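/- **Theorem.** Let $d\ge 1$, let $2\le p\le q<\infty$, let $I\subset\mathbb R$ be a compact interval of positive length, and put $$\alpha = d\Big(1-\frac1p-\frac1q\Big)-\frac2q .$$ Let $\mathcal E$ denote the adjoint restriction (Fourier extension) operator of the paraboloid, $$\mathcal E f(\xi,s)=\int_{|y|\le 1} f(y)\,e^{is|y|^2-i\langle \xi,y\rangle}\,dy,\qquad (\xi,s)\in\mathbb R^d\times\mathbb R,$$ and say that $\mathrm R^*(p\to q)$ holds if $\mathcal E:L^p(\mathbb R^d)\to L^q(\mathbb R^{d+1})$ is bounded. Let $Uf(\cdot,t)=e^{it\Delta}f$ be the Schrödinger propagator, acting on tempered distributions $f$ as the Fourier multiplier operator with symbol $e^{-it|\xi|^2}$, where $\widehat f(\xi)=\int f(y)e^{-i\langle y,\xi\rangle}\,dy$. Let $\psi:\mathbb R^d\to\mathbb R$ be a smooth function supported in $\{1/2\le|\xi|\le 2\}$ with $\sum_{k\ge1}\psi(2^{-k}\xi)=1$ for $|\xi|\ge2$. For $k\ge1$ let $P_k$ be the Fourier multiplier operator with symbol $\psi(2^{-k}\xi)$, and let $P_0=\mathrm{Id}-\sum_{k\ge1}P_k$.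 For $0<\nu<\infty$ let $B^p_{\alpha,\nu}(\mathbb R^d)$ be the Besov space of tempered distributions $f$ with $$\|f\|_{B^p_{\alpha,\nu}}=\Big(\sum_{k\ge0}2^{k\alpha\nu}\|P_kf\|_{L^p(\mathbb R^d)}^\nu\Big)^{1/\nu}<\infty .$$ Then, for every $\nu\in(0,2]$, the following are equivalent: (i) $\mathrm R^*(p\to q)$ holds. (ii) $U:B^p_{\alpha,\nu}(\mathbb R^d)\to L^q(\mathbb R^d\times I)$ is bounded; that is, there is a constant $C$ such that for every $f\in B^p_{\alpha,\nu}(\mathbb R^d)$ there is a function $u\in L^q(\mathbb R^d\times I)$ with $e^{it\Delta}f=u(\cdot,t)$ as tempered distributions for almost every $t\in I$, and $\|u\|_{L^q(\mathbb R^d\times I)}\le C\|f\|_{B^p_{\alpha,\nu}}$. -/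

import Mathlib

open MeasureTheory Set
open scoped ENNReal NNReal ContDiff SchwartzMap RealInnerProductSpace

noncomputable section

/-- The space `ℝ^d` with its Euclidean norm. -/
abbrev Rd (d : ℕ) : Type := EuclideanSpace ℝ (Fin d)

/-- The adjoint restriction (Fourier extension) operator of the paraboloid over the unit ball,
`𝓔 f (ξ, s) = ∫_{|y| ≤ 1} f(y) exp(i s |y|² - i ⟨ξ, y⟩) dy`. -/
def extensionOp {d : ℕ} (f : Rd d → ℂ) (z : Rd d × ℝ) : ℂ :=
  ∫ y in Metric.closedBall (0 : Rd d) 1,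
    f y * Complex.exp (Complex.I * ((z.2 * ‖y‖ ^ 2 - ⟪z.1, y⟫ : ℝ) : ℂ))

/-- `R*(p → q)`: the extension operator is bounded from `L^p(ℝ^d)` to `L^q(ℝ^{d+1})`. -/
def AdjointRestriction (d : ℕ) (p q : ℝ) : Prop :=
  ∃ C : ℝ≥0, ∀ f : Rd d → ℂ, MemLp f (ENNReal.ofReal p) volume →
    MemLp (extensionOp f) (ENNReal.ofReal q) volume ∧
      eLpNorm (extensionOp f) (ENNReal.ofReal q) volume
        ≤ C * eLpNorm f (ENNReal.ofReal p) volume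

/-- The tempered distribution `T` is given by integration against the function `g`. -/
def IsRepresentedBy {d : ℕ} (T : 𝓢'(Rd d, ℂ)) (g : Rd d → ℂ) : Prop :=
  ∀ φ : 𝓢(Rd d, ℂ), Integrable (fun x => φ x * g x) volume ∧ T φ = ∫ x, φ x * g x

/-- The `L^p` norm of a tempered distribution: the `L^p` norm of the (a.e. unique) function in
`L^p` that represents it, and `∞` if there is no such function. -/
def distLpNorm {d : ℕ} (p : ℝ) (T : 𝓢'(Rd d, ℂ)) : ℝ≥0∞ :=
  ⨅ (g : Rd d → ℂ) (_ : MemLp g (ENNReal.ofReal p) volume ∧ IsRepresentedBy T g),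
    eLpNorm g (ENNReal.ofReal p) volume

/-- The Fourier multiplier operator `m(D)` on tempered distributions, for a smooth symbol `m` of
temperate growth and for the Fourier transform `f ↦ ∫ f(y) exp(-i ⟨y, ξ⟩) dy`. Mathlib's Fourier
transform has the phase `-2πi ⟨y, ξ⟩`; this accounts for the factor `2π`. -/
def multiplierOp {d : ℕ} (m : Rd d → ℂ) : 𝓢'(Rd d, ℂ) →L[ℂ] 𝓢'(Rd d, ℂ) :=
  TemperedDistribution.fourierMultiplierCLM ℂ (fun ξ => m ((2 * Real.pi) • ξ))

/-- `ψ` generates an inhomogeneous dyadic decomposition of frequency space: it is smooth, supported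
in `{1/2 ≤ |ξ| ≤ 2}`, and `∑_{k ≥ 1} ψ(2^{-k} ξ) = 1` for `|ξ| ≥ 2`. -/
structure IsDyadicCutoff {d : ℕ} (ψ : Rd d → ℝ) : Prop where
  smooth : ContDiff ℝ ∞ ψ
  support : ∀ ξ, ψ ξ ≠ 0 → 1 / 2 ≤ ‖ξ‖ ∧ ‖ξ‖ ≤ 2
  sum_eq_one : ∀ ξ, 2 ≤ ‖ξ‖ → ∑' k : ℕ, ψ (((2 : ℝ) ^ (k + 1))⁻¹ • ξ) = 1

/-- The symbol of the frequency localization `P_k`: it is `ψ(2^{-k} ξ)` for `k ≥ 1`, and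
`1 - ∑_{k ≥ 1} ψ(2^{-k} ξ)` for `k = 0`. -/
def dyadicSymbol {d : ℕ} (ψ : Rd d → ℝ) : ℕ → Rd d → ℂ
  | 0, ξ => ((1 - ∑' k : ℕ, ψ (((2 : ℝ) ^ (k + 1))⁻¹ • ξ) : ℝ) : ℂ)
  | k + 1, ξ => (ψ (((2 : ℝ) ^ (k + 1))⁻¹ • ξ) : ℂ)

/-- The Besov (quasi-)norm `(∑_{k ≥ 0} 2^{kαν} ‖P_k f‖_p^ν)^{1/ν}` of a tempered distribution; the
Besov space `B^p_{α,ν}` consists of those `f` for which it is finite. -/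
def besovNorm {d : ℕ} (ψ : Rd d → ℝ) (p α ν : ℝ) (f : 𝓢'(Rd d, ℂ)) : ℝ≥0∞ :=
  (∑' k : ℕ, (2 : ℝ≥0∞) ^ ((k : ℝ) * α * ν) *
    distLpNorm p (multiplierOp (dyadicSymbol ψ k) f) ^ ν) ^ (1 / ν)

/-- The Schrödinger propagator `e^{itΔ}` on tempered distributions, with symbol `e^{-it|ξ|²}`. -/
def schrodinger {d : ℕ} (t : ℝ) : 𝓢'(Rd d, ℂ) →L[ℂ] 𝓢'(Rd d, ℂ) :=
  multiplierOp (fun ξ => Complex.exp (-Complex.I * ((t * ‖ξ‖ ^ 2 : ℝ) : ℂ)))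

/-- `U : f ↦ e^{itΔ} f` is bounded from `B^p_{α,ν}(ℝ^d)` to `L^q(ℝ^d × [a, b])`: for every `f` in
the Besov space, `(x, t) ↦ e^{itΔ} f(x)` is a function in `L^q(ℝ^d × [a, b])`, with norm at most a
constant times the Besov norm of `f`. -/
def SchrodingerBounded (d : ℕ) (ψ : Rd d → ℝ) (p q α ν a b : ℝ) : Prop :=
  ∃ C : ℝ≥0, ∀ f : 𝓢'(Rd d, ℂ), besovNorm ψ p α ν f < ⊤ →
    ∃ u : Rd d × ℝ → ℂ,
      MemLp u (ENNReal.ofReal q) (volume.prod (volume.restrict (Icc a b))) ∧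
      (∀ᵐ t ∂(volume.restrict (Icc a b)),
        IsRepresentedBy (schrodinger t f) (fun x => u (x, t))) ∧
      eLpNorm u (ENNReal.ofReal q) (volume.prod (volume.restrict (Icc a b)))
        ≤ C * besovNorm ψ p α ν f

end

/-! Both statements concern the same oscillatory integral. By the dispersive formula, the evolution
of `H` at time `t` is, up to unimodular factors and a power of `|t|`, the extension of the rescaled
datum `y ↦ H (ρ y)` at the pseudoconformal point `(ρ x / 2t, ρ² / 4t)`: the datum in physical space
plays the part of the density on the paraboloid.

From (i) to (ii). For a datum supported in a ball of radius comparable to `N` and an evolution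
truncated to bounded frequencies, R* yields a bound over times in `[N, 2N]` with constant `N^{d(1/2
- 1/p)}` (`lintegral_cv_le_of_support`). Non-stationary phase limits propagation during this time to
distances `O(N)`, so a general datum may be cut into such balls, and `p ≤ q` lets the local bounds
be summed (`lintegral_cv_dyadic_le`). If `p > 2`, the dyadic time intervals add up geometrically; if
`p = 2`, the estimate is global in time and follows from Plancherel. Parabolic scaling converts the
growth in `N` into the loss `2^{kα}` at frequency `2^k`.

The frequencies are then recombined at fixed time by `nq_sum_sq_le`: for frequency localized
functions and `q ≥ 2`, `‖∑ g_k‖_q² ≲ ∑ ‖g_k‖_q²`. It is proved without singular integrals. Expand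
`‖F + g_m‖_q^q` to second order, where `F` is the sum of the lower frequencies; the linear term
gains `2^{-(m-j)}` against `g_j`, because `g_m` is reproduced by a mean zero kernel of width
`2^{-m}` while `g_j` varies on the scale `2^{-j}`. Minkowski in `L^{q/2}` of time and `ℓ^ν ⊂ ℓ²`
finish the estimate.

From (ii) to (i). Fix an interior time `t₀ ≠ 0` and test on `h(x/2^n) e^{-i|x|²/4t₀}`, which focuses
at `t₀` and, for `h` supported in an annulus, has frequencies about `2^n`. In pseudoconformal
coordinates centred at `t₀` the truncated evolution is an average of the extension of `h`, and `α`
is the exponent for which all powers of `2^n` cancel (`lintegral_averagedExt_le`). As `n → ∞` the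
averages converge to the extension of `h`, the time windows exhaust the line, and Fatou's lemma
gives R* for the annulus. Galilean invariance moves the unit ball into it. -/

section

variable {d : ℕ}

/-! ### Weighted Jensen and Young inequalities for nonnegative functions -/

/-- Jensen's inequality for a weight of finite or infinite mass. -/
theorem lintegral_mul_rpow_le {α : Type*} [MeasurableSpace α] {μ : Measure α} {w F : α → ℝ≥0∞}
    (hw : AEMeasurable w μ) (hF : AEMeasurable F μ) {q : ℝ} (hq : 1 ≤ q) :
    (∫⁻ y, w y * F y ∂μ) ^ q ≤ (∫⁻ y, w y ∂μ) ^ (q - 1) * ∫⁻ y, w y * F y ^ q ∂μ := by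
  have hq0 : 0 < q := by linarith
  have h1 : 0 ≤ 1 - 1 / q := by
    rw [sub_nonneg, div_le_one hq0]; exact hq
  have h2 : 0 ≤ 1 / q := by positivity
  -- Hölder for the splitting `w F = w^(1 - 1/q) (w F^q)^(1/q)`.
  have key := ENNReal.lintegral_mul_norm_pow_le (μ := μ) hw (hw.mul (hF.pow_const q)) h1 h2
    (by ring)
  have e : ∀ y, w y ^ (1 - 1 / q) * (w y * F y ^ q) ^ (1 / q) = w y * F y := by
    intro y
    rw [ENNReal.mul_rpow_of_nonneg _ _ h2, ← mul_assoc, ← ENNReal.rpow_add_of_nonneg _ _ h1 h2,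
      ← ENNReal.rpow_mul]
    have : q * (1 / q) = 1 := by field_simp
    rw [this]; simp
  simp only [Pi.mul_apply, e] at key
  calc (∫⁻ y, w y * F y ∂μ) ^ q
      ≤ ((∫⁻ y, w y ∂μ) ^ (1 - 1 / q) * (∫⁻ y, w y * F y ^ q ∂μ) ^ (1 / q)) ^ q :=
        ENNReal.rpow_le_rpow key hq0.le
    _ = _ := by
        rw [ENNReal.mul_rpow_of_nonneg _ _ hq0.le, ← ENNReal.rpow_mul, ← ENNReal.rpow_mul]
        congr 2
        · field_simp
        · rw [show 1 / q * q = 1 by field_simp]; simp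


theorem lintegral_mul_sub_le {w F : Rd d → ℝ≥0∞} (hw : Measurable w) (hF : AEMeasurable F)
    {q : ℝ} (hq : 1 ≤ q) (x : Rd d) :
    (∫⁻ y, w (x - y) * F y) ^ q ≤ (∫⁻ y, w y) ^ (q - 1) * ∫⁻ y, w (x - y) * F y ^ q := by
  refine (lintegral_mul_rpow_le (μ := volume) (w := fun y => w (x - y))
    (hw.comp (by fun_prop)).aemeasurable hF hq).trans ?_
  rw [lintegral_sub_left_eq_self (fun y => w y) x]

/-- Young's inequality `L¹ * L^q → L^q`. -/
theorem lintegral_conv_rpow_le {w F : Rd d → ℝ≥0∞} (hw : Measurable w) (hF : AEMeasurable F)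
    {q : ℝ} (hq : 1 ≤ q) :
    ∫⁻ x, (∫⁻ y, w (x - y) * F y) ^ q ≤ (∫⁻ y, w y) ^ q * ∫⁻ y, F y ^ q := by
  have hq0 : 0 < q := by linarith
  have hwF : AEMeasurable (fun p : Rd d × Rd d => w (p.1 - p.2) * F p.2 ^ q)
      (volume.prod volume) := by
    refine AEMeasurable.mul (hw.comp (by fun_prop)).aemeasurable ?_
    exact ((hF.pow_const q).comp_quasiMeasurePreserving Measure.quasiMeasurePreserving_snd)
  calc ∫⁻ x, (∫⁻ y, w (x - y) * F y) ^ q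
      ≤ ∫⁻ x, (∫⁻ y, w y) ^ (q - 1) * ∫⁻ y, w (x - y) * F y ^ q :=
        lintegral_mono fun x => lintegral_mul_sub_le hw hF hq x
    _ = (∫⁻ y, w y) ^ (q - 1) * ∫⁻ x, ∫⁻ y, w (x - y) * F y ^ q := by
        rw [lintegral_const_mul'' _ hwF.lintegral_prod_right']
    _ = (∫⁻ y, w y) ^ (q - 1) * ∫⁻ y, ∫⁻ x, w (x - y) * F y ^ q := by
        rw [lintegral_lintegral_swap hwF]
    _ = (∫⁻ y, w y) ^ (q - 1) * ∫⁻ y, (∫⁻ x, w x) * F y ^ q := by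
        congr 1
        refine lintegral_congr fun y => ?_
        rw [lintegral_mul_const _ (f := fun x => w (x - y)) (hw.comp (by fun_prop)),
          lintegral_sub_right_eq_self]
    _ = (∫⁻ y, w y) ^ q * ∫⁻ y, F y ^ q := by
        rw [lintegral_const_mul'' _ (hF.pow_const q), ← mul_assoc]
        congr 1
        nth_rewrite 2 [← ENNReal.rpow_one (∫⁻ y, w y)]
        rw [← ENNReal.rpow_add_of_nonneg _ _ (by linarith) zero_le_one, sub_add_cancel]

/-- The pointwise endpoint: after Jensen, the kernel remaining in the integral is replaced by its
supremum. -/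
theorem conv_rpow_le_of_le {w F : Rd d → ℝ≥0∞} (hw : Measurable w) (hF : AEMeasurable F)
    {W : ℝ≥0∞} (hW : ∀ x, w x ≤ W) {q : ℝ} (hq : 1 ≤ q) (x : Rd d) :
    (∫⁻ y, w (x - y) * F y) ^ q ≤ (∫⁻ y, w y) ^ (q - 1) * W * ∫⁻ y, F y ^ q := by
  refine (lintegral_mul_sub_le hw hF hq x).trans ?_
  rw [mul_assoc, ← lintegral_const_mul'' _ (hF.pow_const q)]
  gcongr
  exact hW _

/-- A bounded integrable kernel maps `L^p` to `L^q` for `p ≤ q`. -/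
theorem lintegral_conv_rpow_le_of_le {w F : Rd d → ℝ≥0∞} (hw : Measurable w)
    (hF : AEMeasurable F) {W : ℝ≥0∞} (hW : ∀ x, w x ≤ W) {p q : ℝ} (hp : 1 ≤ p) (hpq : p ≤ q) :
    ∫⁻ x, (∫⁻ y, w (x - y) * F y) ^ q
      ≤ ((∫⁻ y, w y) ^ (p - 1) * W) ^ (q / p - 1) * (∫⁻ y, w y) ^ p *
        (∫⁻ y, F y ^ p) ^ (q / p) := by
  have hp0 : 0 < p := by linarith
  have hr : 0 ≤ q / p - 1 := by rw [sub_nonneg, le_div_iff₀ hp0]; linarith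
  have hm : AEMeasurable (fun x : Rd d => (∫⁻ y, w (x - y) * F y) ^ p) := by
    refine AEMeasurable.pow_const (AEMeasurable.lintegral_prod_right'
      (f := fun z : Rd d × Rd d => w (z.1 - z.2) * F z.2) ?_) p
    refine AEMeasurable.mul (hw.comp (by fun_prop)).aemeasurable ?_
    exact hF.comp_quasiMeasurePreserving Measure.quasiMeasurePreserving_snd
  -- The excess power `q - p` is absorbed by the pointwise bound; the remaining `p`-th power is
  -- integrated by Young's inequality.
  calc ∫⁻ x, (∫⁻ y, w (x - y) * F y) ^ q
      = ∫⁻ x, ((∫⁻ y, w (x - y) * F y) ^ p) ^ (q / p - 1) * (∫⁻ y, w (x - y) * F y) ^ p := by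
        refine lintegral_congr fun x => ?_
        rw [← ENNReal.rpow_mul, ← ENNReal.rpow_add_of_nonneg _ _ (by positivity) hp0.le]
        congr 1
        field_simp
        ring
    _ ≤ ∫⁻ x, ((∫⁻ y, w y) ^ (p - 1) * W * ∫⁻ y, F y ^ p) ^ (q / p - 1)
          * (∫⁻ y, w (x - y) * F y) ^ p := by
        refine lintegral_mono fun x => ?_
        gcongr
        exact conv_rpow_le_of_le hw hF hW hp x
    _ = ((∫⁻ y, w y) ^ (p - 1) * W * ∫⁻ y, F y ^ p) ^ (q / p - 1)
          * ∫⁻ x, (∫⁻ y, w (x - y) * F y) ^ p := by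
        rw [lintegral_const_mul'' _ hm]
    _ ≤ ((∫⁻ y, w y) ^ (p - 1) * W * ∫⁻ y, F y ^ p) ^ (q / p - 1)
          * ((∫⁻ y, w y) ^ p * ∫⁻ y, F y ^ p) := by
        gcongr
        exact lintegral_conv_rpow_le hw hF hp
    _ = _ := by
        rw [ENNReal.mul_rpow_of_nonneg _ _ hr]
        have : (∫⁻ y, F y ^ p) ^ (q / p)
            = (∫⁻ y, F y ^ p) ^ (q / p - 1) * ∫⁻ y, F y ^ p := by
          conv_rhs => rw [← ENNReal.rpow_one (∫⁻ y, F y ^ p), ← ENNReal.rpow_mul, one_mul]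
          rw [← ENNReal.rpow_add_of_nonneg _ _ hr zero_le_one]
          simp
        rw [this]
        ring

/-! ### Convolutions of functions and `L^p` norms with real exponents -/

/-- Convolution `∫ k(x - y) g(y) dy`, written as an explicit integral. -/
noncomputable def cv (k g : Rd d → ℂ) (x : Rd d) : ℂ := ∫ y, k (x - y) * g y

theorem enorm_cv_le (k g : Rd d → ℂ) (x : Rd d) :
    ‖cv k g x‖ₑ ≤ ∫⁻ y, ‖k (x - y)‖ₑ * ‖g y‖ₑ := by
  refine (enorm_integral_le_lintegral_enorm _).trans_eq ?_
  simp [enorm_mul]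

theorem cv_eq_integral_mul_sub (k g : Rd d → ℂ) (x : Rd d) :
    cv k g x = ∫ y, k y * g (x - y) := by
  rw [cv, ← integral_sub_left_eq_self _ volume x]
  simp

theorem lintegral_cv_rpow_le {k g : Rd d → ℂ} (hk : Measurable k)
    (hg : AEStronglyMeasurable g volume) {q : ℝ} (hq : 1 ≤ q) :
    ∫⁻ x, ‖cv k g x‖ₑ ^ q ≤ (∫⁻ y, ‖k y‖ₑ) ^ q * ∫⁻ y, ‖g y‖ₑ ^ q := by
  refine le_trans (lintegral_mono fun x => ?_) (lintegral_conv_rpow_le hk.enorm hg.enorm hq)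
  gcongr
  exact enorm_cv_le k g x

/-- An `L^p` function times a bounded integrable kernel is integrable. -/
theorem integrable_kernel_mul {k g : Rd d → ℂ} (hk : Measurable k)
    (hki : ∫⁻ y, ‖k y‖ₑ ≠ ⊤) {W : ℝ≥0∞} (hW : ∀ x, ‖k x‖ₑ ≤ W) (hWt : W ≠ ⊤)
    (hg : AEStronglyMeasurable g volume) {p : ℝ} (hp : 1 ≤ p) (hgp : ∫⁻ y, ‖g y‖ₑ ^ p ≠ ⊤)
    (x : Rd d) : Integrable (fun y => k (x - y) * g y) := by
  refine ⟨(hk.comp (by fun_prop)).aestronglyMeasurable.mul hg, ?_⟩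
  have hp0 : 0 < p := by linarith
  have := conv_rpow_le_of_le hk.enorm hg.enorm hW hp x
  rw [hasFiniteIntegral_iff_enorm]
  simp only [enorm_mul]
  by_contra hcon
  rw [not_lt, top_le_iff] at hcon
  rw [hcon, ENNReal.top_rpow_of_pos hp0, top_le_iff] at this
  exact (ENNReal.mul_ne_top (ENNReal.mul_ne_top
    (ENNReal.rpow_ne_top_of_nonneg (by linarith) hki) hWt) hgp) this

theorem eLpNorm_ofReal_eq {α F : Type*} [MeasurableSpace α] {μ : Measure α}
    [NormedAddCommGroup F] {f : α → F} {p : ℝ} (hp : 0 < p) :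
    eLpNorm f (ENNReal.ofReal p) μ = (∫⁻ x, ‖f x‖ₑ ^ p ∂μ) ^ (1 / p) := by
  rw [eLpNorm_eq_lintegral_rpow_enorm_toReal (by simpa using hp) ENNReal.ofReal_ne_top,
    ENNReal.toReal_ofReal hp.le]

theorem eLpNorm_ofReal_rpow {α F : Type*} [MeasurableSpace α] {μ : Measure α}
    [NormedAddCommGroup F] {f : α → F} {p : ℝ} (hp : 0 < p) :
    eLpNorm f (ENNReal.ofReal p) μ ^ p = ∫⁻ x, ‖f x‖ₑ ^ p ∂μ := by
  rw [eLpNorm_ofReal_eq hp, ← ENNReal.rpow_mul, one_div_mul_cancel hp.ne', ENNReal.rpow_one]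

theorem memLp_ofReal_iff {α F : Type*} [MeasurableSpace α] {μ : Measure α}
    [NormedAddCommGroup F] {f : α → F} {p : ℝ} (hp : 0 < p) :
    MemLp f (ENNReal.ofReal p) μ ↔ AEStronglyMeasurable f μ ∧ ∫⁻ x, ‖f x‖ₑ ^ p ∂μ ≠ ⊤ := by
  rw [MemLp, eLpNorm_ofReal_eq hp, ENNReal.rpow_lt_top_iff_of_pos (by positivity), lt_top_iff_ne_top]

/-! ### The duality map and the second order expansion of the `L^q` norm -/

/-- The duality map `z ↦ |z|^{q-2} z̄` of `L^q`. -/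
noncomputable def dualPow (q : ℝ) (z : ℂ) : ℂ := ((‖z‖ ^ (q - 2) : ℝ) : ℂ) * (starRingEnd ℂ) z

theorem norm_dualPow (q : ℝ) (z : ℂ) : ‖dualPow q z‖ = ‖z‖ ^ (q - 2) * ‖z‖ := by
  rw [dualPow, norm_mul, Complex.norm_real, Real.norm_of_nonneg (by positivity), RCLike.norm_conj]

@[simp] theorem dualPow_zero (q : ℝ) : dualPow q 0 = 0 := by simp [dualPow]

theorem continuous_dualPow {q : ℝ} (hq : 2 ≤ q) : Continuous (dualPow q) := by
  unfold dualPow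
  refine Continuous.mul (Complex.continuous_ofReal.comp ?_) Complex.continuous_conj
  exact continuous_norm.rpow_const fun x => Or.inr (by linarith)

/-- Bernoulli's inequality with exponent `r + 1` at the point `y / x`. The factor `y` in front makes
the bound valid also for `r < 1`, when `r`-th powers are not Lipschitz at the origin. -/
theorem mul_rpow_sub_rpow_le {x y r : ℝ} (hy : 0 ≤ y) (hyx : y ≤ x) (hr : 0 ≤ r) :
    y * (x ^ r - y ^ r) ≤ (r + 1) * x ^ r * (x - y) := by
  rcases (hy.trans hyx).eq_or_lt with hx | hx
  · have : y = 0 := le_antisymm (hx ▸ hyx) hy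
    subst this; simp [← hx]
  have hB := one_add_mul_self_le_rpow_one_add (s := y / x - 1) (p := r + 1)
    (by linarith [div_nonneg hy hx.le]) (by linarith)
  rw [add_sub_cancel, Real.div_rpow hy hx.le, Real.rpow_add_one' hy (by linarith),
    Real.rpow_add_one hx.ne'] at hB
  have hxr : 0 < x ^ r := Real.rpow_pos_of_pos hx r
  have h3 : (1 + (r + 1) * (y / x - 1)) * (x ^ r * x) ≤ y ^ r * y := by
    rwa [le_div_iff₀ (by positivity)] at hB
  have h4 : (1 + (r + 1) * (y / x - 1)) * (x ^ r * x) = x ^ r * x + (r + 1) * x ^ r * (y - x) := by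
    field_simp
  nlinarith [mul_le_mul_of_nonneg_left hyx hxr.le]

/-- The difference splits into a change of the argument, with weight `‖z‖^(q-2)`, and a change of
the weight, multiplied by the conjugate of `w`. Ordering the norms so that `w` is the smaller one
makes `mul_rpow_sub_rpow_le` applicable to the second part. -/
theorem norm_dualPow_sub_le {q : ℝ} (hq : 2 ≤ q) (z w : ℂ) :
    ‖dualPow q z - dualPow q w‖ ≤ q * (‖z‖ + ‖w‖) ^ (q - 2) * ‖z - w‖ := by
  wlog h : ‖w‖ ≤ ‖z‖ generalizing z w
  · rw [norm_sub_rev, norm_sub_rev z, add_comm]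
    exact this w z (le_of_not_ge h)
  have hr : 0 ≤ q - 2 := by linarith
  have e : dualPow q z - dualPow q w = ((‖z‖ ^ (q - 2) : ℝ) : ℂ) * (starRingEnd ℂ) (z - w)
      + ((‖z‖ ^ (q - 2) - ‖w‖ ^ (q - 2) : ℝ) : ℂ) * (starRingEnd ℂ) w := by
    simp only [dualPow, map_sub, Complex.ofReal_sub]; ring
  have h0 : ‖w‖ ^ (q - 2) ≤ ‖z‖ ^ (q - 2) := Real.rpow_le_rpow (norm_nonneg _) h hr
  calc ‖dualPow q z - dualPow q w‖
      ≤ ‖z‖ ^ (q - 2) * ‖z - w‖ + (‖z‖ ^ (q - 2) - ‖w‖ ^ (q - 2)) * ‖w‖ := by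
        rw [e]
        refine (norm_add_le _ _).trans_eq ?_
        rw [norm_mul, norm_mul, Complex.norm_real, Complex.norm_real, RCLike.norm_conj,
          RCLike.norm_conj, Real.norm_of_nonneg (by positivity),
          Real.norm_of_nonneg (by linarith)]
    _ ≤ ‖z‖ ^ (q - 2) * ‖z - w‖ + (q - 2 + 1) * ‖z‖ ^ (q - 2) * ‖z - w‖ := by
        have h1 := mul_rpow_sub_rpow_le (norm_nonneg w) h hr
        have h2 : ‖z‖ - ‖w‖ ≤ ‖z - w‖ := norm_sub_norm_le z w
        have h3 : (q - 2 + 1) * ‖z‖ ^ (q - 2) * (‖z‖ - ‖w‖)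
            ≤ (q - 2 + 1) * ‖z‖ ^ (q - 2) * ‖z - w‖ := by gcongr
        linarith
    _ = q * ‖z‖ ^ (q - 2) * ‖z - w‖ := by ring
    _ ≤ _ := by
        gcongr
        linarith [norm_nonneg w]

/-- Second order Taylor estimate for `|·|^q`, `q ≥ 2`. -/
theorem norm_add_rpow_le {q : ℝ} (hq : 2 ≤ q) (a b : ℂ) :
    ‖a + b‖ ^ q ≤ ‖a‖ ^ q + q * (dualPow q a * b).re
      + q * q * 2 ^ (q - 2) * ((‖a‖ + ‖b‖) ^ (q - 2) * ‖b‖ ^ 2) := by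
  have hd : ∀ s : ℝ, HasDerivAt (fun s : ℝ => ‖a + s • b‖ ^ q)
      (q * (dualPow q (a + s • b) * b).re) s := by
    intro s
    have h1 : HasDerivAt (fun s : ℝ => a + s • b) b s := by
      simpa using ((hasDerivAt_id s).smul_const b).const_add a
    have h2 := (hasFDerivAt_norm_rpow (a + s • b) (p := q) (by linarith)).comp_hasDerivAt s h1
    refine h2.congr_deriv ?_
    simp only [smul_apply, innerSL_apply_apply, smul_eq_mul, dualPow,
      mul_assoc, Complex.re_ofReal_mul, Complex.inner]
    rw [mul_comm b]
  -- Mean value theorem along `s ↦ a + s b`. Replacing the derivative at the intermediate point by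
  -- the one at `0` costs a second factor `‖b‖`, by the Lipschitz bound for `dualPow`.
  obtain ⟨s, hs, hse⟩ := exists_hasDerivAt_eq_slope (fun s : ℝ => ‖a + s • b‖ ^ q) _ zero_lt_one
    (fun s _ => (hd s).continuousAt.continuousWithinAt) (fun s _ => hd s)
  simp only [one_smul, zero_smul, add_zero, sub_zero, div_one] at hse
  have h3 : (dualPow q (a + s • b) * b).re ≤ (dualPow q a * b).re
      + q * 2 ^ (q - 2) * ((‖a‖ + ‖b‖) ^ (q - 2) * ‖b‖ ^ 2) := by
    have h4 : ((dualPow q (a + s • b) - dualPow q a) * b).re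
        ≤ ‖(dualPow q (a + s • b) - dualPow q a)‖ * ‖b‖ :=
      (Complex.re_le_norm _).trans (norm_mul_le _ _)
    have h5 := norm_dualPow_sub_le hq (a + s • b) a
    have hsb : ‖s • b‖ ≤ ‖b‖ := by
      rw [norm_smul, Real.norm_of_nonneg hs.1.le]
      exact mul_le_of_le_one_left (norm_nonneg _) hs.2.le
    have h6 : (‖a + s • b‖ + ‖a‖) ^ (q - 2) ≤ 2 ^ (q - 2) * (‖a‖ + ‖b‖) ^ (q - 2) := by
      rw [← Real.mul_rpow (by norm_num) (by positivity)]
      refine Real.rpow_le_rpow (by positivity) ?_ (by linarith)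
      linarith [norm_add_le a (s • b), norm_nonneg b]
    rw [add_sub_cancel_left] at h5
    have h7 : ‖dualPow q (a + s • b) - dualPow q a‖ * ‖b‖
        ≤ q * (2 ^ (q - 2) * (‖a‖ + ‖b‖) ^ (q - 2)) * ‖b‖ * ‖b‖ := by
      gcongr
      refine h5.trans ?_
      gcongr
    rw [sub_mul, Complex.sub_re] at h4
    nlinarith
  have : ‖a + b‖ ^ q = ‖a‖ ^ q + q * (dualPow q (a + s • b) * b).re := by linarith
  rw [this]
  nlinarith

/-- Hölder's inequality with exponents `q/(q-2), q, q`. -/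
theorem lintegral_rpow_mul_mul_le {α : Type*} [MeasurableSpace α] {μ : Measure α}
    {A B D : α → ℝ≥0∞} (hA : AEMeasurable A μ) (hB : AEMeasurable B μ) (hD : AEMeasurable D μ)
    {q : ℝ} (hq : 2 ≤ q) :
    ∫⁻ x, A x ^ (q - 2) * B x * D x ∂μ
      ≤ ((∫⁻ x, A x ^ q ∂μ) ^ (1 / q)) ^ (q - 2) * (∫⁻ x, B x ^ q ∂μ) ^ (1 / q)
        * (∫⁻ x, D x ^ q ∂μ) ^ (1 / q) := by
  have hq0 : 0 < q := by linarith
  have key := ENNReal.lintegral_prod_norm_pow_le (μ := μ) (Finset.univ : Finset (Fin 3))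
    (f := ![fun x => A x ^ q, fun x => B x ^ q, fun x => D x ^ q])
    (p := ![(q - 2) / q, 1 / q, 1 / q])
    (by intro i _; fin_cases i
        · exact hA.pow_const q
        · exact hB.pow_const q
        · exact hD.pow_const q)
    (by simp [Fin.sum_univ_three]; field_simp; ring)
    (by intro i _; fin_cases i
        · exact div_nonneg (by linarith) hq0.le
        · exact (one_div_pos.2 hq0).le
        · exact (one_div_pos.2 hq0).le)
  simp only [Fin.prod_univ_three, Matrix.cons_val_zero, Matrix.cons_val_one,
    Matrix.cons_val] at key
  have e1 : q * (1 / q) = 1 := by field_simp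
  have e2 : q * ((q - 2) / q) = q - 2 := by field_simp
  have e3 : 1 / q * (q - 2) = (q - 2) / q := by ring
  simp only [← ENNReal.rpow_mul, e1, e2, ENNReal.rpow_one] at key
  rw [← ENNReal.rpow_mul, e3]
  exact key


/-- The `L^q` norm on `ℝ^d`, for a real exponent. -/
noncomputable abbrev nq (q : ℝ) (f : Rd d → ℂ) : ℝ≥0∞ := eLpNorm f (ENNReal.ofReal q) volume

theorem nq_eq {q : ℝ} (hq : 0 < q) (f : Rd d → ℂ) :
    nq q f = (∫⁻ x, ‖f x‖ₑ ^ q) ^ (1 / q) := eLpNorm_ofReal_eq hq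

theorem one_le_ofReal_of_two_le {q : ℝ} (hq : 2 ≤ q) : 1 ≤ ENNReal.ofReal q := by
  rw [ENNReal.one_le_ofReal]; linarith

theorem lintegral_add_enorm_rpow_le {q : ℝ} (hq : 2 ≤ q) {F g : Rd d → ℂ}
    (hF : AEStronglyMeasurable F volume) (hg : AEStronglyMeasurable g volume) :
    (∫⁻ x, (‖F x‖ₑ + ‖g x‖ₑ) ^ q) ^ (1 / q) ≤ nq q F + nq q g := by
  have h := eLpNorm_add_le hF.norm hg.norm (one_le_ofReal_of_two_le hq)
  rw [eLpNorm_norm, eLpNorm_norm, eLpNorm_ofReal_eq (by linarith)] at h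
  refine le_of_eq_of_le ?_ h
  congr 1
  refine lintegral_congr fun x => ?_
  congr 1
  simp only [Pi.add_apply]
  rw [Real.enorm_of_nonneg (by positivity), ENNReal.ofReal_add (by positivity) (by positivity)]
  simp

theorem enorm_dualPow_mul_le {q : ℝ} (hq : 2 ≤ q) (z w : ℂ) :
    ‖dualPow q z * w‖ₑ ≤ ‖z‖ₑ ^ (q - 2) * ‖z‖ₑ * ‖w‖ₑ := by
  rw [enorm_mul]
  gcongr
  rw [← ofReal_norm, norm_dualPow, ENNReal.ofReal_mul (by positivity),
    ← ENNReal.ofReal_rpow_of_nonneg (by positivity) (by linarith), ofReal_norm]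

theorem enorm_dualPow_sub_le {q : ℝ} (hq : 2 ≤ q) (z w : ℂ) :
    ‖dualPow q z - dualPow q w‖ₑ
      ≤ ENNReal.ofReal q * (‖z‖ₑ + ‖w‖ₑ) ^ (q - 2) * ‖z - w‖ₑ := by
  rw [← ofReal_norm]
  refine (ENNReal.ofReal_le_ofReal (norm_dualPow_sub_le hq z w)).trans_eq ?_
  rw [ENNReal.ofReal_mul (by positivity), ENNReal.ofReal_mul (by positivity),
    ← ENNReal.ofReal_rpow_of_nonneg (by positivity) (by linarith),
    ENNReal.ofReal_add (by positivity) (by positivity), ofReal_norm, ofReal_norm, ofReal_norm]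

theorem nq_comp_add_right (q : ℝ) {f : Rd d → ℂ} (hf : AEStronglyMeasurable f volume) (y : Rd d) :
    nq q (fun x => f (x + y)) = nq q f :=
  eLpNorm_comp_measurePreserving hf (measurePreserving_add_right volume y)

theorem lintegral_dualPow_mul_le {q : ℝ} (hq : 2 ≤ q) {F g : Rd d → ℂ}
    (hF : AEStronglyMeasurable F volume) (hg : AEStronglyMeasurable g volume) :
    ∫⁻ x, ‖dualPow q (F x) * g x‖ₑ ≤ nq q F ^ (q - 2) * nq q F * nq q g := by
  simp only [nq_eq (show 0 < q by linarith)]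
  refine (lintegral_mono fun x => enorm_dualPow_mul_le hq (F x) (g x)).trans ?_
  exact lintegral_rpow_mul_mul_le hF.enorm hF.enorm hg.enorm hq

theorem integrable_dualPow_mul {q : ℝ} (hq : 2 ≤ q) {F g : Rd d → ℂ}
    (hF : MemLp F (ENNReal.ofReal q) volume) (hg : MemLp g (ENNReal.ofReal q) volume) :
    Integrable (fun x => dualPow q (F x) * g x) := by
  refine ⟨((continuous_dualPow hq).comp_aestronglyMeasurable hF.1).mul hg.1, ?_⟩
  refine (lintegral_dualPow_mul_le hq hF.1 hg.1).trans_lt ?_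
  refine ENNReal.mul_lt_top (ENNReal.mul_lt_top ?_ hF.2) hg.2
  exact ENNReal.rpow_lt_top_of_nonneg (by linarith) hF.2.ne

/-- The integrated form of `norm_add_rpow_le`. The linear term is kept as an integral, because the
oscillation of `g` against `F` is exploited there; only the quadratic remainder is estimated by
Hölder. -/
theorem lintegral_norm_add_rpow_le {q : ℝ} (hq : 2 ≤ q) {F g : Rd d → ℂ}
    (hF : MemLp F (ENNReal.ofReal q) volume) (hg : MemLp g (ENNReal.ofReal q) volume) :
    nq q (F + g) ^ q ≤ nq q F ^ q + ENNReal.ofReal q * ‖∫ x, dualPow q (F x) * g x‖ₑ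
      + ENNReal.ofReal (q * q * 2 ^ (q - 2)) * ((nq q F + nq q g) ^ (q - 2) * nq q g * nq q g) := by
  have hq0 : 0 < q := by linarith
  have hint : ∀ {f : Rd d → ℂ}, MemLp f (ENNReal.ofReal q) volume →
      Integrable (fun x => ‖f x‖ ^ q) := by
    intro f hf
    have := hf.integrable_norm_rpow (by simpa using hq0) ENNReal.ofReal_ne_top
    rwa [ENNReal.toReal_ofReal hq0.le] at this
  have hnq : ∀ {f : Rd d → ℂ}, MemLp f (ENNReal.ofReal q) volume →
      nq q f ^ q = ENNReal.ofReal (∫ x, ‖f x‖ ^ q) := by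
    intro f hf
    rw [eLpNorm_ofReal_rpow hq0, ofReal_integral_eq_lintegral_ofReal (hint hf)
      (Filter.Eventually.of_forall fun x => by positivity)]
    refine lintegral_congr fun x => ?_
    rw [← ENNReal.ofReal_rpow_of_nonneg (norm_nonneg _) hq0.le, ofReal_norm]
  set R : Rd d → ℝ := fun x => (‖F x‖ + ‖g x‖) ^ (q - 2) * ‖g x‖ ^ 2 with hR
  have hRle : ∫⁻ x, ENNReal.ofReal (R x) ≤ (nq q F + nq q g) ^ (q - 2) * nq q g * nq q g := by
    have e : ∀ x, ENNReal.ofReal (R x) = (‖F x‖ₑ + ‖g x‖ₑ) ^ (q - 2) * ‖g x‖ₑ * ‖g x‖ₑ := by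
      intro x
      simp only [hR]
      rw [ENNReal.ofReal_mul (by positivity),
        ← ENNReal.ofReal_rpow_of_nonneg (by positivity) (by linarith),
        ENNReal.ofReal_add (by positivity) (by positivity), ofReal_norm, ofReal_norm, pow_two,
        ENNReal.ofReal_mul (by positivity), ofReal_norm, mul_assoc]
    simp only [e]
    refine (lintegral_rpow_mul_mul_le (hF.1.enorm.add hg.1.enorm) hg.1.enorm hg.1.enorm hq).trans ?_
    rw [nq_eq hq0 g]
    gcongr
    · rw [← nq_eq hq0 g]
      exact lintegral_add_enorm_rpow_le hq hF.1 hg.1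
  have hRm : AEStronglyMeasurable R volume := by
    refine AEStronglyMeasurable.mul ?_ (hg.1.norm.pow 2)
    exact ((hF.1.norm.add hg.1.norm).aemeasurable.pow_const (q - 2)).aestronglyMeasurable
  have hRi : Integrable R := by
    refine ⟨hRm, ?_⟩
    rw [hasFiniteIntegral_iff_ofReal (Filter.Eventually.of_forall fun x => by positivity)]
    refine hRle.trans_lt (ENNReal.mul_lt_top (ENNReal.mul_lt_top ?_ hg.2) hg.2)
    exact ENNReal.rpow_lt_top_of_nonneg (by linarith) (ENNReal.add_ne_top.2 ⟨hF.2.ne, hg.2.ne⟩)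
  have hGi := integrable_dualPow_mul hq hF hg
  have hmono : ∫ x, ‖F x + g x‖ ^ q ≤ ∫ x, (‖F x‖ ^ q + q * (dualPow q (F x) * g x).re
      + q * q * 2 ^ (q - 2) * R x) := by
    refine integral_mono (hint (hF.add hg)) (((hint hF).add (hGi.re.const_mul q)).add
      (hRi.const_mul _)) fun x => norm_add_rpow_le hq (F x) (g x)
  have hre : ∫ x, (dualPow q (F x) * g x).re = (∫ x, dualPow q (F x) * g x).re :=
    integral_re hGi
  have hsum : ∫ x, (‖F x‖ ^ q + q * (dualPow q (F x) * g x).re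
      + q * q * 2 ^ (q - 2) * R x) = (∫ x, ‖F x‖ ^ q) + q * (∫ x, dualPow q (F x) * g x).re
      + q * q * 2 ^ (q - 2) * ∫ x, R x := by
    rw [integral_add (f := fun x => ‖F x‖ ^ q + q * (dualPow q (F x) * g x).re)
      ((hint hF).add (hGi.re.const_mul q)) (hRi.const_mul _),
      integral_add (g := fun x => q * (dualPow q (F x) * g x).re) (hint hF) (hGi.re.const_mul q),
      integral_const_mul, integral_const_mul, hre]
  rw [hsum] at hmono
  rw [hnq (hF.add hg), hnq hF]
  calc ENNReal.ofReal (∫ x, ‖(F + g) x‖ ^ q)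
      ≤ ENNReal.ofReal ((∫ x, ‖F x‖ ^ q) + q * ‖∫ x, dualPow q (F x) * g x‖
      + q * q * 2 ^ (q - 2) * ∫ x, R x) := by
        refine ENNReal.ofReal_le_ofReal (hmono.trans ?_)
        gcongr
        exact Complex.re_le_norm _
    _ ≤ _ := by
        have hRn : 0 ≤ ∫ x, R x := integral_nonneg fun x => by positivity
        have hFn : 0 ≤ ∫ x, ‖F x‖ ^ q := integral_nonneg fun x => by positivity
        rw [ENNReal.ofReal_add (by positivity) (by positivity),
          ENNReal.ofReal_add (by positivity) (by positivity), ENNReal.ofReal_mul hq0.le,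
          ofReal_norm, ENNReal.ofReal_mul (by positivity)]
        gcongr
        rw [ofReal_integral_eq_lintegral_ofReal hRi
          (Filter.Eventually.of_forall fun x => by positivity)]
        exact hRle

/-! ### Almost orthogonality of dyadic pieces in `L^q` -/

/-- Pairing with a function reproduced by a mean zero kernel is controlled by differences. -/
theorem enorm_integral_dualPow_mul_le {q : ℝ} (hq : 2 ≤ q) {F g Φ : Rd d → ℂ}
    (hF : MemLp F (ENNReal.ofReal q) volume) (hg : MemLp g (ENNReal.ofReal q) volume)
    (hΦ : Integrable Φ) (hΦ0 : ∫ y, Φ y = 0) (hrep : g =ᵐ[volume] cv Φ g) :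
    ‖∫ x, dualPow q (F x) * g x‖ₑ ≤ ENNReal.ofReal q * ∫⁻ y, ‖Φ y‖ₑ *
      ((2 * nq q F) ^ (q - 2) * nq q (fun x => F (x + y) - F x) * nq q g) := by
  have hq0 : 0 < q := by linarith
  have hFy : ∀ y, MemLp (fun x => F (x + y)) (ENNReal.ofReal q) volume := fun y =>
    hF.comp_measurePreserving (measurePreserving_add_right volume y)
  have hgy : ∀ y, MemLp (fun x => g (x - y)) (ENNReal.ofReal q) volume := fun y =>
    hg.comp_measurePreserving (measurePreserving_sub_right volume y)
  have hprodm : AEStronglyMeasurable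
      (fun z : Rd d × Rd d => dualPow q (F z.1) * (Φ z.2 * g (z.1 - z.2)))
      (volume.prod volume) := by
    refine AEStronglyMeasurable.mul ?_ (AEStronglyMeasurable.mul ?_ ?_)
    · exact (continuous_dualPow hq).comp_aestronglyMeasurable (hF.1.comp_fst)
    · exact hΦ.1.comp_snd
    · exact hg.1.comp_quasiMeasurePreserving (quasiMeasurePreserving_sub volume volume)
  have hprod : Integrable (fun z : Rd d × Rd d => dualPow q (F z.1) * (Φ z.2 * g (z.1 - z.2)))
      (volume.prod volume) := by
    refine ⟨hprodm, ?_⟩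
    rw [hasFiniteIntegral_iff_enorm, lintegral_prod_symm _ hprodm.enorm]
    have hle : ∀ y, ∫⁻ x, ‖dualPow q (F x) * (Φ y * g (x - y))‖ₑ
        ≤ ‖Φ y‖ₑ * (nq q F ^ (q - 2) * nq q F * nq q g) := by
      intro y
      have h3 := lintegral_dualPow_mul_le hq hF.1 (hgy y).1
      have h4 : nq q (fun x => g (x - y)) = nq q g :=
        eLpNorm_comp_measurePreserving hg.1 (measurePreserving_sub_right volume y)
      rw [h4] at h3
      calc ∫⁻ x, ‖dualPow q (F x) * (Φ y * g (x - y))‖ₑ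
          = ∫⁻ x, ‖Φ y‖ₑ * ‖dualPow q (F x) * g (x - y)‖ₑ := by
            refine lintegral_congr fun x => ?_
            rw [← enorm_mul]; congr 1; ring
        _ = ‖Φ y‖ₑ * ∫⁻ x, ‖dualPow q (F x) * g (x - y)‖ₑ :=
            lintegral_const_mul' _ _ enorm_ne_top
        _ ≤ _ := by gcongr
    refine (lintegral_mono hle).trans_lt ?_
    rw [lintegral_mul_const'' _ hΦ.1.enorm]
    refine ENNReal.mul_lt_top hΦ.2 (ENNReal.mul_lt_top (ENNReal.mul_lt_top ?_ hF.2) hg.2)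
    exact ENNReal.rpow_lt_top_of_nonneg (by linarith) hF.2.ne
  -- Insert `g = Φ * g`, move the translation onto `F`, and use `∫ Φ = 0` to subtract the
  -- untranslated term, so that only differences of `F` remain.
  have e1 : ∫ x, dualPow q (F x) * g x = ∫ y, Φ y * ∫ x, (dualPow q (F (x + y)) - dualPow q (F x)) * g x := by
    calc ∫ x, dualPow q (F x) * g x = ∫ x, ∫ y, dualPow q (F x) * (Φ y * g (x - y)) := by
          refine integral_congr_ae ?_
          filter_upwards [hrep] with x hx
          rw [integral_const_mul, ← cv_eq_integral_mul_sub, ← hx]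
      _ = ∫ y, ∫ x, dualPow q (F x) * (Φ y * g (x - y)) := integral_integral_swap hprod
      _ = ∫ y, Φ y * ∫ x, dualPow q (F (x + y)) * g x := by
          congr 1; ext y
          rw [← integral_const_mul, ← integral_add_right_eq_self _ y]
          congr 1; ext x
          rw [add_sub_cancel_right]; ring
      _ = ∫ y, (Φ y * (∫ x, (dualPow q (F (x + y)) - dualPow q (F x)) * g x)
            + Φ y * ∫ x, dualPow q (F x) * g x) := by
          congr 1; ext y
          rw [← mul_add, ← integral_add]
          · congr 2; ext x; ring
          · simp only [sub_mul]
            exact (integrable_dualPow_mul hq (hFy y) hg).sub (integrable_dualPow_mul hq hF hg)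
          · exact integrable_dualPow_mul hq hF hg
      _ = _ := by
          -- If the first summand is not integrable then neither is the sum, and both integrals take
          -- the default value `0`.
          by_cases hi : Integrable (fun y => Φ y * ∫ x, (dualPow q (F (x + y)) - dualPow q (F x)) * g x)
          · rw [integral_add hi (hΦ.mul_const _), integral_mul_const, hΦ0, zero_mul, add_zero]
          · rw [integral_undef hi, integral_undef]
            intro h
            refine hi ?_
            have := h.sub (hΦ.mul_const (∫ x, dualPow q (F x) * g x))
            refine this.congr (Filter.Eventually.of_forall fun y => ?_)
            simp
  rw [e1]
  refine (enorm_integral_le_lintegral_enorm _).trans ?_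
  rw [← lintegral_const_mul' _ _ ENNReal.ofReal_ne_top]
  refine lintegral_mono fun y => ?_
  rw [enorm_mul]
  have h2 : ‖∫ x, (dualPow q (F (x + y)) - dualPow q (F x)) * g x‖ₑ ≤ ENNReal.ofReal q *
      ((2 * nq q F) ^ (q - 2) * nq q (fun x => F (x + y) - F x) * nq q g) := by
    refine (enorm_integral_le_lintegral_enorm _).trans ?_
    calc ∫⁻ x, ‖(dualPow q (F (x + y)) - dualPow q (F x)) * g x‖ₑ
        ≤ ∫⁻ x, ENNReal.ofReal q * ((‖F (x + y)‖ₑ + ‖F x‖ₑ) ^ (q - 2) * ‖F (x + y) - F x‖ₑ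
            * ‖g x‖ₑ) := by
          refine lintegral_mono fun x => ?_
          simp only
          rw [enorm_mul]
          refine (mul_le_mul_left (enorm_dualPow_sub_le hq _ _) _).trans_eq ?_
          ring
      _ = ENNReal.ofReal q * ∫⁻ x, ((‖F (x + y)‖ₑ + ‖F x‖ₑ) ^ (q - 2) * ‖F (x + y) - F x‖ₑ
            * ‖g x‖ₑ) := lintegral_const_mul' _ _ ENNReal.ofReal_ne_top
      _ ≤ _ := by
          gcongr
          refine (lintegral_rpow_mul_mul_le ((hFy y).1.enorm.add hF.1.enorm)
            ((hFy y).1.sub hF.1).enorm hg.1.enorm hq).trans ?_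
          rw [nq_eq hq0 g, nq_eq hq0 (fun x => F (x + y) - F x)]
          refine mul_le_mul_left (mul_le_mul_left ?_ _) _
          refine ENNReal.rpow_le_rpow ?_ (by linarith)
          refine (lintegral_add_enorm_rpow_le hq (hFy y).1 hF.1).trans_eq ?_
          rw [nq_comp_add_right q hF.1, two_mul]
  calc ‖Φ y‖ₑ * _ ≤ ‖Φ y‖ₑ * (ENNReal.ofReal q *
      ((2 * nq q F) ^ (q - 2) * nq q (fun x => F (x + y) - F x) * nq q g)) := by gcongr
    _ = _ := by ring

theorem sum_range_half_pow_le (n : ℕ) : ∑ i ∈ Finset.range n, (2⁻¹ : ℝ≥0∞) ^ (i + 1) ≤ 1 := by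
  refine (ENNReal.sum_le_tsum _).trans ?_
  simp only [pow_succ]
  rw [ENNReal.tsum_mul_right, ENNReal.tsum_geometric_two]
  exact (ENNReal.mul_inv_cancel (by norm_num) (by norm_num)).le

/-- Schur's test for the strictly triangular kernel `2^{-(m-j)}`: after `x y ≤ x² + y²`, every row
sum and every column sum is at most `1`. -/
theorem sum_Ico_half_pow_le (a : ℕ → ℝ≥0∞) (N : ℕ) :
    ∑ m ∈ Finset.range N, a m * ∑ j ∈ Finset.range m, (2⁻¹ : ℝ≥0∞) ^ (m - j) * a j
      ≤ 2 * ∑ m ∈ Finset.range N, a m ^ 2 := by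
  have hab : ∀ x y : ℝ≥0∞, x * y ≤ x ^ 2 + y ^ 2 := by
    intro x y
    rcases le_total x y with h | h
    · calc x * y ≤ y * y := by gcongr
        _ ≤ _ := by rw [← pow_two]; exact le_add_self
    · calc x * y ≤ x * x := by gcongr
        _ ≤ _ := by rw [← pow_two]; exact le_self_add
  calc ∑ m ∈ Finset.range N, a m * ∑ j ∈ Finset.range m, (2⁻¹ : ℝ≥0∞) ^ (m - j) * a j
      ≤ ∑ m ∈ Finset.range N, ∑ j ∈ Finset.range m,
          ((2⁻¹ : ℝ≥0∞) ^ (m - j) * a m ^ 2 + (2⁻¹ : ℝ≥0∞) ^ (m - j) * a j ^ 2) := by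
        refine Finset.sum_le_sum fun m _ => ?_
        rw [Finset.mul_sum]
        refine Finset.sum_le_sum fun j _ => ?_
        rw [← mul_add, mul_left_comm]
        gcongr
        exact hab _ _
    _ = ∑ m ∈ Finset.range N, (∑ j ∈ Finset.range m, (2⁻¹ : ℝ≥0∞) ^ (m - j)) * a m ^ 2
        + ∑ j ∈ Finset.range N, (∑ m ∈ Finset.Ico (j + 1) N, (2⁻¹ : ℝ≥0∞) ^ (m - j)) * a j ^ 2 := by
        simp only [Finset.sum_add_distrib, Finset.sum_mul]
        congr 1
        simp only [Finset.range_eq_Ico]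
        rw [Finset.sum_Ico_Ico_comm']
    _ ≤ ∑ m ∈ Finset.range N, 1 * a m ^ 2 + ∑ j ∈ Finset.range N, 1 * a j ^ 2 := by
        gcongr with m _ j _
        · rw [← Finset.sum_range_reflect]
          refine le_trans (Finset.sum_le_sum fun i hi => ?_) (sum_range_half_pow_le m)
          have := Finset.mem_range.1 hi
          rw [show m - (m - 1 - i) = i + 1 by omega]
        · rw [Finset.sum_Ico_eq_sum_range]
          refine le_trans (Finset.sum_le_sum fun i hi => ?_) (sum_range_half_pow_le (N - (j + 1)))
          rw [show j + 1 + i - j = i + 1 by omega]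
    _ = _ := by simp only [one_mul]; rw [two_mul]

/-- Divides by `M^(q-2)`, which is legitimate because `M` is finite; `M = 0` is trivial. -/
theorem sq_le_of_rpow_le {q : ℝ} {M S : ℝ≥0∞} (hq : 2 ≤ q) (hMt : M ≠ ⊤)
    (hMq : M ^ q ≤ M ^ (q - 2) * S) : M ^ 2 ≤ S := by
  have hq2 : 0 ≤ q - 2 := by linarith
  rcases eq_or_ne M 0 with h0 | h0
  · rw [h0]; simp
  have hMp : M ^ (q - 2) ≠ 0 := by
    rw [Ne, ENNReal.rpow_eq_zero_iff]; simp [h0, hMt]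
  have hMpt : M ^ (q - 2) ≠ ⊤ := ENNReal.rpow_ne_top_of_nonneg hq2 hMt
  have e2 : M ^ q = M ^ (q - 2) * M ^ 2 := by
    rw [← ENNReal.rpow_natCast M 2, ← ENNReal.rpow_add _ _ h0 hMt]
    congr 1; push_cast; ring
  rw [e2] at hMq
  refine (ENNReal.mul_le_mul_iff_right hMp hMpt).1 hMq

set_option maxHeartbeats 400000 in
/-- A substitute for the Littlewood-Paley inequality: functions which are reproduced by dyadic mean
zero kernels and have dyadic moduli of continuity are almost orthogonal in `L^q`, `q ≥ 2`. -/
theorem nq_sum_sq_le {q : ℝ} (hq : 2 ≤ q) (L B : ℝ≥0) : ∃ C : ℝ≥0, ∀ (g Φ : ℕ → Rd d → ℂ),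
    (∀ k, MemLp (g k) (ENNReal.ofReal q) volume) →
    (∀ k, 1 ≤ k → Integrable (Φ k) ∧ ∫ y, Φ k y = 0 ∧ g k =ᵐ[volume] cv (Φ k) (g k) ∧
      ∫⁻ y, ‖Φ k y‖ₑ * ‖y‖ₑ ≤ B * (2⁻¹ : ℝ≥0∞) ^ k) →
    (∀ k y, nq q (fun x => g k (x + y) - g k x) ≤ L * 2 ^ k * ‖y‖ₑ * nq q (g k)) →
    ∀ N, nq q (∑ k ∈ Finset.range N, g k) ^ 2 ≤ C * ∑ k ∈ Finset.range N, nq q (g k) ^ 2 := by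
  have hq0 : 0 < q := by linarith
  have hq2 : 0 ≤ q - 2 := by linarith
  -- The base `3` serves for `‖F m‖ + ‖g m‖ ≤ 3 M` in the Taylor remainder and, wastefully, for `2
  -- ‖F m‖ ≤ 3 M` in the linear term.
  set K : ℝ≥0∞ := ENNReal.ofReal q * ENNReal.ofReal q * 3 ^ (q - 2) * L * B
    + ENNReal.ofReal (q * q * 2 ^ (q - 2)) * 3 ^ (q - 2) with hK
  have h3t : (3 : ℝ≥0∞) ^ (q - 2) ≠ ⊤ := ENNReal.rpow_ne_top_of_nonneg hq2 (by norm_num)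
  have hKt : K ≠ ⊤ := by
    refine ENNReal.add_ne_top.2 ⟨?_, ENNReal.mul_ne_top ENNReal.ofReal_ne_top h3t⟩
    exact ENNReal.mul_ne_top (ENNReal.mul_ne_top (ENNReal.mul_ne_top
      (ENNReal.mul_ne_top ENNReal.ofReal_ne_top ENNReal.ofReal_ne_top) h3t)
      ENNReal.coe_ne_top) ENNReal.coe_ne_top
  refine ⟨(K * 3).toNNReal, fun g Φ hg hΦ hL N => ?_⟩
  rw [ENNReal.coe_toNNReal (ENNReal.mul_ne_top hKt (by norm_num))]
  set F : ℕ → Rd d → ℂ := fun m => ∑ k ∈ Finset.range m, g k with hFdef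
  have hF : ∀ m, MemLp (F m) (ENNReal.ofReal q) volume := fun m => memLp_finsetSum' _ fun k _ => hg k
  have hFs : ∀ m, F (m + 1) = F m + g m := fun m => Finset.sum_range_succ _ _
  -- The maximum over all partial sums: telescoping bounds each `‖F m‖^q` by `M^(q-2)` times the
  -- square sum, and the argument closes at an index where the maximum is attained.
  set M : ℝ≥0∞ := (Finset.range (N + 1)).sup fun m => nq q (F m) with hM
  have hFM : ∀ m ≤ N, nq q (F m) ≤ M := fun m hm =>
    Finset.le_sup (f := fun m => nq q (F m)) (Finset.mem_range.2 (by omega))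
  obtain ⟨m₀, hm₀, hMm₀⟩ := Finset.exists_mem_eq_sup (Finset.range (N + 1)) ⟨0, by simp⟩
    fun m => nq q (F m)
  have hMt : M ≠ ⊤ := ne_of_eq_of_ne (hM.trans hMm₀) (hF m₀).2.ne
  have hone := one_le_ofReal_of_two_le hq
  have hgM : ∀ m < N, nq q (g m) ≤ 2 * M := by
    intro m hm
    have : g m = F (m + 1) - F m := by rw [hFs]; simp
    rw [this, two_mul]
    exact (eLpNorm_sub_le (hF _).1 (hF _).1 hone).trans
      (add_le_add (hFM _ (by omega)) (hFM _ (by omega)))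
  have hdiff : ∀ m y, nq q (fun x => F m (x + y) - F m x)
      ≤ ∑ j ∈ Finset.range m, L * 2 ^ j * ‖y‖ₑ * nq q (g j) := by
    intro m y
    have : (fun x => F m (x + y) - F m x)
        = ∑ j ∈ Finset.range m, fun x => g j (x + y) - g j x := by
      ext x; simp [hFdef, Finset.sum_apply]
    rw [this]
    refine (eLpNorm_sum_le (fun j _ => ?_) hone).trans (Finset.sum_le_sum fun j _ => hL j y)
    exact ((hg j).comp_measurePreserving (measurePreserving_add_right volume y)).1.sub (hg j).1
  have hcanc : ∀ m < N, ‖∫ x, dualPow q (F m x) * g m x‖ₑ ≤ ENNReal.ofReal q * 3 ^ (q - 2) * L * B *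
      M ^ (q - 2) * (nq q (g m) * ∑ j ∈ Finset.range m, (2⁻¹ : ℝ≥0∞) ^ (m - j) * nq q (g j)) := by
    intro m hm
    -- For `m = 0` the partial sum is empty and the pairing vanishes, so no mean zero kernel is
    -- required of `g 0`.
    rcases Nat.eq_zero_or_pos m with rfl | hm0
    · simp [hFdef]
    obtain ⟨hΦi, hΦ0, hrep, hΦB⟩ := hΦ m hm0
    refine (enorm_integral_dualPow_mul_le hq (hF m) (hg m) hΦi hΦ0 hrep).trans ?_
    set A := ∑ j ∈ Finset.range m, (2 : ℝ≥0∞) ^ j * nq q (g j) with hA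
    calc ENNReal.ofReal q * ∫⁻ y, ‖Φ m y‖ₑ *
          ((2 * nq q (F m)) ^ (q - 2) * nq q (fun x => F m (x + y) - F m x) * nq q (g m))
        ≤ ENNReal.ofReal q * ∫⁻ y, (3 ^ (q - 2) * M ^ (q - 2) * L * A * nq q (g m)) *
            (‖Φ m y‖ₑ * ‖y‖ₑ) := by
          refine mul_le_mul_right (lintegral_mono fun y => ?_) _
          have h1 : (2 * nq q (F m)) ^ (q - 2) ≤ 3 ^ (q - 2) * M ^ (q - 2) := by
            rw [← ENNReal.mul_rpow_of_nonneg _ _ hq2]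
            refine ENNReal.rpow_le_rpow (mul_le_mul' ?_ (hFM m hm.le)) hq2
            norm_num
          have h2 : nq q (fun x => F m (x + y) - F m x) ≤ L * A * ‖y‖ₑ := by
            refine (hdiff m y).trans_eq ?_
            rw [hA, Finset.mul_sum, Finset.sum_mul]
            refine Finset.sum_congr rfl fun j _ => by ring
          calc ‖Φ m y‖ₑ *
              ((2 * nq q (F m)) ^ (q - 2) * nq q (fun x => F m (x + y) - F m x) * nq q (g m))
              ≤ ‖Φ m y‖ₑ * (3 ^ (q - 2) * M ^ (q - 2) * (L * A * ‖y‖ₑ) * nq q (g m)) := by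
                gcongr
            _ = _ := by ring
      _ = ENNReal.ofReal q * ((3 ^ (q - 2) * M ^ (q - 2) * L * A * nq q (g m)) *
            ∫⁻ y, ‖Φ m y‖ₑ * ‖y‖ₑ) := by
          rw [lintegral_const_mul'' (f := fun y => ‖Φ m y‖ₑ * ‖y‖ₑ) _
            (AEMeasurable.mul hΦi.1.enorm (by fun_prop))]
      _ ≤ ENNReal.ofReal q * ((3 ^ (q - 2) * M ^ (q - 2) * L * A * nq q (g m)) *
            (B * (2⁻¹ : ℝ≥0∞) ^ m)) := by gcongr
      _ = ENNReal.ofReal q * 3 ^ (q - 2) * L * B * M ^ (q - 2) * (nq q (g m) *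
            (A * (2⁻¹ : ℝ≥0∞) ^ m)) := by ring
      _ = _ := by
          congr 2
          rw [hA, Finset.sum_mul]
          refine Finset.sum_congr rfl fun j hj => ?_
          have hjm := Finset.mem_range.1 hj
          have : (2⁻¹ : ℝ≥0∞) ^ m = (2⁻¹) ^ (m - j) * (2⁻¹) ^ j := by
            rw [← pow_add]; congr 1; omega
          have h22 : (2 : ℝ≥0∞) ^ j * (2⁻¹) ^ j = 1 := by
            rw [← mul_pow, ENNReal.mul_inv_cancel (by norm_num) (by norm_num), one_pow]
          rw [this]
          calc 2 ^ j * nq q (g j) * ((2⁻¹) ^ (m - j) * (2⁻¹) ^ j)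
              = (2 ^ j * (2⁻¹) ^ j) * ((2⁻¹) ^ (m - j) * nq q (g j)) := by ring
            _ = _ := by rw [h22, one_mul]
  set D : ℕ → ℝ≥0∞ := fun m => nq q (g m) ^ 2
    + nq q (g m) * ∑ j ∈ Finset.range m, (2⁻¹ : ℝ≥0∞) ^ (m - j) * nq q (g j) with hD
  have hstep : ∀ m < N, nq q (F (m + 1)) ^ q ≤ nq q (F m) ^ q + K * M ^ (q - 2) * D m := by
    intro m hm
    rw [hFs]
    refine (lintegral_norm_add_rpow_le hq (hF m) (hg m)).trans ?_
    have h3 : (nq q (F m) + nq q (g m)) ^ (q - 2) ≤ 3 ^ (q - 2) * M ^ (q - 2) := by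
      rw [← ENNReal.mul_rpow_of_nonneg _ _ hq2]
      refine ENNReal.rpow_le_rpow ?_ hq2
      refine (add_le_add (hFM m hm.le) (hgM m hm)).trans_eq ?_
      ring
    rw [add_assoc]
    gcongr
    set Z := nq q (g m) * ∑ j ∈ Finset.range m, (2⁻¹ : ℝ≥0∞) ^ (m - j) * nq q (g j)
    set a := nq q (g m)
    calc ENNReal.ofReal q * ‖∫ x, dualPow q (F m x) * g m x‖ₑ + ENNReal.ofReal (q * q * 2 ^ (q - 2))
          * ((nq q (F m) + a) ^ (q - 2) * a * a)
        ≤ ENNReal.ofReal q * (ENNReal.ofReal q * 3 ^ (q - 2) * L * B * M ^ (q - 2) * Z)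
          + ENNReal.ofReal (q * q * 2 ^ (q - 2)) * (3 ^ (q - 2) * M ^ (q - 2) * a * a) := by
          gcongr
          exact hcanc m hm
      _ = (ENNReal.ofReal q * ENNReal.ofReal q * 3 ^ (q - 2) * L * B) * M ^ (q - 2) * Z
          + (ENNReal.ofReal (q * q * 2 ^ (q - 2)) * 3 ^ (q - 2)) * M ^ (q - 2) * a ^ 2 := by ring
      _ ≤ K * M ^ (q - 2) * Z + K * M ^ (q - 2) * a ^ 2 := by
          gcongr
          · exact le_self_add
          · exact le_add_self
      _ = K * M ^ (q - 2) * (a ^ 2 + Z) := by ring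
  have hsum : ∀ m ≤ N, nq q (F m) ^ q ≤ K * M ^ (q - 2) * ∑ i ∈ Finset.range m, D i := by
    intro m
    induction m with
    | zero => intro _; simp [hFdef, hq0]
    | succ m ih =>
      intro hm
      rw [Finset.sum_range_succ, mul_add]
      exact (hstep m (by omega)).trans (add_le_add_left (ih (by omega)) _)
  set S := ∑ k ∈ Finset.range N, nq q (g k) ^ 2 with hS
  have hDS : ∑ i ∈ Finset.range N, D i ≤ 3 * S := by
    rw [hD, Finset.sum_add_distrib]
    refine (add_le_add_right (sum_Ico_half_pow_le (fun k => nq q (g k)) N) _).trans_eq ?_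
    rw [← hS]; ring
  have hMq : M ^ q ≤ K * M ^ (q - 2) * (3 * S) := by
    have hm₀N : m₀ ≤ N := by have := Finset.mem_range.1 hm₀; omega
    calc M ^ q = nq q (F m₀) ^ q := congrArg (fun z : ℝ≥0∞ => z ^ q) (hM.trans hMm₀)
      _ ≤ K * M ^ (q - 2) * ∑ i ∈ Finset.range m₀, D i := hsum m₀ hm₀N
      _ ≤ K * M ^ (q - 2) * ∑ i ∈ Finset.range N, D i :=
          mul_le_mul_right (Finset.sum_le_sum_of_subset (Finset.range_mono hm₀N)) _
      _ ≤ _ := mul_le_mul_right hDS _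
  refine (pow_le_pow_left' (hFM N le_rfl) 2).trans ?_
  have hMq' : M ^ q ≤ M ^ (q - 2) * (K * 3 * S) := by
    rwa [mul_comm K, mul_assoc, ← mul_assoc K] at hMq
  exact sq_le_of_rpow_le hq hMt hMq'

/-! ### Kernels of smooth compactly supported symbols -/

/-- The convolution kernel of the Fourier multiplier with symbol `m`. -/
noncomputable def kern (m : Rd d → ℂ) (x : Rd d) : ℂ :=
  (((2 * Real.pi) ^ d : ℝ) : ℂ)⁻¹ * ∫ ξ, m ξ * Complex.exp (Complex.I * ((⟪x, ξ⟫ : ℝ) : ℂ))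

/-- The symbol `m`, evolved to time `t` by the Schrödinger flow. -/
noncomputable def evo (m : Rd d → ℂ) (t : ℝ) (ξ : Rd d) : ℂ :=
  m ξ * Complex.exp (-Complex.I * ((t * ‖ξ‖ ^ 2 : ℝ) : ℂ))

theorem contDiff_evo {m : Rd d → ℂ} (hm : ContDiff ℝ ∞ m) (t : ℝ) : ContDiff ℝ ∞ (evo m t) := by
  unfold evo
  refine hm.mul (ContDiff.cexp (contDiff_const.mul ?_))
  exact Complex.ofRealCLM.contDiff.comp (contDiff_const.mul (contDiff_norm_sq ℝ))

theorem hasCompactSupport_evo {m : Rd d → ℂ} (hc : HasCompactSupport m) (t : ℝ) :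
    HasCompactSupport (evo m t) := hc.mul_right

theorem evo_zero (m : Rd d → ℂ) : evo m 0 = m := by
  ext ξ; simp [evo]

/-- The rescaled symbol, as seen by Mathlib's Fourier transform. -/
noncomputable def symbolS {m : Rd d → ℂ} (hm : ContDiff ℝ ∞ m) (hc : HasCompactSupport m) :
    𝓢(Rd d, ℂ) :=
  HasCompactSupport.toSchwartzMap (f := fun η : Rd d => m ((2 * Real.pi) • η))
    (hc.comp_smul (by positivity)) (hm.comp (contDiff_const_smul _))

open FourierTransform in
/-- The kernel of a smooth compactly supported symbol, as a Schwartz function. -/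
noncomputable def kerS {m : Rd d → ℂ} (hm : ContDiff ℝ ∞ m) (hc : HasCompactSupport m) :
    𝓢(Rd d, ℂ) := 𝓕⁻ (symbolS hm hc)

theorem integral_comp_two_pi_smul (f : Rd d → ℂ) :
    ∫ η, f ((2 * Real.pi) • η) = (((2 * Real.pi) ^ d : ℝ) : ℂ)⁻¹ * ∫ ξ, f ξ := by
  rw [Measure.integral_comp_smul, finrank_euclideanSpace_fin,
    abs_of_nonneg (by positivity), Complex.real_smul, Complex.ofReal_inv]

theorem kerS_apply {m : Rd d → ℂ} (hm : ContDiff ℝ ∞ m) (hc : HasCompactSupport m) (x : Rd d) :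
    kerS hm hc x = kern m x := by
  rw [kerS, SchwartzMap.fourierInv_coe, Real.fourierInv_eq', kern, ← integral_comp_two_pi_smul]
  congr 1; ext η
  simp only [symbolS, HasCompactSupport.toSchwartzMap_toFun, smul_eq_mul]
  rw [mul_comm]
  congr 2
  rw [inner_smul_right, real_inner_comm]
  push_cast; ring

theorem coe_kerS {m : Rd d → ℂ} (hm : ContDiff ℝ ∞ m) (hc : HasCompactSupport m) :
    ⇑(kerS hm hc) = kern m := funext (kerS_apply hm hc)

/-- Fourier inversion for kernels. -/
theorem integral_kern_mul_exp {m : Rd d → ℂ} (hm : ContDiff ℝ ∞ m) (hc : HasCompactSupport m)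
    (ξ : Rd d) :
    ∫ y, kern m y * Complex.exp (-Complex.I * ((⟪y, ξ⟫ : ℝ) : ℂ)) = m ξ := by
  have h : (FourierTransform.fourier (kerS hm hc)) ((2 * Real.pi)⁻¹ • ξ) = m ξ := by
    rw [kerS, FourierTransform.fourier_fourierInv_eq]
    simp only [symbolS, HasCompactSupport.toSchwartzMap_toFun]
    rw [smul_smul, mul_inv_cancel₀ (by positivity), one_smul]
  rw [← h, SchwartzMap.fourier_coe, Real.fourier_eq', coe_kerS]
  congr 1; ext y
  rw [smul_eq_mul, mul_comm]
  congr 2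
  rw [inner_smul_right, ← mul_assoc, mul_assoc (-2), mul_comm, mul_assoc]
  push_cast
  field_simp

theorem continuous_kern {m : Rd d → ℂ} (hm : ContDiff ℝ ∞ m) (hc : HasCompactSupport m) :
    Continuous (kern m) := by rw [← coe_kerS hm hc]; exact (kerS hm hc).continuous

theorem integrable_kern {m : Rd d → ℂ} (hm : ContDiff ℝ ∞ m) (hc : HasCompactSupport m) :
    Integrable (kern m) := by rw [← coe_kerS hm hc]; exact (kerS hm hc).integrable

theorem integral_kern {m : Rd d → ℂ} (hm : ContDiff ℝ ∞ m) (hc : HasCompactSupport m) :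
    ∫ y, kern m y = m 0 := by
  simpa using integral_kern_mul_exp hm hc 0

/-! ### Decay and dispersive formula for the Schrödinger kernel -/

/-- The phase of the Schrödinger kernel. -/
noncomputable def phase (x : Rd d) (τ : ℝ) (ξ : Rd d) : ℝ := ⟪x, ξ⟫ - τ * ‖ξ‖ ^ 2

theorem continuous_phase (x : Rd d) (τ : ℝ) : Continuous (phase x τ) := by
  unfold phase; fun_prop

theorem kern_evo_eq_phase (m : Rd d → ℂ) (τ : ℝ) (x : Rd d) :
    kern (evo m τ) x = (((2 * Real.pi) ^ d : ℝ) : ℂ)⁻¹ *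
      ∫ ξ, Complex.exp (Complex.I * (phase x τ ξ : ℂ)) * m ξ := by
  rw [kern]
  congr 2; ext ξ
  rw [evo, mul_assoc, ← Complex.exp_add, mul_comm]
  congr 2
  rw [phase]; push_cast; ring

theorem norm_exp_I_mul_ofReal (r : ℝ) : ‖Complex.exp (Complex.I * (r : ℂ))‖ = 1 := by
  rw [mul_comm]; exact Complex.norm_exp_ofReal_mul_I r

theorem norm_kern_evo_le (m : Rd d → ℂ) (τ : ℝ) (x : Rd d) :
    ‖kern (evo m τ) x‖ ≤ ‖(((2 * Real.pi) ^ d : ℝ) : ℂ)⁻¹‖ * ∫ ξ, ‖m ξ‖ := by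
  rw [kern_evo_eq_phase, norm_mul]
  gcongr
  refine (norm_integral_le_integral_norm _).trans_eq ?_
  congr 1; ext ξ
  rw [norm_mul, norm_exp_I_mul_ofReal, one_mul]

theorem integrable_mul_of_bound {h χ : Rd d → ℂ} (hχ : Continuous χ) (hc : HasCompactSupport χ)
    (hh : Measurable h) {C : ℝ} (hC : ∀ ξ, χ ξ ≠ 0 → ‖h ξ‖ ≤ C) :
    Integrable (fun ξ => h ξ * χ ξ) := by
  refine Integrable.mono' ((hχ.integrable_of_hasCompactSupport hc).norm.const_mul C)
    (hh.aestronglyMeasurable.mul hχ.aestronglyMeasurable) (Filter.Eventually.of_forall fun ξ => ?_)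
  rw [norm_mul]
  by_cases h0 : χ ξ = 0
  · simp [h0]
  · gcongr; exact hC ξ h0

theorem tsupport_subset_closedBall {χ : Rd d → ℂ} {R : ℝ} (hs : ∀ ξ, χ ξ ≠ 0 → ‖ξ‖ ≤ R) :
    tsupport χ ⊆ Metric.closedBall 0 R :=
  closure_minimal (fun ξ hξ => by simpa using hs ξ hξ) Metric.isClosed_closedBall

/-- `x j - 2 τ ξ j` is the `j`-th derivative of the phase; it cannot degenerate when `x` is far from
the points `2 τ ξ` reached by the frequencies `‖ξ‖ ≤ R`. -/
theorem half_abs_le_of_norm_le {R τ : ℝ} {x ξ : Rd d} {j : Fin d}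
    (hτ : 4 * R * |τ| ≤ |x j|) (hξ : ‖ξ‖ ≤ R) : |x j| / 2 ≤ |x j - 2 * τ * ξ j| := by
  have h1 : |ξ j| ≤ R := by
    have := PiLp.norm_apply_le ξ j
    rw [Real.norm_eq_abs] at this; linarith
  have h2 : |2 * τ * ξ j| ≤ 2 * |τ| * R := by
    rw [abs_mul, abs_mul, abs_two]; gcongr
  have := abs_sub_abs_le_abs_sub (x j) (2 * τ * ξ j)
  linarith

/-- The derivative of the exponential cancels one inverse power and returns the integrand with
exponent `n`; the derivative of the inverse power leaves an error with exponent `n + 2` and a factor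
`τ`. -/
theorem hasLineDerivAt_phase_factor {x ξ : Rd d} {τ : ℝ} {j : Fin d} (n : ℕ)
    (hb : x j - 2 * τ * ξ j ≠ 0) :
    HasLineDerivAt ℝ (fun ξ : Rd d => (((x j - 2 * τ * ξ j)⁻¹ ^ (n + 1) : ℝ) : ℂ) *
        Complex.exp (Complex.I * (phase x τ ξ : ℂ)))
      ((((n + 1) * (2 * τ) : ℝ) : ℂ) * ((((x j - 2 * τ * ξ j)⁻¹ ^ (n + 2) : ℝ) : ℂ) *
        Complex.exp (Complex.I * (phase x τ ξ : ℂ)))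
        + Complex.I * ((((x j - 2 * τ * ξ j)⁻¹ ^ n : ℝ) : ℂ) *
        Complex.exp (Complex.I * (phase x τ ξ : ℂ)))) ξ (EuclideanSpace.single j (1 : ℝ)) := by
  have e1 : ∀ s : ℝ, (ξ + s • EuclideanSpace.single j (1 : ℝ) : Rd d) j = ξ j + s := by
    intro s; simp
  have e2 : ∀ s : ℝ, phase x τ (ξ + s • EuclideanSpace.single j (1 : ℝ))
      = phase x τ ξ + s * x j - τ * (2 * s * ξ j + s ^ 2) := by
    intro s
    rw [phase, phase, inner_add_right, inner_smul_right, norm_add_sq_real, inner_smul_right,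
      norm_smul, EuclideanSpace.inner_single_right, EuclideanSpace.inner_single_right]
    simp
    ring
  have hd1 : HasDerivAt (fun s : ℝ => (x j - 2 * τ * (ξ j + s))⁻¹ ^ (n + 1))
      (((n + 1) * (2 * τ)) * (x j - 2 * τ * ξ j)⁻¹ ^ (n + 2)) 0 := by
    have h0 : HasDerivAt (fun s : ℝ => x j - 2 * τ * (ξ j + s)) (-(2 * τ)) 0 := by
      simpa using (((hasDerivAt_id (0 : ℝ)).const_add (ξ j)).const_mul (2 * τ)).const_sub (x j)
    have h1 := (h0.inv (by simpa using hb)).pow (n + 1)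
    refine h1.congr_deriv ?_
    simp only [add_zero, Nat.add_sub_cancel, neg_neg, Pi.inv_apply]
    rw [pow_add _ n 2]
    push_cast
    field_simp
  have hd2 : HasDerivAt (fun s : ℝ => phase x τ ξ + s * x j - τ * (2 * s * ξ j + s ^ 2))
      (x j - 2 * τ * ξ j) 0 := by
    have := (((hasDerivAt_id (0 : ℝ)).mul_const (x j)).const_add (phase x τ ξ)).sub
      (((((hasDerivAt_id (0 : ℝ)).const_mul 2).mul_const (ξ j)).add
        ((hasDerivAt_id (0 : ℝ)).pow 2)).const_mul τ)
    refine this.congr_deriv ?_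
    simp; ring
  have hd3 := (hd2.ofReal_comp.const_mul Complex.I).cexp
  have hd4 := hd1.ofReal_comp.mul hd3
  rw [HasLineDerivAt]
  simp only [e1, e2]
  refine hd4.congr_deriv ?_
  simp only [add_zero, zero_mul, mul_zero, ne_eq, OfNat.ofNat_ne_zero, not_false_eq_true,
    zero_pow, sub_zero]
  have hb' : (((x j - 2 * τ * ξ j)⁻¹ ^ (n + 1) : ℝ) : ℂ) * ((x j - 2 * τ * ξ j : ℝ) : ℂ)
      = (((x j - 2 * τ * ξ j)⁻¹ ^ n : ℝ) : ℂ) := by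
    rw [← Complex.ofReal_mul, pow_succ, mul_assoc, inv_mul_cancel₀ hb, mul_one]
  rw [← hb']
  push_cast
  ring

/-- Non-stationary phase, with the amplitude carrying powers of the derivative of the phase. -/
theorem exists_nonstationary_bound {R : ℝ} (hR : 0 < R) (j : Fin d) (M : ℕ) :
    ∀ (n : ℕ) (χ : Rd d → ℂ), ContDiff ℝ ∞ χ → (∀ ξ, χ ξ ≠ 0 → ‖ξ‖ ≤ R) →
      ∃ C : ℝ, 0 ≤ C ∧ ∀ (τ : ℝ) (x : Rd d), x j ≠ 0 → 4 * R * |τ| ≤ |x j| →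
        ‖∫ ξ, ((((x j - 2 * τ * ξ j)⁻¹ ^ n : ℝ) : ℂ) *
          Complex.exp (Complex.I * (phase x τ ξ : ℂ))) * χ ξ‖ ≤ C * |x j|⁻¹ ^ (n + M) := by
  have hbd : ∀ {τ : ℝ} {x ξ : Rd d} (n : ℕ), x j ≠ 0 → 4 * R * |τ| ≤ |x j| → ‖ξ‖ ≤ R →
      ‖(((x j - 2 * τ * ξ j)⁻¹ ^ n : ℝ) : ℂ) * Complex.exp (Complex.I * (phase x τ ξ : ℂ))‖
        ≤ (2 * |x j|⁻¹) ^ n := by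
    intro τ x ξ n hx hτ hξ
    have := half_abs_le_of_norm_le hτ hξ
    have hx' := abs_pos.2 hx
    rw [norm_mul, norm_exp_I_mul_ofReal, mul_one, Complex.norm_real, norm_pow, norm_inv,
      Real.norm_eq_abs]
    gcongr
    rw [inv_le_comm₀ (by linarith) (by positivity), mul_inv, inv_inv]
    linarith
  have hcs : ∀ {χ : Rd d → ℂ}, (∀ ξ, χ ξ ≠ 0 → ‖ξ‖ ≤ R) → HasCompactSupport χ := fun hs =>
    (isCompact_closedBall 0 R).of_isClosed_subset (isClosed_tsupport _)
      (tsupport_subset_closedBall hs)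
  have hmeas : ∀ (τ : ℝ) (x : Rd d) (n : ℕ), Measurable (fun ξ : Rd d =>
      (((x j - 2 * τ * ξ j)⁻¹ ^ n : ℝ) : ℂ) * Complex.exp (Complex.I * (phase x τ ξ : ℂ))) := by
    intro τ x n
    refine Measurable.mul ?_ ?_
    · exact Complex.measurable_ofReal.comp
        ((Continuous.measurable (by fun_prop : Continuous fun ξ : Rd d => x j - 2 * τ * ξ j)).inv.pow_const n)
    · have := continuous_phase x τ
      exact Continuous.measurable (by fun_prop)
  -- Induction on the number of integrations by parts, for all `n` and `χ` at once. The derivative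
  -- falls either on the amplitude, giving exponent `n + 1`, or on the inverse power, giving `n + 2`
  -- and a factor `τ`. Since `|τ| ≤ |x j| / (4 R)`, both gain one power of `|x j|⁻¹`.
  induction M with
  | zero =>
    intro n χ hχ hs
    refine ⟨2 ^ n * ∫ ξ, ‖χ ξ‖, by positivity, fun τ x hx hτ => ?_⟩
    have hi := hχ.continuous.integrable_of_hasCompactSupport (μ := volume) (hcs hs)
    refine (norm_integral_le_of_norm_le (hi.norm.const_mul ((2 * |x j|⁻¹) ^ n))
      (Filter.Eventually.of_forall fun ξ => ?_)).trans_eq ?_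
    · rw [norm_mul]
      by_cases h0 : χ ξ = 0
      · simp [h0]
      · gcongr; exact hbd n hx hτ (hs ξ h0)
    · rw [integral_const_mul, mul_pow]; simp only [add_zero]; ring
  | succ M ih =>
    intro n χ hχ hs
    set v : Rd d := EuclideanSpace.single j (1 : ℝ) with hv
    have hχ' : ContDiff ℝ ∞ (fun ξ => fderiv ℝ χ ξ v) :=
      (hχ.fderiv_right (m := ∞) (by simp)).clm_apply contDiff_const
    have hs' : ∀ ξ, fderiv ℝ χ ξ v ≠ 0 → ‖ξ‖ ≤ R := by
      intro ξ h
      have : ξ ∈ tsupport χ := by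
        by_contra hn
        exact h (by rw [fderiv_of_notMem_tsupport (𝕜 := ℝ) hn]; simp)
      simpa using tsupport_subset_closedBall hs this
    obtain ⟨C1, hC1, h1⟩ := ih (n + 1) _ hχ' hs'
    obtain ⟨C2, hC2, h2⟩ := ih (n + 2) χ hχ hs
    refine ⟨C1 + (n + 1) * (2 / (4 * R)) * C2, by positivity, fun τ x hx hτ => ?_⟩
    set E : ℕ → Rd d → ℂ := fun n ξ => (((x j - 2 * τ * ξ j)⁻¹ ^ n : ℝ) : ℂ) *
      Complex.exp (Complex.I * (phase x τ ξ : ℂ)) with hE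
    have hint : ∀ (k : ℕ) (ρ : Rd d → ℂ), ContDiff ℝ ∞ ρ → (∀ ξ, ρ ξ ≠ 0 → ‖ξ‖ ≤ R) →
        Integrable (fun ξ => E k ξ * ρ ξ) := fun k ρ hρ hρs =>
      integrable_mul_of_bound hρ.continuous (hcs hρs) (hmeas τ x k)
        fun ξ h => hbd k hx hτ (hρs ξ h)
    have hparts := integral_bilinear_hasLineDerivAt_right_eq_neg_left_of_integrable
      (μ := (volume : Measure (Rd d))) (B := ContinuousLinearMap.mul ℝ ℂ) (v := v)
      (f := E (n + 1)) (g := χ) (g' := fun ξ => fderiv ℝ χ ξ v)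
      (f' := fun ξ => (((n + 1) * (2 * τ) : ℝ) : ℂ) * E (n + 2) ξ + Complex.I * E n ξ)
      (by
        simp only [ContinuousLinearMap.mul_apply', add_mul, mul_assoc]
        exact ((hint (n + 2) χ hχ hs).const_mul _).add ((hint n χ hχ hs).const_mul _))
      (by simpa only [ContinuousLinearMap.mul_apply'] using hint (n + 1) _ hχ' hs')
      (by simpa only [ContinuousLinearMap.mul_apply'] using hint (n + 1) χ hχ hs)
      (by
        intro ξ hξ
        have hξR : ‖ξ‖ ≤ R := by simpa using tsupport_subset_closedBall hs hξ
        refine hasLineDerivAt_phase_factor n ?_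
        have := half_abs_le_of_norm_le hτ hξR
        have hx' := abs_pos.2 hx
        exact abs_pos.1 (by linarith))
      (by
        intro ξ _
        exact ((hχ.differentiable (by simp)).differentiableAt.hasFDerivAt).hasLineDerivAt v)
    simp only [ContinuousLinearMap.mul_apply', add_mul, mul_assoc] at hparts
    rw [integral_add ((hint (n + 2) χ hχ hs).const_mul _) ((hint n χ hχ hs).const_mul _),
      integral_const_mul, integral_const_mul] at hparts
    have h1' := h1 τ x hx hτ
    have h2' := h2 τ x hx hτ
    have e : ‖∫ ξ, E n ξ * χ ξ‖ = ‖(∫ ξ, E (n + 1) ξ * fderiv ℝ χ ξ v)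
        + (((n + 1) * (2 * τ) : ℝ) : ℂ) * ∫ ξ, E (n + 2) ξ * χ ξ‖ := by
      have : (∫ ξ, E (n + 1) ξ * fderiv ℝ χ ξ v)
          + (((n + 1) * (2 * τ) : ℝ) : ℂ) * ∫ ξ, E (n + 2) ξ * χ ξ
          = -(Complex.I * ∫ ξ, E n ξ * χ ξ) := by
        rw [hparts]; push_cast; ring
      rw [this, norm_neg, norm_mul, Complex.norm_I, one_mul]
    have hx' := abs_pos.2 hx
    calc ‖∫ ξ, E n ξ * χ ξ‖
        ≤ C1 * |x j|⁻¹ ^ (n + 1 + M) + ((n + 1) * (2 * |τ|)) * (C2 * |x j|⁻¹ ^ (n + 2 + M)) := by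
          rw [e]
          refine (norm_add_le _ _).trans ?_
          rw [norm_mul, Complex.norm_real, Real.norm_eq_abs, abs_mul, abs_mul, abs_two,
            abs_of_nonneg (by positivity : (0 : ℝ) ≤ (n : ℝ) + 1)]
          gcongr
      _ ≤ C1 * |x j|⁻¹ ^ (n + 1 + M)
          + ((n + 1) * (2 * (|x j| / (4 * R)))) * (C2 * |x j|⁻¹ ^ (n + 2 + M)) := by
          gcongr
          rw [le_div_iff₀ (by positivity)]; linarith
      _ = _ := by
          rw [show n + (M + 1) = n + 1 + M by ring, show n + 2 + M = n + 1 + M + 1 by ring, pow_succ]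
          field_simp

theorem exists_norm_le_mul_abs_apply (x : Rd d) (hx : x ≠ 0) :
    ∃ j, ‖x‖ ≤ (d + 1) * |x j| := by
  by_contra! h
  have hx' : 0 < ‖x‖ := norm_pos_iff.2 hx
  have h1 : ‖x‖ ^ 2 = ∑ j, |x j| ^ 2 := by
    rw [EuclideanSpace.norm_sq_eq]; simp [Real.norm_eq_abs]
  have h2 : ∑ j, |x j| ^ 2 ≤ ∑ _j : Fin d, (‖x‖ / (d + 1)) ^ 2 := by
    refine Finset.sum_le_sum fun j _ => ?_
    refine pow_le_pow_left₀ (abs_nonneg _) ?_ 2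
    rw [le_div_iff₀ (by positivity), mul_comm]
    exact (h j).le
  rw [← h1, Finset.sum_const, Finset.card_univ, Fintype.card_fin, nsmul_eq_mul, div_pow,
    ← mul_div_assoc, le_div_iff₀ (by positivity), mul_comm (d : ℝ)] at h2
  have h3 := le_of_mul_le_mul_left h2 (by positivity : 0 < ‖x‖ ^ 2)
  nlinarith [(Nat.cast_nonneg d : (0 : ℝ) ≤ d)]

/-- Rapid decay of the Schrödinger kernel outside of the region reached by its frequencies. -/
theorem exists_kern_evo_decay {m : Rd d → ℂ} (hm : ContDiff ℝ ∞ m) (hc : HasCompactSupport m)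
    (M : ℕ) : ∃ A C : ℝ, 1 ≤ A ∧ 0 ≤ C ∧ ∀ (τ : ℝ) (x : Rd d), A * |τ| ≤ ‖x‖ →
      ‖kern (evo m τ) x‖ ≤ C * ((1 + ‖x‖) ^ M)⁻¹ := by
  obtain ⟨R₀, hR₀⟩ := hc.isCompact.isBounded.subset_closedBall 0
  set R := max R₀ 1 with hRdef
  have hR : 0 < R := lt_of_lt_of_le one_pos (le_max_right _ _)
  have hs : ∀ ξ, m ξ ≠ 0 → ‖ξ‖ ≤ R := fun ξ hξ => by
    have := hR₀ (subset_tsupport _ hξ)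
    rw [mem_closedBall_zero_iff] at this
    exact this.trans (le_max_left _ _)
  choose C hC0 hC using fun j => exists_nonstationary_bound hR j M 0 m hm hs
  set c := ‖(((2 * Real.pi) ^ d : ℝ) : ℂ)⁻¹‖
  set B := c * ∫ ξ, ‖m ξ‖ with hB
  have hB0 : 0 ≤ B := by positivity
  have hR1 : 1 ≤ R := le_max_right _ _
  -- For a coordinate with `‖x‖ ≤ (d + 1) |x j|`, this `A` turns `A |τ| ≤ ‖x‖` into `4 R |τ| ≤ |x
  -- j|`. The two summands of the constant cover `‖x‖ ≤ 1` and `‖x‖ > 1`.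
  refine ⟨4 * R * (d + 1), B * 2 ^ M + c * (∑ j, C j) * (2 * (d + 1)) ^ M, ?_, ?_, ?_⟩
  · nlinarith [(Nat.cast_nonneg d : (0 : ℝ) ≤ d)]
  · have := Finset.sum_nonneg fun j (_ : j ∈ Finset.univ) => hC0 j
    positivity
  intro τ x hτ
  have hSC := Finset.sum_nonneg fun j (_ : j ∈ Finset.univ) => hC0 j
  have hx0 := norm_nonneg x
  rcases le_or_gt ‖x‖ 1 with h1 | h1
  · have h2 : (1 + ‖x‖) ^ M ≤ 2 ^ M := pow_le_pow_left₀ (by positivity) (by linarith) M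
    calc ‖kern (evo m τ) x‖ ≤ B := norm_kern_evo_le m τ x
      _ ≤ B * 2 ^ M * ((1 + ‖x‖) ^ M)⁻¹ := by
          rw [← div_eq_mul_inv, le_div_iff₀ (by positivity)]
          gcongr
      _ ≤ _ := by
          gcongr
          exact le_add_of_nonneg_right (by positivity)
  · have hxne : x ≠ 0 := by rintro rfl; simp at h1; linarith
    obtain ⟨j, hj⟩ := exists_norm_le_mul_abs_apply x hxne
    have hd1 : (0 : ℝ) < d + 1 := by positivity
    have hxj : 0 < |x j| := by
      by_contra hcon
      have : |x j| = 0 := le_antisymm (not_lt.1 hcon) (abs_nonneg _)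
      rw [this] at hj; linarith
    have hτj : 4 * R * |τ| ≤ |x j| := by
      have : 4 * R * (d + 1) * |τ| ≤ (d + 1) * |x j| := hτ.trans hj
      nlinarith
    have key := hC j τ x (abs_pos.1 hxj) hτj
    simp only [pow_zero, Complex.ofReal_one, one_mul, zero_add] at key
    have h3 : |x j|⁻¹ ≤ 2 * (d + 1) * (1 + ‖x‖)⁻¹ := by
      rw [← div_eq_mul_inv, le_div_iff₀ (by positivity), inv_mul_le_iff₀ hxj]
      linarith
    calc ‖kern (evo m τ) x‖ ≤ c * (C j * |x j|⁻¹ ^ M) := by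
          rw [kern_evo_eq_phase, norm_mul]
          gcongr
      _ ≤ c * ((∑ j, C j) * (2 * (d + 1) * (1 + ‖x‖)⁻¹) ^ M) := by
          gcongr
          exact Finset.single_le_sum (fun j _ => hC0 j) (Finset.mem_univ j)
      _ = c * (∑ j, C j) * (2 * (d + 1)) ^ M * ((1 + ‖x‖) ^ M)⁻¹ := by
          rw [mul_pow, inv_pow]; ring
      _ ≤ _ := by
          gcongr
          exact le_add_of_nonneg_left (by positivity)

theorem continuous_kern_evo {m : Rd d → ℂ} (hm : ContDiff ℝ ∞ m) (hc : HasCompactSupport m) :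
    Continuous (fun z : Rd d × ℝ => kern (evo m z.2) z.1) := by
  simp only [kern_evo_eq_phase]
  refine continuous_const.mul ?_
  refine continuous_of_dominated (bound := fun ξ => ‖m ξ‖) ?_ ?_ ?_ ?_
  · intro z
    have := continuous_phase z.1 z.2
    have := hm.continuous
    exact Continuous.aestronglyMeasurable (by fun_prop)
  · intro z
    refine Filter.Eventually.of_forall fun ξ => ?_
    rw [norm_mul, norm_exp_I_mul_ofReal, one_mul]
  · exact (hm.continuous.integrable_of_hasCompactSupport hc).norm
  · refine Filter.Eventually.of_forall fun ξ => ?_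
    unfold phase
    fun_prop

open Filter Topology in
/-- The dispersive representation of the Schrödinger kernel. -/
theorem exists_kern_evo_eq {m : Rd d → ℂ} (hm : ContDiff ℝ ∞ m) (hc : HasCompactSupport m)
    {t : ℝ} (ht : t ≠ 0) : ∃ c : ℂ, ‖c‖ = (4 * Real.pi * |t|) ^ (-(d : ℝ) / 2) ∧
      ∀ x, kern (evo m t) x
        = c * ∫ y, kern m y * Complex.exp (Complex.I * ((‖x - y‖ ^ 2 / (4 * t) : ℝ) : ℂ)) := by
  set a : ℂ := (((2 * Real.pi) ^ d : ℝ) : ℂ)⁻¹ with ha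
  -- Damping by `e^{-ε‖ξ‖²}` makes Fubini and the Gaussian integral with complex parameter `ε + i t`
  -- available; then `ε → 0⁺` by dominated convergence on both sides.
  set b : ℝ → ℂ := fun ε => (ε : ℂ) + Complex.I * t with hb
  have hbre : ∀ ε, (b ε).re = ε := fun ε => by simp [hb]
  have hb0 : b 0 = Complex.I * t := by simp [hb]
  have hb0ne : b 0 ≠ 0 := by rw [hb0]; simp [ht]
  refine ⟨a * ((Real.pi : ℂ) / b 0) ^ ((d : ℂ) / 2), ?_, fun x => ?_⟩
  · have e : (d : ℂ) / 2 = (((d : ℝ) / 2 : ℝ) : ℂ) := by push_cast; ring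
    have ht' := abs_pos.2 ht
    rw [norm_mul, e, Complex.norm_cpow_real, hb0, norm_div, norm_mul, Complex.norm_I, one_mul,
      Complex.norm_real, Complex.norm_real, Real.norm_eq_abs, Real.norm_eq_abs,
      abs_of_pos Real.pi_pos, ha, norm_inv, Complex.norm_real, Real.norm_of_nonneg (by positivity),
      ← Real.rpow_natCast, ← Real.rpow_neg (by positivity),
      show -(d : ℝ) = 2 * (-(d : ℝ) / 2) by ring, Real.rpow_mul (by positivity),
      show (d : ℝ) / 2 = -(-(d : ℝ) / 2) by ring, Real.rpow_neg (by positivity),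
      ← Real.inv_rpow (by positivity), ← Real.mul_rpow (by positivity) (by positivity)]
    congr 1
    · rw [Real.rpow_two]; field_simp; ring
    · ring
  have hmi : Integrable m := hm.continuous.integrable_of_hasCompactSupport hc
  have hki := integrable_kern hm hc
  set J : ℝ → ℂ := fun ε => a * ∫ ξ, m ξ * (Complex.exp (-b ε * (‖ξ‖ : ℂ) ^ 2
    + Complex.I * ((⟪x, ξ⟫ : ℝ) : ℂ))) with hJ
  have hnorm : ∀ ε, 0 ≤ ε → ∀ (z ξ : Rd d), ‖Complex.exp (-b ε * (‖ξ‖ : ℂ) ^ 2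
      + Complex.I * ((⟪z, ξ⟫ : ℝ) : ℂ))‖ ≤ 1 := by
    intro ε hε z ξ
    rw [Complex.norm_exp, Real.exp_le_one_iff]
    have : (-b ε * (‖ξ‖ : ℂ) ^ 2 + Complex.I * ((⟪z, ξ⟫ : ℝ) : ℂ)).re = - ε * ‖ξ‖ ^ 2 := by
      rw [← Complex.ofReal_pow, Complex.add_re, Complex.re_mul_ofReal,
        Complex.neg_re, hbre]
      simp
    rw [this]
    nlinarith [sq_nonneg ‖ξ‖]
  have hlim1 : Tendsto J (𝓝[>] 0) (𝓝 (kern (evo m t) x)) := by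
    have : kern (evo m t) x = a * ∫ ξ, m ξ * (Complex.exp (-b 0 * (‖ξ‖ : ℂ) ^ 2
        + Complex.I * ((⟪x, ξ⟫ : ℝ) : ℂ))) := by
      rw [kern]
      congr 2; ext ξ
      rw [evo, mul_assoc, ← Complex.exp_add, hb0]
      congr 2
      push_cast; ring
    rw [this]
    refine Tendsto.const_mul _ ?_
    refine tendsto_integral_filter_of_dominated_convergence (fun ξ => ‖m ξ‖) ?_ ?_ hmi.norm ?_
    · refine Eventually.of_forall fun ε => ?_
      have := hm.continuous
      exact Continuous.aestronglyMeasurable (by fun_prop)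
    · filter_upwards [self_mem_nhdsWithin] with ε hε
      refine Eventually.of_forall fun ξ => ?_
      rw [norm_mul]
      exact mul_le_of_le_one_right (norm_nonneg _) (hnorm ε (le_of_lt hε) x ξ)
    · refine Eventually.of_forall fun ξ => ?_
      have hcont : Continuous (fun ε => m ξ * (Complex.exp (-b ε * (‖ξ‖ : ℂ) ^ 2
        + Complex.I * ((⟪x, ξ⟫ : ℝ) : ℂ)))) := by
        simp only [hb]; fun_prop
      exact (hcont.tendsto 0).mono_left nhdsWithin_le_nhds
  have hJeq : ∀ ε, 0 < ε → J ε = a * ((Real.pi : ℂ) / b ε) ^ ((d : ℂ) / 2) *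
      ∫ y, kern m y * Complex.exp (-(‖x - y‖ : ℂ) ^ 2 / (4 * b ε)) := by
    intro ε hε
    have hbε : 0 < (b ε).re := by rw [hbre]; exact hε
    have hgauss : Integrable (fun ξ : Rd d => Complex.exp (-b ε * (‖ξ‖ : ℂ) ^ 2)) := by
      have := GaussianFourier.integrable_cexp_neg_mul_sq_norm_add hbε 0 (0 : Rd d)
      simpa using this
    have hprod : Integrable (fun z : Rd d × Rd d =>
        (kern m z.2 * Complex.exp (-Complex.I * ((⟪z.2, z.1⟫ : ℝ) : ℂ))) *
        Complex.exp (-b ε * (‖z.1‖ : ℂ) ^ 2 + Complex.I * ((⟪x, z.1⟫ : ℝ) : ℂ)))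
        (volume.prod volume) := by
      have h0 := hgauss.mul_prod hki
      refine h0.norm.mono' ?_ (Eventually.of_forall fun z => ?_)
      · have := continuous_kern hm hc
        exact Continuous.aestronglyMeasurable (by fun_prop)
      · rw [norm_mul, norm_mul, norm_mul, Complex.exp_add, norm_mul, norm_exp_I_mul_ofReal, mul_one]
        have : ‖Complex.exp (-Complex.I * ((⟪z.2, z.1⟫ : ℝ) : ℂ))‖ = 1 := by
          have := norm_exp_I_mul_ofReal (-⟪z.2, z.1⟫)
          rwa [Complex.ofReal_neg, mul_neg, ← neg_mul] at this
        rw [this, mul_one, mul_comm]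
    simp only [hJ]
    rw [mul_assoc]
    congr 1
    calc ∫ ξ, m ξ * (Complex.exp (-b ε * (‖ξ‖ : ℂ) ^ 2 + Complex.I * ((⟪x, ξ⟫ : ℝ) : ℂ)))
        = ∫ ξ, ∫ y, (kern m y * Complex.exp (-Complex.I * ((⟪y, ξ⟫ : ℝ) : ℂ))) *
            Complex.exp (-b ε * (‖ξ‖ : ℂ) ^ 2 + Complex.I * ((⟪x, ξ⟫ : ℝ) : ℂ)) := by
          congr 1; ext ξ
          rw [integral_mul_const, integral_kern_mul_exp hm hc]
      _ = ∫ y, ∫ ξ, (kern m y * Complex.exp (-Complex.I * ((⟪y, ξ⟫ : ℝ) : ℂ))) *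
            Complex.exp (-b ε * (‖ξ‖ : ℂ) ^ 2 + Complex.I * ((⟪x, ξ⟫ : ℝ) : ℂ)) :=
          integral_integral_swap hprod
      _ = ∫ y, kern m y * (((Real.pi : ℂ) / b ε) ^ ((d : ℂ) / 2)
            * Complex.exp (-(‖x - y‖ : ℂ) ^ 2 / (4 * b ε))) := by
          congr 1; ext y
          have hg := GaussianFourier.integral_cexp_neg_mul_sq_norm_add hbε Complex.I (x - y)
          rw [finrank_euclideanSpace_fin, Complex.I_sq, neg_one_mul] at hg
          rw [← hg, ← integral_const_mul]
          congr 1; ext ξ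
          rw [mul_assoc, ← Complex.exp_add]
          congr 2
          rw [inner_sub_left]; push_cast; ring
      _ = _ := by
          rw [← integral_const_mul]
          congr 1; ext y; ring
  have hlim2 : Tendsto J (𝓝[>] 0) (𝓝 (a * ((Real.pi : ℂ) / b 0) ^ ((d : ℂ) / 2) *
      ∫ y, kern m y * Complex.exp (-(‖x - y‖ : ℂ) ^ 2 / (4 * b 0)))) := by
    have hbc : Continuous b := by simp only [hb]; fun_prop
    have : Tendsto (fun ε => a * ((Real.pi : ℂ) / b ε) ^ ((d : ℂ) / 2) *
      ∫ y, kern m y * Complex.exp (-(‖x - y‖ : ℂ) ^ 2 / (4 * b ε))) (𝓝[>] 0)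
      (𝓝 (a * ((Real.pi : ℂ) / b 0) ^ ((d : ℂ) / 2) *
      ∫ y, kern m y * Complex.exp (-(‖x - y‖ : ℂ) ^ 2 / (4 * b 0)))) := by
      refine Tendsto.mul (Tendsto.const_mul _ ?_) ?_
      -- `π / (i t)` is nonzero and purely imaginary, hence off the branch cut of the power.
      · have hca : ContinuousAt (fun ε => ((Real.pi : ℂ) / b ε) ^ ((d : ℂ) / 2)) 0 := by
          refine ContinuousAt.cpow (continuousAt_const.div hbc.continuousAt hb0ne)
            continuousAt_const ?_
          rw [Complex.mem_slitPlane_iff, hb0]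
          right
          rw [div_eq_mul_inv, Complex.im_ofReal_mul, mul_inv, Complex.inv_I, ← Complex.ofReal_inv]
          simp [ht, Real.pi_ne_zero]
        exact hca.tendsto.mono_left nhdsWithin_le_nhds
      · refine tendsto_integral_filter_of_dominated_convergence (fun y => ‖kern m y‖) ?_ ?_
          hki.norm ?_
        · refine Eventually.of_forall fun ε => ?_
          have := continuous_kern hm hc
          exact Continuous.aestronglyMeasurable (by fun_prop)
        · filter_upwards [self_mem_nhdsWithin] with ε hε
          refine Eventually.of_forall fun y => ?_
          rw [norm_mul]
          refine mul_le_of_le_one_right (norm_nonneg _) ?_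
          rw [Complex.norm_exp, Real.exp_le_one_iff, ← Complex.ofReal_pow, ← Complex.ofReal_neg,
            div_eq_mul_inv, Complex.re_ofReal_mul, mul_inv,
            show (4 : ℂ)⁻¹ = ((4⁻¹ : ℝ) : ℂ) by push_cast; rfl, Complex.re_ofReal_mul,
            Complex.inv_re, hbre]
          have h5 : 0 ≤ ε / Complex.normSq (b ε) := div_nonneg (le_of_lt hε) (Complex.normSq_nonneg _)
          nlinarith [mul_nonneg (sq_nonneg ‖x - y‖) h5]
        · refine Eventually.of_forall fun y => ?_
          have hca : ContinuousAt (fun ε => kern m y *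
              Complex.exp (-(‖x - y‖ : ℂ) ^ 2 / (4 * b ε))) 0 := by
            refine continuousAt_const.mul (ContinuousAt.cexp ?_)
            exact continuousAt_const.div (continuousAt_const.mul hbc.continuousAt)
              (mul_ne_zero (by norm_num) hb0ne)
          exact hca.tendsto.mono_left nhdsWithin_le_nhds
    refine this.congr' ?_
    filter_upwards [self_mem_nhdsWithin] with ε hε
    exact (hJeq ε hε).symm
  rw [tendsto_nhds_unique hlim1 hlim2]
  congr 2; ext y
  congr 2
  rw [hb0]
  have : (t : ℂ) ≠ 0 := by exact_mod_cast ht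
  push_cast
  field_simp
  rw [Complex.I_sq]; ring

/-! ### The pseudoconformal change of variables and the extension operator -/

theorem lintegral_smul_comp {r : ℝ} (hr : r ≠ 0) (f : Rd d → ℝ≥0∞) :
    ∫⁻ x, f x = ENNReal.ofReal (|r| ^ d) * ∫⁻ x, f (r • x) := by
  have h1 : ∫⁻ x, f (r • x) = ∫⁻ x, f x ∂(Measure.map (fun x => r • x) (volume : Measure (Rd d))) :=
    ((MeasurableEquiv.smul₀ r hr).measurableEmbedding.lintegral_map f).symm
  rw [h1, Measure.map_addHaar_smul volume hr, finrank_euclideanSpace_fin, lintegral_smul_measure,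
    smul_eq_mul, ← mul_assoc, ← ENNReal.ofReal_mul (by positivity), abs_inv, abs_pow,
    mul_inv_cancel₀ (by have := abs_pos.2 hr; positivity)]
  simp

/-- The pseudoconformal change of variables `(x, t) ↦ (ρ x / 2t, ρ² / 4t - s₀)`. -/
theorem lintegral_pseudoconformal {ρ : ℝ} (hρ : 0 < ρ) (s₀ : ℝ) {J : Set ℝ} (hJ : MeasurableSet J)
    (h0 : ∀ t ∈ J, t ≠ 0) (Ψ : Rd d × ℝ → ℝ≥0∞) :
    ∫⁻ s in (fun t : ℝ => ρ ^ 2 / (4 * t) - s₀) '' J, ∫⁻ ξ, Ψ (ξ, s)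
      = ∫⁻ t in J, ENNReal.ofReal (ρ ^ 2 / (4 * t ^ 2) * (ρ / (2 * |t|)) ^ d) *
          ∫⁻ x, Ψ ((ρ / (2 * t)) • x, ρ ^ 2 / (4 * t) - s₀) := by
  have hd : ∀ t ∈ J, HasDerivWithinAt (fun t : ℝ => ρ ^ 2 / (4 * t) - s₀)
      (-(ρ ^ 2 / (4 * t ^ 2))) J t := by
    intro t ht
    have ht0 := h0 t ht
    have h1 : HasDerivAt (fun t : ℝ => ρ ^ 2 / (4 * t) - s₀) (-(ρ ^ 2 / (4 * t ^ 2))) t := by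
      have h2 := ((hasDerivAt_const t (ρ ^ 2)).div ((hasDerivAt_id t).const_mul 4)
        (by simpa using ht0)).sub_const s₀
      refine h2.congr_deriv ?_
      simp only [id]
      field_simp
      ring
    exact h1.hasDerivWithinAt
  have hinj : InjOn (fun t : ℝ => ρ ^ 2 / (4 * t) - s₀) J := by
    intro t ht t' ht' h
    have ht0 := h0 t ht
    have ht0' := h0 t' ht'
    have h1 : ρ ^ 2 / (4 * t) = ρ ^ 2 / (4 * t') := by simpa using h
    rw [div_eq_div_iff (by positivity) (by positivity)] at h1
    have h2 : ρ ^ 2 * 4 ≠ 0 := by positivity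
    have h3 : (ρ ^ 2 * 4) * t' = (ρ ^ 2 * 4) * t := by linarith
    exact (mul_left_cancel₀ h2 h3).symm
  rw [lintegral_image_eq_lintegral_abs_deriv_mul hJ hd hinj]
  refine setLIntegral_congr_fun hJ fun t ht => ?_
  have ht0 := h0 t ht
  have hr : ρ / (2 * t) ≠ 0 := by positivity
  rw [abs_neg, abs_of_nonneg (by positivity), lintegral_smul_comp hr, ← mul_assoc,
    ← ENNReal.ofReal_mul (by positivity), abs_div, abs_mul, abs_two, abs_of_pos hρ]

/-- The extension operator over the whole space. -/
noncomputable def fullExt (h : Rd d → ℂ) (z : Rd d × ℝ) : ℂ :=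
  ∫ y, h y * Complex.exp (Complex.I * ((z.2 * ‖y‖ ^ 2 - ⟪z.1, y⟫ : ℝ) : ℂ))

theorem extensionOp_eq_fullExt {h : Rd d → ℂ} (hh : ∀ y, h y ≠ 0 → ‖y‖ ≤ 1) (z : Rd d × ℝ) :
    extensionOp h z = fullExt h z := by
  rw [extensionOp, fullExt, ← integral_indicator Metric.isClosed_closedBall.measurableSet]
  congr 1; ext y
  by_cases hy : y ∈ Metric.closedBall (0 : Rd d) 1
  · rw [indicator_of_mem hy]
  · rw [indicator_of_notMem hy]
    have : h y = 0 := by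
      by_contra hne
      exact hy (by simpa using hh y hne)
    rw [this, zero_mul]

/-- The Schrödinger evolution at time `t`, up to a constant depending on `t`. -/
noncomputable def chirp (t : ℝ) (H : Rd d → ℂ) (x : Rd d) : ℂ :=
  ∫ y, H y * Complex.exp (Complex.I * ((‖x - y‖ ^ 2 / (4 * t) : ℝ) : ℂ))

/-- Expanding `‖x - ρ y‖²` gives a unimodular factor in `x` alone, a quadratic phase in `y` and a
linear one: the extension operator at the pseudoconformal point. -/
theorem norm_chirp_eq {t ρ : ℝ} (ht : t ≠ 0) (hρ : 0 < ρ) (H : Rd d → ℂ) (x : Rd d) :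
    ‖chirp t H x‖ = ρ ^ d * ‖fullExt (fun y => H (ρ • y)) ((ρ / (2 * t)) • x, ρ ^ 2 / (4 * t))‖ := by
  have h1 := Measure.integral_comp_smul (volume : Measure (Rd d)) (fun y =>
    H y * Complex.exp (Complex.I * ((‖x - y‖ ^ 2 / (4 * t) : ℝ) : ℂ))) ρ
  have h2 : chirp t H x = ((ρ ^ d : ℝ) : ℂ) * ∫ y, H (ρ • y) *
      Complex.exp (Complex.I * ((‖x - ρ • y‖ ^ 2 / (4 * t) : ℝ) : ℂ)) := by
    rw [h1, finrank_euclideanSpace_fin, abs_of_nonneg (by positivity), Complex.real_smul,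
      ← mul_assoc, ← Complex.ofReal_mul, mul_inv_cancel₀ (by positivity), chirp]
    simp
  have h3 : (∫ y, H (ρ • y) * Complex.exp (Complex.I * ((‖x - ρ • y‖ ^ 2 / (4 * t) : ℝ) : ℂ)))
      = Complex.exp (Complex.I * ((‖x‖ ^ 2 / (4 * t) : ℝ) : ℂ)) *
        fullExt (fun y => H (ρ • y)) ((ρ / (2 * t)) • x, ρ ^ 2 / (4 * t)) := by
    rw [fullExt, ← integral_const_mul]
    congr 1; ext y
    rw [mul_left_comm, ← Complex.exp_add, ← mul_add, ← Complex.ofReal_add]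
    congr 4
    rw [norm_sub_sq_real, inner_smul_right, norm_smul, real_inner_smul_left,
      Real.norm_of_nonneg hρ.le]
    field_simp
    ring
  rw [h2, h3, norm_mul, norm_mul, norm_exp_I_mul_ofReal, one_mul, Complex.norm_real,
    Real.norm_of_nonneg (by positivity)]

theorem chirp_comp_add (t : ℝ) (H : Rd d → ℂ) (z x : Rd d) :
    chirp t (fun y => H (y + z)) x = chirp t H (x + z) := by
  rw [chirp, chirp, ← integral_add_right_eq_self (fun y => H y * _) z]
  congr 1; ext y
  rw [add_sub_add_right_eq_sub]

/-! ### From adjoint restriction to frequency localized evolutions on one dyadic time interval -/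

/-- The adjoint restriction estimate, transferred to Schrödinger evolutions of functions supported
in a ball whose radius is comparable to the time. -/
theorem AdjointRestriction.lintegral_chirp_le {p q : ℝ} (hp : 0 < p) (hq : 0 < q)
    (h : AdjointRestriction d p q) {a : ℝ} (ha : 0 < a) :
    ∃ C : ℝ≥0∞, C ≠ ⊤ ∧ ∀ (N : ℝ), 0 < N → ∀ (z : Rd d) (H : Rd d → ℂ),
      MemLp H (ENNReal.ofReal p) volume → (∀ y, H y ≠ 0 → ‖y - z‖ ≤ a * N) →
      ∫⁻ t in Icc N (2 * N), ∫⁻ x, ‖chirp t H x‖ₑ ^ q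
        ≤ C * ENNReal.ofReal (N ^ (d * q * (1 - 1 / p))) * (∫⁻ y, ‖H y‖ₑ ^ p) ^ (q / p) := by
  obtain ⟨C, hC⟩ := h
  refine ⟨ENNReal.ofReal ((4 / a) ^ (d + 2)) * (C : ℝ≥0∞) ^ q
    * ENNReal.ofReal (a ^ (d * q * (1 - 1 / p))), ?_, ?_⟩
  · exact ENNReal.mul_ne_top (ENNReal.mul_ne_top ENNReal.ofReal_ne_top
      (ENNReal.rpow_ne_top_of_nonneg hq.le ENNReal.coe_ne_top)) ENNReal.ofReal_ne_top
  intro N hN z H hH hsupp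
  set ρ := a * N with hρdef
  have hρ : 0 < ρ := by positivity
  set H₀ : Rd d → ℂ := fun y => H (y + z) with hH₀
  set g : Rd d → ℂ := fun y => H₀ (ρ • y) with hg
  have hgs : ∀ y, g y ≠ 0 → ‖y‖ ≤ 1 := by
    intro y hy
    have := hsupp _ hy
    rw [add_sub_cancel_right, norm_smul, Real.norm_of_nonneg hρ.le] at this
    exact le_of_mul_le_mul_left (by linarith) hρ
  have hH₀m : MemLp H₀ (ENNReal.ofReal p) volume :=
    hH.comp_measurePreserving (measurePreserving_add_right volume z)
  have hqmp : Measure.QuasiMeasurePreserving (fun y : Rd d => ρ • y) volume volume := by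
    refine ⟨by fun_prop, ?_⟩
    rw [Measure.map_addHaar_smul volume hρ.ne']
    exact Measure.smul_absolutelyContinuous
  have hgp : ∫⁻ y, ‖H y‖ₑ ^ p = ENNReal.ofReal (ρ ^ d) * ∫⁻ y, ‖g y‖ₑ ^ p := by
    rw [← lintegral_add_right_eq_self _ z, lintegral_smul_comp hρ.ne', abs_of_pos hρ]
  have hρd : ENNReal.ofReal (ρ ^ d) ≠ 0 := by
    rw [Ne, ENNReal.ofReal_eq_zero, not_le]; positivity
  have hgm : MemLp g (ENNReal.ofReal p) volume := by
    rw [memLp_ofReal_iff hp] at hH₀m hH ⊢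
    refine ⟨hH₀m.1.comp_quasiMeasurePreserving hqmp, fun hcon => hH.2 ?_⟩
    rw [hgp, hcon, ENNReal.mul_top hρd]
  obtain ⟨hE, hEle⟩ := hC g hgm
  have hEq := ENNReal.rpow_le_rpow hEle hq.le
  rw [eLpNorm_ofReal_rpow hq, ENNReal.mul_rpow_of_nonneg _ _ hq.le, eLpNorm_ofReal_eq hp,
    ← ENNReal.rpow_mul, one_div_mul_eq_div] at hEq
  have hchirp : ∀ t ∈ Icc N (2 * N), ∫⁻ x, ‖chirp t H x‖ₑ ^ q
      = ENNReal.ofReal ((ρ ^ d) ^ q) *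
        ∫⁻ x, ‖extensionOp g ((ρ / (2 * t)) • x, ρ ^ 2 / (4 * t) - 0)‖ₑ ^ q := by
    intro t ht
    have ht0 : t ≠ 0 := (hN.trans_le ht.1).ne'
    rw [← lintegral_add_right_eq_self _ z, ← lintegral_const_mul' _ _ ENNReal.ofReal_ne_top]
    refine lintegral_congr fun x => ?_
    rw [← chirp_comp_add, ← ofReal_norm, norm_chirp_eq ht0 hρ,
      ENNReal.ofReal_mul (by positivity), ENNReal.mul_rpow_of_nonneg _ _ hq.le,
      ENNReal.ofReal_rpow_of_nonneg (by positivity) hq.le, ofReal_norm, sub_zero,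
      extensionOp_eq_fullExt hgs]
  -- On `[N, 2N]` the Jacobian is `(ρ / 2t)^(d+2) ≥ (a/4)^(d+2)`, so it can be inserted before the
  -- change of variables at the cost of a constant.
  have hw : ∀ t ∈ Icc N (2 * N), (1 : ℝ≥0∞) ≤ ENNReal.ofReal ((4 / a) ^ (d + 2)) *
      ENNReal.ofReal (ρ ^ 2 / (4 * t ^ 2) * (ρ / (2 * |t|)) ^ d) := by
    intro t ht
    have ht0 : 0 < t := hN.trans_le ht.1
    rw [← ENNReal.ofReal_mul (by positivity), ENNReal.one_le_ofReal, abs_of_pos ht0]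
    have h1 : a / 4 ≤ ρ / (2 * t) := by
      rw [div_le_div_iff₀ (by norm_num) (by positivity), hρdef]
      nlinarith [ht.2]
    have h2 : ρ ^ 2 / (4 * t ^ 2) * (ρ / (2 * t)) ^ d = (ρ / (2 * t)) ^ (d + 2) := by
      rw [pow_add, div_pow ρ (2 * t) 2]; ring
    rw [h2, ← mul_pow]
    refine one_le_pow₀ ?_
    calc (1 : ℝ) = 4 / a * (a / 4) := by field_simp
      _ ≤ _ := by gcongr
  calc ∫⁻ t in Icc N (2 * N), ∫⁻ x, ‖chirp t H x‖ₑ ^ q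
      ≤ ∫⁻ t in Icc N (2 * N), ENNReal.ofReal ((ρ ^ d) ^ q) * ENNReal.ofReal ((4 / a) ^ (d + 2)) *
          (ENNReal.ofReal (ρ ^ 2 / (4 * t ^ 2) * (ρ / (2 * |t|)) ^ d) *
          ∫⁻ x, ‖extensionOp g ((ρ / (2 * t)) • x, ρ ^ 2 / (4 * t) - 0)‖ₑ ^ q) := by
        refine setLIntegral_mono' measurableSet_Icc fun t ht => ?_
        rw [hchirp t ht, mul_assoc]
        gcongr
        rw [← mul_assoc]
        exact le_mul_of_one_le_left' (hw t ht)
    _ = ENNReal.ofReal ((ρ ^ d) ^ q) * ENNReal.ofReal ((4 / a) ^ (d + 2)) *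
        ∫⁻ s in (fun t : ℝ => ρ ^ 2 / (4 * t) - 0) '' Icc N (2 * N),
          ∫⁻ ξ, ‖extensionOp g (ξ, s)‖ₑ ^ q := by
        rw [lintegral_pseudoconformal hρ 0 measurableSet_Icc
          (fun t ht => (hN.trans_le ht.1).ne') (fun z => ‖extensionOp g z‖ₑ ^ q),
          lintegral_const_mul' _ _ (ENNReal.mul_ne_top ENNReal.ofReal_ne_top ENNReal.ofReal_ne_top)]
    _ ≤ ENNReal.ofReal ((ρ ^ d) ^ q) * ENNReal.ofReal ((4 / a) ^ (d + 2)) *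
        ∫⁻ z, ‖extensionOp g z‖ₑ ^ q := by
        gcongr
        rw [Measure.volume_eq_prod, lintegral_prod_symm _ (hE.1.enorm.pow_const q)]
        exact setLIntegral_le_lintegral _ _
    _ ≤ ENNReal.ofReal ((ρ ^ d) ^ q) * ENNReal.ofReal ((4 / a) ^ (d + 2)) *
        ((C : ℝ≥0∞) ^ q * (∫⁻ y, ‖g y‖ₑ ^ p) ^ (q / p)) := by gcongr
    _ = _ := by
        have h3 : (∫⁻ y, ‖g y‖ₑ ^ p) ^ (q / p)
            = ENNReal.ofReal (ρ ^ (-(d * q / p))) * (∫⁻ y, ‖H y‖ₑ ^ p) ^ (q / p) := by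
          rw [hgp, ENNReal.mul_rpow_of_nonneg _ _ (by positivity), ← mul_assoc,
            ENNReal.ofReal_rpow_of_nonneg (by positivity) (by positivity),
            ← ENNReal.ofReal_mul (by positivity), ← Real.rpow_natCast, ← Real.rpow_mul hρ.le,
            ← Real.rpow_add hρ]
          have : -(d * q / p) + d * (q / p) = 0 := by ring
          rw [this]; simp
        -- The dilation contributes `ρ^(d q)` through the chirp and `ρ^(-d q / p)` through the norm
        -- of the datum, hence the exponent `d q (1 - 1/p)`.
        have h4 : ENNReal.ofReal ((ρ ^ d) ^ q) * ENNReal.ofReal (ρ ^ (-(d * q / p)))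
            = ENNReal.ofReal (a ^ (d * q * (1 - 1 / p))) *
              ENNReal.ofReal (N ^ (d * q * (1 - 1 / p))) := by
          rw [← ENNReal.ofReal_mul (by positivity), ← ENNReal.ofReal_mul (by positivity),
            ← Real.mul_rpow ha.le hN.le, ← hρdef, ← Real.rpow_natCast, ← Real.rpow_mul hρ.le,
            ← Real.rpow_add hρ]
          congr 2; ring
        rw [h3]
        calc _ = (ENNReal.ofReal ((ρ ^ d) ^ q) * ENNReal.ofReal (ρ ^ (-(d * q / p)))) *
              (ENNReal.ofReal ((4 / a) ^ (d + 2)) * (C : ℝ≥0∞) ^ q *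
              (∫⁻ y, ‖H y‖ₑ ^ p) ^ (q / p)) := by ring
          _ = _ := by rw [h4]; ring

theorem integrable_of_memLp_of_bounded_support {p : ℝ} (hp : 1 ≤ p) {H : Rd d → ℂ}
    (hH : MemLp H (ENNReal.ofReal p) volume) {z : Rd d} {R : ℝ}
    (hs : ∀ y, H y ≠ 0 → ‖y - z‖ ≤ R) : Integrable H := by
  have hfin : volume (Metric.closedBall z R) < ⊤ := measure_closedBall_lt_top
  have h1 : IntegrableOn H (Metric.closedBall z R) := by
    have : IsFiniteMeasure (volume.restrict (Metric.closedBall z R)) := ⟨by simpa using hfin⟩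
    exact (hH.restrict _).integrable (by rwa [ENNReal.one_le_ofReal])
  refine (integrableOn_iff_integrable_of_support_subset fun y hy => ?_).1 h1
  rw [Metric.mem_closedBall, dist_eq_norm]
  exact hs y hy

/-- The dispersive kernel is itself a convolution of `kern χ` with a chirp; integrability of `H`
allows the two convolutions to be exchanged. The remaining convolution with `kern χ` is bounded on
`L^q`, so the chirp alone needs an estimate. -/
theorem cv_kern_evo_eq {χ : Rd d → ℂ} (hχ : ContDiff ℝ ∞ χ) (hc : HasCompactSupport χ) {t : ℝ}
    (ht : t ≠ 0) {H : Rd d → ℂ} (hH : Integrable H) (x : Rd d) :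
    ‖cv (kern (evo χ t)) H x‖
      = (4 * Real.pi * |t|) ^ (-(d : ℝ) / 2) * ‖cv (kern χ) (chirp t H) x‖ := by
  obtain ⟨c, hcn, hce⟩ := exists_kern_evo_eq hχ hc ht
  have hki := integrable_kern hχ hc
  have hprod : Integrable (fun z : Rd d × Rd d => kern χ z.2 *
      Complex.exp (Complex.I * ((‖x - z.1 - z.2‖ ^ 2 / (4 * t) : ℝ) : ℂ)) * H z.1)
      (volume.prod volume) := by
    refine (hH.mul_prod hki).norm.mono' ?_ (Filter.Eventually.of_forall fun z => ?_)
    · refine AEStronglyMeasurable.mul (Continuous.aestronglyMeasurable ?_) hH.1.comp_fst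
      have := continuous_kern hχ hc
      fun_prop
    · rw [norm_mul, norm_mul, norm_mul, norm_exp_I_mul_ofReal, mul_one, mul_comm]
  have : cv (kern (evo χ t)) H x = c * cv (kern χ) (chirp t H) x := by
    calc cv (kern (evo χ t)) H x = c * ∫ w, ∫ y, kern χ y *
          Complex.exp (Complex.I * ((‖x - w - y‖ ^ 2 / (4 * t) : ℝ) : ℂ)) * H w := by
          rw [cv, ← integral_const_mul]
          congr 1; ext w
          rw [hce, integral_mul_const, mul_assoc]
      _ = c * ∫ y, ∫ w, kern χ y *
          Complex.exp (Complex.I * ((‖x - w - y‖ ^ 2 / (4 * t) : ℝ) : ℂ)) * H w := by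
          rw [integral_integral_swap hprod]
      _ = _ := by
          rw [cv_eq_integral_mul_sub]
          congr 2; ext y
          rw [chirp, ← integral_const_mul]
          congr 1; ext w
          rw [sub_right_comm]; ring
  rw [this, norm_mul, hcn]

theorem continuous_chirp {H : Rd d → ℂ} (hH : Integrable H) (t : ℝ) : Continuous (chirp t H) := by
  unfold chirp
  refine continuous_of_dominated (bound := fun y => ‖H y‖) ?_ ?_ hH.norm ?_
  · intro x
    exact hH.1.mul (Continuous.aestronglyMeasurable (by fun_prop))
  · intro x
    refine Filter.Eventually.of_forall fun y => ?_
    rw [norm_mul, norm_exp_I_mul_ofReal, mul_one]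
  · exact Filter.Eventually.of_forall fun y => by fun_prop

/-- The localized estimate for frequency localized evolutions of functions supported in a ball. -/
theorem AdjointRestriction.lintegral_cv_le_of_support {p q : ℝ} (hp : 1 ≤ p) (hq : 1 ≤ q)
    (h : AdjointRestriction d p q) {χ : Rd d → ℂ} (hχ : ContDiff ℝ ∞ χ)
    (hc : HasCompactSupport χ) {a : ℝ} (ha : 0 < a) :
    ∃ C : ℝ≥0∞, C ≠ ⊤ ∧ ∀ (N : ℝ), 0 < N → ∀ (z : Rd d) (H : Rd d → ℂ),
      MemLp H (ENNReal.ofReal p) volume → (∀ y, H y ≠ 0 → ‖y - z‖ ≤ a * N) →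
      ∫⁻ t in Icc N (2 * N), ∫⁻ x, ‖cv (kern (evo χ t)) H x‖ₑ ^ q
        ≤ C * ENNReal.ofReal (N ^ (d * q * (1 / 2 - 1 / p))) * (∫⁻ y, ‖H y‖ₑ ^ p) ^ (q / p) := by
  have hq0 : 0 < q := by linarith
  have hki := integrable_kern hχ hc
  obtain ⟨C, hCt, hC⟩ := h.lintegral_chirp_le (by linarith) hq0 ha
  set K := ∫⁻ y, ‖kern χ y‖ₑ with hK
  have hKt : K ≠ ⊤ := hki.2.ne
  refine ⟨K ^ q * C, ENNReal.mul_ne_top (ENNReal.rpow_ne_top_of_nonneg hq0.le hKt) hCt, ?_⟩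
  intro N hN z H hH hs
  have hHi := integrable_of_memLp_of_bounded_support hp hH hs
  have hpt : ∀ t ∈ Icc N (2 * N), ∫⁻ x, ‖cv (kern (evo χ t)) H x‖ₑ ^ q
      ≤ ENNReal.ofReal (N ^ (-(d * q / 2))) * K ^ q * ∫⁻ x, ‖chirp t H x‖ₑ ^ q := by
    intro t ht
    have ht0 : 0 < t := hN.trans_le ht.1
    have e : ∀ x, ‖cv (kern (evo χ t)) H x‖ₑ ^ q
        = ENNReal.ofReal (((4 * Real.pi * |t|) ^ (-(d : ℝ) / 2)) ^ q) *
          ‖cv (kern χ) (chirp t H) x‖ₑ ^ q := by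
      intro x
      rw [← ofReal_norm, cv_kern_evo_eq hχ hc ht0.ne' hHi, ENNReal.ofReal_mul (by positivity),
        ENNReal.mul_rpow_of_nonneg _ _ hq0.le, ENNReal.ofReal_rpow_of_nonneg (by positivity) hq0.le,
        ofReal_norm]
    simp only [e]
    rw [lintegral_const_mul' _ _ ENNReal.ofReal_ne_top, mul_assoc (ENNReal.ofReal (N ^ _))]
    refine mul_le_mul' ?_ ?_
    · refine ENNReal.ofReal_le_ofReal ?_
      rw [← Real.rpow_mul (by positivity), show -(d : ℝ) / 2 * q = -(d * q / 2) by ring,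
        Real.rpow_neg (by positivity), Real.rpow_neg (by positivity)]
      have h1 : N ≤ 4 * Real.pi * |t| := by
        rw [abs_of_pos ht0]
        nlinarith [ht.1, Real.pi_gt_three]
      gcongr
    · exact lintegral_cv_rpow_le (continuous_kern hχ hc).measurable
        (continuous_chirp hHi t).aestronglyMeasurable hq
  calc ∫⁻ t in Icc N (2 * N), ∫⁻ x, ‖cv (kern (evo χ t)) H x‖ₑ ^ q
      ≤ ∫⁻ t in Icc N (2 * N), ENNReal.ofReal (N ^ (-(d * q / 2))) * K ^ q *
          ∫⁻ x, ‖chirp t H x‖ₑ ^ q := setLIntegral_mono' measurableSet_Icc hpt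
    _ = ENNReal.ofReal (N ^ (-(d * q / 2))) * K ^ q *
          ∫⁻ t in Icc N (2 * N), ∫⁻ x, ‖chirp t H x‖ₑ ^ q := by
        rw [lintegral_const_mul' _ _ (ENNReal.mul_ne_top ENNReal.ofReal_ne_top
          (ENNReal.rpow_ne_top_of_nonneg hq0.le hKt))]
    _ ≤ ENNReal.ofReal (N ^ (-(d * q / 2))) * K ^ q *
          (C * ENNReal.ofReal (N ^ (d * q * (1 - 1 / p))) * (∫⁻ y, ‖H y‖ₑ ^ p) ^ (q / p)) := by
        gcongr
        exact hC N hN z H hH hs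
    _ = K ^ q * C * (ENNReal.ofReal (N ^ (-(d * q / 2))) *
          ENNReal.ofReal (N ^ (d * q * (1 - 1 / p)))) * (∫⁻ y, ‖H y‖ₑ ^ p) ^ (q / p) := by ring
    _ = _ := by
        rw [← ENNReal.ofReal_mul (by positivity), ← Real.rpow_add hN]
        congr 4; ring

/-- Averaging over balls of a fixed radius. -/
theorem lintegral_indicator_ball {α : Type*} [MeasurableSpace α] {μ : Measure α} [SFinite μ]
    {π : α → Rd d} (hπ : Measurable π) {F : α → ℝ≥0∞} (hF : AEMeasurable F μ) (R : ℝ) :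
    ∫⁻ z : Rd d, ∫⁻ w, {w | ‖π w - z‖ ≤ R}.indicator F w ∂μ
      = volume (Metric.closedBall (0 : Rd d) R) * ∫⁻ w, F w ∂μ := by
  have hset : MeasurableSet {v : Rd d × α | ‖π v.2 - v.1‖ ≤ R} :=
    measurableSet_le (by fun_prop) measurable_const
  have hm : AEMeasurable (fun v : Rd d × α => {w | ‖π w - v.1‖ ≤ R}.indicator F v.2)
      (volume.prod μ) := by
    have : (fun v : Rd d × α => {w | ‖π w - v.1‖ ≤ R}.indicator F v.2)
        = {v : Rd d × α | ‖π v.2 - v.1‖ ≤ R}.indicator (fun v => F v.2) := by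
      ext v; simp only [indicator, mem_ofPred_eq]
    rw [this]
    exact (hF.comp_quasiMeasurePreserving Measure.quasiMeasurePreserving_snd).indicator hset
  rw [lintegral_lintegral_swap hm, ← lintegral_const_mul'' _ hF]
  refine lintegral_congr fun w => ?_
  have : ∀ z, {w | ‖π w - z‖ ≤ R}.indicator F w
      = (Metric.closedBall (π w) R).indicator (fun _ => F w) z := by
    intro z
    simp only [indicator, mem_ofPred_eq, Metric.mem_closedBall, dist_eq_norm, norm_sub_rev z]
  simp only [this]
  rw [lintegral_indicator Metric.isClosed_closedBall.measurableSet, lintegral_const,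
    Measure.restrict_apply_univ, Measure.addHaar_closedBall_center, mul_comm]

theorem aestronglyMeasurable_cv_kern_evo {χ : Rd d → ℂ} (hχ : ContDiff ℝ ∞ χ)
    (hc : HasCompactSupport χ) {G : Rd d → ℂ} (hG : AEStronglyMeasurable G volume)
    (μ : Measure (Rd d × ℝ)) [SFinite μ] :
    AEStronglyMeasurable (fun w : Rd d × ℝ => cv (kern (evo χ w.2)) G w.1) μ := by
  refine AEStronglyMeasurable.integral_prod_right'
    (f := fun v : (Rd d × ℝ) × Rd d => kern (evo χ v.1.2) (v.1.1 - v.2) * G v.2) ?_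
  refine AEStronglyMeasurable.mul (Continuous.aestronglyMeasurable ?_) hG.comp_snd
  exact (continuous_kern_evo hχ hc).comp
    (by fun_prop : Continuous fun v : (Rd d × ℝ) × Rd d => (v.1.1 - v.2, v.1.2))

theorem integrable_kern_mul {χ : Rd d → ℂ} (hχ : ContDiff ℝ ∞ χ)
    (hc : HasCompactSupport χ) {G : Rd d → ℂ} {p : ℝ} (hp : 1 ≤ p)
    (hG : MemLp G (ENNReal.ofReal p) volume) (x : Rd d) :
    Integrable (fun y => kern χ (x - y) * G y) := by
  rw [memLp_ofReal_iff (by linarith)] at hG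
  obtain ⟨W, hW⟩ : ∃ W : ℝ, ∀ x, ‖kern χ x‖ ≤ W :=
    ⟨_, fun x => by simpa [evo_zero] using norm_kern_evo_le χ 0 x⟩
  refine integrable_kernel_mul (continuous_kern hχ hc).measurable (integrable_kern hχ hc).2.ne
    (W := ENNReal.ofReal W) (fun x => ?_) ENNReal.ofReal_ne_top hG.1 hp hG.2 x
  rw [← ofReal_norm]
  exact ENNReal.ofReal_le_ofReal (hW x)

theorem measurable_one_add_norm_weight (C : ℝ) :
    Measurable (fun x : Rd d => ENNReal.ofReal (C * ((1 + ‖x‖) ^ (d + 1))⁻¹)) := by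
  refine ENNReal.measurable_ofReal.comp (Continuous.measurable ?_)
  refine continuous_const.mul (Continuous.inv₀ (by fun_prop) fun x => by positivity)

theorem lintegral_one_add_norm_weight (C : ℝ) :
    ∫⁻ x : Rd d, ENNReal.ofReal (C * ((1 + ‖x‖) ^ (d + 1))⁻¹) ≠ ⊤ := by
  have h := integrable_one_add_norm (E := Rd d) (μ := volume) (r := (d + 1 : ℕ))
    (by rw [finrank_euclideanSpace_fin]; push_cast; linarith)
  have h2 := (h.const_mul C).2
  rw [hasFiniteIntegral_iff_enorm] at h2
  refine ((lintegral_mono fun x => ?_).trans_lt h2).ne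
  rw [Real.rpow_neg (by positivity), Real.rpow_natCast]
  rw [← ofReal_norm, Real.norm_eq_abs]
  exact ENNReal.ofReal_le_ofReal (le_abs_self _)

theorem add_rpow_le_two_rpow {q : ℝ} (hq : 1 ≤ q) (u v : ℝ≥0∞) :
    (u + v) ^ q ≤ 2 ^ (q - 1) * (u ^ q + v ^ q) := by
  exact ENNReal.rpow_add_le_mul_rpow_add_rpow u v hq

/-- The estimate over a dyadic time interval. -/
theorem AdjointRestriction.lintegral_cv_dyadic_le {p q : ℝ} (hp : 2 ≤ p) (hpq : p ≤ q)
    (h : AdjointRestriction d p q) {χ : Rd d → ℂ} (hχ : ContDiff ℝ ∞ χ)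
    (hc : HasCompactSupport χ) :
    ∃ C : ℝ≥0∞, C ≠ ⊤ ∧ ∀ (N : ℝ), 1 ≤ N → ∀ (G : Rd d → ℂ), MemLp G (ENNReal.ofReal p) volume →
      ∫⁻ t in Icc N (2 * N), ∫⁻ x, ‖cv (kern (evo χ t)) G x‖ₑ ^ q
        ≤ C * ENNReal.ofReal (N ^ (d * q * (1 / 2 - 1 / p))) * (∫⁻ y, ‖G y‖ₑ ^ p) ^ (q / p) := by
  have hp0 : 0 < p := by linarith
  have hp1 : 1 ≤ p := by linarith
  have hq0 : 0 < q := by linarith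
  have hq1 : 1 ≤ q := by linarith
  have hqp : 0 ≤ q / p - 1 := by rw [sub_nonneg, le_div_iff₀ hp0]; linarith
  -- Decay of order `d + 2`: `d + 1` powers make the weight integrable, and the last one yields the
  -- factor `N⁻¹` that pays for the length `N` of the time interval.
  obtain ⟨A, C₀, hA, hC₀, hdecay⟩ := exists_kern_evo_decay hχ hc (d + 2)
  -- With this `a`, `‖x - z‖ ≤ N` and `‖y - z‖ > a N` force `‖x - y‖ ≥ 2 A N ≥ A t`, the region of
  -- rapid decay.
  set a := 2 * A + 1 with ha
  have ha0 : 0 < a := by linarith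
  obtain ⟨C₁, hC₁t, hC₁⟩ := h.lintegral_cv_le_of_support hp1 hq1 hχ hc ha0
  set w : Rd d → ℝ≥0∞ := fun x => ENNReal.ofReal (C₀ * ((1 + ‖x‖) ^ (d + 1))⁻¹) with hw
  have hwm : Measurable w := measurable_one_add_norm_weight C₀
  have hwt : ∫⁻ x, w x ≠ ⊤ := lintegral_one_add_norm_weight C₀
  have hwW : ∀ x, w x ≤ ENNReal.ofReal C₀ := fun x => by
    refine ENNReal.ofReal_le_ofReal (mul_le_of_le_one_right hC₀ ?_)
    exact inv_le_one_of_one_le₀ (one_le_pow₀ (by linarith [norm_nonneg x]))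
  set K : ℝ≥0∞ := ((∫⁻ y, w y) ^ (p - 1) * ENNReal.ofReal C₀) ^ (q / p - 1) * (∫⁻ y, w y) ^ p
    with hK
  have hKt : K ≠ ⊤ := ENNReal.mul_ne_top (ENNReal.rpow_ne_top_of_nonneg hqp
    (ENNReal.mul_ne_top (ENNReal.rpow_ne_top_of_nonneg (by linarith) hwt) ENNReal.ofReal_ne_top))
    (ENNReal.rpow_ne_top_of_nonneg hp0.le hwt)
  have h2t : (2 : ℝ≥0∞) ^ (q - 1) ≠ ⊤ := ENNReal.rpow_ne_top_of_nonneg (by linarith) (by norm_num)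
  refine ⟨2 ^ (q - 1) * (C₁ * ENNReal.ofReal (a ^ d) + K), ENNReal.mul_ne_top h2t
    (ENNReal.add_ne_top.2 ⟨ENNReal.mul_ne_top hC₁t ENNReal.ofReal_ne_top, hKt⟩), ?_⟩
  intro N hN G hG
  have hN0 : 0 < N := by linarith
  have hG' := (memLp_ofReal_iff hp0).1 hG
  set X := ∫⁻ y, ‖G y‖ₑ ^ p with hX
  set γ : ℝ := d * q * (1 / 2 - 1 / p) with hγ
  have hγ0 : 0 ≤ γ := by
    have : 1 / p ≤ 1 / 2 := one_div_le_one_div_of_le (by norm_num) hp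
    have : 0 ≤ 1 / 2 - 1 / p := by linarith
    positivity
  have hNγ : (1 : ℝ≥0∞) ≤ ENNReal.ofReal (N ^ γ) := by
    rw [ENNReal.one_le_ofReal]; exact Real.one_le_rpow hN hγ0
  set T : Rd d → ℝ≥0∞ := fun x => (∫⁻ y, w (x - y) * ‖G y‖ₑ) ^ q with hT
  have hTm : AEMeasurable T := by
    refine AEMeasurable.pow_const (AEMeasurable.lintegral_prod_right'
      (f := fun z : Rd d × Rd d => w (z.1 - z.2) * ‖G z.2‖ₑ) ?_) q
    exact AEMeasurable.mul (hwm.comp (by fun_prop)).aemeasurable hG.1.comp_snd.enorm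
  have hTint : ∫⁻ x, T x ≤ K * X ^ (q / p) :=
    lintegral_conv_rpow_le_of_le hwm hG.1.enorm hwW hp1 hpq
  set F : Rd d × ℝ → ℝ≥0∞ := fun v => ‖cv (kern (evo χ v.2)) G v.1‖ₑ ^ q with hF
  set μ : Measure (Rd d × ℝ) := volume.prod (volume.restrict (Icc N (2 * N))) with hμ
  have hFm : AEMeasurable F μ :=
    (aestronglyMeasurable_cv_kern_evo hχ hc hG.1 μ).enorm.pow_const q
  have hFint : ∫⁻ v, F v ∂μ = ∫⁻ t in Icc N (2 * N), ∫⁻ x, ‖cv (kern (evo χ t)) G x‖ₑ ^ q := by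
    rw [hμ, lintegral_prod_symm _ hFm]
  set B : Rd d → ℝ≥0∞ := fun z => ∫⁻ y, {y | ‖y - z‖ ≤ a * N}.indicator (fun y => ‖G y‖ₑ ^ p) y
    with hB
  set D : Rd d → ℝ≥0∞ := fun z => ∫⁻ x, {x | ‖x - z‖ ≤ N}.indicator T x with hD
  -- Near `z` the datum is cut to the concentric ball of radius `a N`: the part inside falls under
  -- the localized estimate, the part outside only contributes through the tail of the kernel.
  have hlocal : ∀ z : Rd d, ∫⁻ v, {v : Rd d × ℝ | ‖v.1 - z‖ ≤ N}.indicator F v ∂μ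
      ≤ 2 ^ (q - 1) * (C₁ * ENNReal.ofReal (N ^ γ) * B z ^ (q / p) + D z) := by
    intro z
    set H : Rd d → ℂ := {y | ‖y - z‖ ≤ a * N}.indicator G with hH
    have hset : ∀ R : ℝ, MeasurableSet {y : Rd d | ‖y - z‖ ≤ R} := fun R =>
      measurableSet_le (by fun_prop) measurable_const
    have hHm : MemLp H (ENNReal.ofReal p) volume := hG.indicator (hset _)
    have hHs : ∀ y, H y ≠ 0 → ‖y - z‖ ≤ a * N := by
      intro y hy
      by_contra hcon
      have hcon' : y ∉ {y | ‖y - z‖ ≤ a * N} := hcon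
      exact hy (by rw [hH, indicator_of_notMem hcon'])
    have hHp : ∫⁻ y, ‖H y‖ₑ ^ p = B z := by
      refine lintegral_congr fun y => ?_
      by_cases hy : y ∈ {y | ‖y - z‖ ≤ a * N}
      · rw [hH, indicator_of_mem hy, indicator_of_mem hy]
      · rw [hH, indicator_of_notMem hy, indicator_of_notMem hy]; simp [hp0]
    have hbound : ∀ t ∈ Icc N (2 * N), ∀ x, {x | ‖x - z‖ ≤ N}.indicator (fun x => F (x, t)) x
        ≤ 2 ^ (q - 1) * (‖cv (kern (evo χ t)) H x‖ₑ ^ q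
          + ENNReal.ofReal N⁻¹ * {x | ‖x - z‖ ≤ N}.indicator T x) := by
      intro t ht x
      by_cases hx : x ∈ {x | ‖x - z‖ ≤ N}
      swap
      · rw [indicator_of_notMem hx]; exact zero_le
      rw [indicator_of_mem hx, indicator_of_mem hx]
      have ht0 : 0 < t := hN0.trans_le ht.1
      have hxN : ‖x - z‖ ≤ N := hx
      have hsplit : ‖cv (kern (evo χ t)) G x‖ₑ ≤ ‖cv (kern (evo χ t)) H x‖ₑ
          + ENNReal.ofReal N⁻¹ * ∫⁻ y, w (x - y) * ‖G y‖ₑ := by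
        have e : cv (kern (evo χ t)) G x = cv (kern (evo χ t)) H x
            + ∫ y, kern (evo χ t) (x - y) * (G y - H y) := by
          rw [cv, cv, ← integral_add]
          · congr 1; ext y; ring
          · exact integrable_kern_mul (contDiff_evo hχ t) (hasCompactSupport_evo hc t) hp1 hHm x
          · exact integrable_kern_mul (contDiff_evo hχ t) (hasCompactSupport_evo hc t) hp1
              (hG.sub hHm) x
        rw [e]
        refine (enorm_add_le _ _).trans (add_le_add_right ?_ _)
        refine (enorm_integral_le_lintegral_enorm _).trans ?_
        rw [← lintegral_const_mul' _ _ ENNReal.ofReal_ne_top]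
        refine lintegral_mono fun y => ?_
        by_cases hy : y ∈ {y | ‖y - z‖ ≤ a * N}
        · rw [hH, indicator_of_mem hy]; simp
        · simp only
          rw [hH, indicator_of_notMem hy, sub_zero, enorm_mul, ← mul_assoc]
          gcongr
          have hy' : a * N < ‖y - z‖ := not_le.1 hy
          have hfar : 2 * A * N ≤ ‖x - y‖ := by
            have h1 : ‖y - z‖ ≤ ‖x - y‖ + ‖x - z‖ := by
              rw [norm_sub_rev x y]
              calc ‖y - z‖ = ‖(y - x) + (x - z)‖ := by rw [sub_add_sub_cancel]
                _ ≤ _ := norm_add_le _ _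
            rw [ha] at hy'
            nlinarith
          have h2 := hdecay t (x - y) (by
            rw [abs_of_pos ht0]
            nlinarith [ht.2])
          rw [← ofReal_norm, hw, ← ENNReal.ofReal_mul (by positivity)]
          refine ENNReal.ofReal_le_ofReal (h2.trans ?_)
          have h3 : (1 + ‖x - y‖)⁻¹ ≤ N⁻¹ := by
            refine inv_anti₀ hN0 ?_
            nlinarith
          calc C₀ * ((1 + ‖x - y‖) ^ (d + 2))⁻¹
              = C₀ * ((1 + ‖x - y‖) ^ (d + 1))⁻¹ * (1 + ‖x - y‖)⁻¹ := by
                rw [pow_succ (1 + ‖x - y‖) (d + 1), mul_inv]; ring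
            _ ≤ C₀ * ((1 + ‖x - y‖) ^ (d + 1))⁻¹ * N⁻¹ := by gcongr
            _ = _ := by ring
      calc F (x, t) ≤ (‖cv (kern (evo χ t)) H x‖ₑ
            + ENNReal.ofReal N⁻¹ * ∫⁻ y, w (x - y) * ‖G y‖ₑ) ^ q :=
            ENNReal.rpow_le_rpow hsplit hq0.le
        _ ≤ _ := add_rpow_le_two_rpow hq1 _ _
        _ ≤ _ := by
            gcongr
            rw [ENNReal.mul_rpow_of_nonneg _ _ hq0.le]
            gcongr
            calc ENNReal.ofReal N⁻¹ ^ q ≤ ENNReal.ofReal N⁻¹ ^ (1 : ℝ) := by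
                  refine ENNReal.rpow_le_rpow_of_exponent_ge ?_ hq1
                  rw [ENNReal.ofReal_le_one]
                  exact inv_le_one_of_one_le₀ hN
              _ = _ := ENNReal.rpow_one _
    have hind : AEMeasurable ({v : Rd d × ℝ | ‖v.1 - z‖ ≤ N}.indicator F) μ :=
      hFm.indicator (measurableSet_le (by fun_prop) measurable_const)
    have hDm : AEMeasurable ({x : Rd d | ‖x - z‖ ≤ N}.indicator T) := hTm.indicator (hset N)
    calc ∫⁻ v, {v : Rd d × ℝ | ‖v.1 - z‖ ≤ N}.indicator F v ∂μ
        = ∫⁻ t in Icc N (2 * N), ∫⁻ x, {x | ‖x - z‖ ≤ N}.indicator (fun x => F (x, t)) x := by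
          rw [hμ, lintegral_prod_symm _ hind]
          rfl
      _ ≤ ∫⁻ t in Icc N (2 * N), (2 ^ (q - 1) * ((∫⁻ x, ‖cv (kern (evo χ t)) H x‖ₑ ^ q)
          + ENNReal.ofReal N⁻¹ * D z)) := by
          refine setLIntegral_mono' measurableSet_Icc fun t ht => ?_
          refine (lintegral_mono (hbound t ht)).trans_eq ?_
          rw [lintegral_const_mul' _ _ h2t, lintegral_add_right' _ (hDm.const_mul _),
            lintegral_const_mul' _ _ ENNReal.ofReal_ne_top]
      _ = 2 ^ (q - 1) * ((∫⁻ t in Icc N (2 * N), ∫⁻ x, ‖cv (kern (evo χ t)) H x‖ₑ ^ q)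
          + D z) := by
          rw [lintegral_const_mul' _ _ h2t, lintegral_add_right _ measurable_const,
            lintegral_const, Measure.restrict_apply_univ, Real.volume_Icc,
            show 2 * N - N = N by ring, mul_right_comm, ← ENNReal.ofReal_mul (by positivity),
            inv_mul_cancel₀ hN0.ne', ENNReal.ofReal_one, one_mul]
      _ ≤ _ := by
          gcongr
          refine (hC₁ N hN0 z H hHm hHs).trans_eq ?_
          rw [hHp]
  set V := volume (Metric.closedBall (0 : Rd d) N) with hV
  have hV0 : V ≠ 0 := (Metric.measure_closedBall_pos volume _ hN0).ne'
  have hVt : V ≠ ⊤ := measure_closedBall_lt_top.ne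
  have hVa : volume (Metric.closedBall (0 : Rd d) (a * N)) = ENNReal.ofReal (a ^ d) * V := by
    rw [hV, Measure.addHaar_closedBall_mul volume (0 : Rd d) ha0.le hN0.le, finrank_euclideanSpace_fin]
  have hDint : ∫⁻ z, D z = V * ∫⁻ x, T x :=
    lintegral_indicator_ball (π := fun x : Rd d => x) measurable_id hTm N
  have hDm : AEMeasurable D := by
    have hset : MeasurableSet {v : Rd d × Rd d | ‖v.2 - v.1‖ ≤ N} :=
      measurableSet_le (by fun_prop) measurable_const
    refine AEMeasurable.lintegral_prod_right' (f := fun v : Rd d × Rd d =>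
      {x | ‖x - v.1‖ ≤ N}.indicator T v.2) ?_
    have : (fun v : Rd d × Rd d => {x | ‖x - v.1‖ ≤ N}.indicator T v.2)
        = {v : Rd d × Rd d | ‖v.2 - v.1‖ ≤ N}.indicator (fun v => T v.2) := by
      ext v; simp only [indicator, mem_ofPred_eq]
    rw [this]
    exact (hTm.comp_quasiMeasurePreserving Measure.quasiMeasurePreserving_snd).indicator hset
  have hBint : ∫⁻ z, B z = ENNReal.ofReal (a ^ d) * V * X := by
    rw [← hVa]
    exact lintegral_indicator_ball (π := fun x : Rd d => x) measurable_id
      (hG.1.enorm.pow_const p) (a * N)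
  have hBX : ∀ z, B z ≤ X := fun z => lintegral_mono fun y => indicator_le_self _ _ y
  have hXt : X ^ (q / p - 1) ≠ ⊤ := ENNReal.rpow_ne_top_of_nonneg hqp hG'.2
  -- Since `q ≥ p`, the power `q/p - 1` of the local mass can be bounded by that of the total mass,
  -- leaving a single integrable factor `B z`.
  have hBq : ∫⁻ z, B z ^ (q / p) ≤ ENNReal.ofReal (a ^ d) * V * X ^ (q / p) := by
    have e : ∀ Y : ℝ≥0∞, Y ^ (q / p) = Y ^ (q / p - 1) * Y := by
      intro Y
      conv_rhs => rw [← ENNReal.rpow_one Y, ← ENNReal.rpow_mul, one_mul]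
      rw [← ENNReal.rpow_add_of_nonneg _ _ hqp zero_le_one]
      simp
    calc ∫⁻ z, B z ^ (q / p) ≤ ∫⁻ z, X ^ (q / p - 1) * B z := by
          refine lintegral_mono fun z => ?_
          rw [e (B z)]
          gcongr
          exact hBX z
      _ = X ^ (q / p - 1) * (ENNReal.ofReal (a ^ d) * V * X) := by
          rw [lintegral_const_mul' _ _ hXt, hBint]
      _ = _ := by rw [e X]; ring
  -- Averaging over the centres `z` puts the volume `V` of a ball of radius `N` on both sides. The
  -- tail term does not grow with `N` and is absorbed by `N^γ ≥ 1`.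
  have hmain : V * ∫⁻ v, F v ∂μ ≤ V * (2 ^ (q - 1) * (C₁ * ENNReal.ofReal (a ^ d) + K)
      * ENNReal.ofReal (N ^ γ) * X ^ (q / p)) := by
    calc V * ∫⁻ v, F v ∂μ
        = ∫⁻ z : Rd d, ∫⁻ v, {v : Rd d × ℝ | ‖v.1 - z‖ ≤ N}.indicator F v ∂μ :=
          (lintegral_indicator_ball (π := fun v : Rd d × ℝ => v.1) measurable_fst hFm N).symm
      _ ≤ ∫⁻ z, 2 ^ (q - 1) * (C₁ * ENNReal.ofReal (N ^ γ) * B z ^ (q / p) + D z) :=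
          lintegral_mono hlocal
      _ = 2 ^ (q - 1) * (C₁ * ENNReal.ofReal (N ^ γ) * (∫⁻ z, B z ^ (q / p)) + ∫⁻ z, D z) := by
          rw [lintegral_const_mul' _ _ h2t, lintegral_add_right' _ hDm,
            lintegral_const_mul' _ _ (ENNReal.mul_ne_top hC₁t ENNReal.ofReal_ne_top)]
      _ ≤ 2 ^ (q - 1) * (C₁ * ENNReal.ofReal (N ^ γ) * (ENNReal.ofReal (a ^ d) * V * X ^ (q / p))
          + V * (1 * (K * X ^ (q / p)))) := by
          rw [hDint, one_mul]
          gcongr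
      _ ≤ 2 ^ (q - 1) * (C₁ * ENNReal.ofReal (N ^ γ) * (ENNReal.ofReal (a ^ d) * V * X ^ (q / p))
          + V * (ENNReal.ofReal (N ^ γ) * (K * X ^ (q / p)))) := by
          gcongr
      _ = _ := by ring
  rw [← hFint]
  exact (ENNReal.mul_le_mul_iff_right hV0 hVt).1 hmain

/-- For `|t| ≤ 1` the region not covered by the decay estimate lies in the fixed ball `‖x‖ ≤ A`,
where the trivial bound suffices. -/
theorem exists_kern_evo_le_weight {χ : Rd d → ℂ} (hχ : ContDiff ℝ ∞ χ) (hc : HasCompactSupport χ) :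
    ∃ C : ℝ, 0 ≤ C ∧ ∀ t : ℝ, |t| ≤ 1 → ∀ x, ‖kern (evo χ t) x‖ ≤ C * ((1 + ‖x‖) ^ (d + 1))⁻¹ := by
  obtain ⟨A, C₀, hA, hC₀, hdecay⟩ := exists_kern_evo_decay hχ hc (d + 1)
  obtain ⟨W, hW0, hW⟩ : ∃ W : ℝ, 0 ≤ W ∧ ∀ t x, ‖kern (evo χ t) x‖ ≤ W :=
    ⟨_, (norm_nonneg _).trans (norm_kern_evo_le χ 0 0), fun t x => norm_kern_evo_le χ t x⟩
  refine ⟨C₀ + W * (1 + A) ^ (d + 1), by positivity, fun t ht x => ?_⟩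
  rw [add_mul]
  rcases le_total A ‖x‖ with h | h
  · refine (hdecay t x (by nlinarith)).trans (le_add_of_nonneg_right (by positivity))
  · refine (hW t x).trans (le_trans ?_ (le_add_of_nonneg_left (by positivity)))
    rw [mul_assoc]
    refine le_mul_of_one_le_right hW0 ?_
    rw [← div_eq_mul_inv, one_le_div (by positivity)]
    gcongr

/-- The estimate over a unit time interval. -/
theorem lintegral_cv_unit_le {p q : ℝ} (hp : 1 ≤ p) (hpq : p ≤ q)
    {χ : Rd d → ℂ} (hχ : ContDiff ℝ ∞ χ) (hc : HasCompactSupport χ) :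
    ∃ C : ℝ≥0∞, C ≠ ⊤ ∧ ∀ (G : Rd d → ℂ), MemLp G (ENNReal.ofReal p) volume →
      ∫⁻ t in Icc 0 1, ∫⁻ x, ‖cv (kern (evo χ t)) G x‖ₑ ^ q
        ≤ C * (∫⁻ y, ‖G y‖ₑ ^ p) ^ (q / p) := by
  have hp0 : 0 < p := by linarith
  have hqp : 0 ≤ q / p - 1 := by rw [sub_nonneg, le_div_iff₀ hp0]; linarith
  obtain ⟨C₀, hC₀, hk⟩ := exists_kern_evo_le_weight hχ hc
  set w : Rd d → ℝ≥0∞ := fun x => ENNReal.ofReal (C₀ * ((1 + ‖x‖) ^ (d + 1))⁻¹) with hw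
  have hwm : Measurable w := measurable_one_add_norm_weight C₀
  have hwt : ∫⁻ x, w x ≠ ⊤ := lintegral_one_add_norm_weight C₀
  have hwW : ∀ x, w x ≤ ENNReal.ofReal C₀ := fun x => by
    refine ENNReal.ofReal_le_ofReal (mul_le_of_le_one_right hC₀ ?_)
    exact inv_le_one_of_one_le₀ (one_le_pow₀ (by linarith [norm_nonneg x]))
  refine ⟨((∫⁻ y, w y) ^ (p - 1) * ENNReal.ofReal C₀) ^ (q / p - 1) * (∫⁻ y, w y) ^ p,
    ENNReal.mul_ne_top (ENNReal.rpow_ne_top_of_nonneg hqp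
    (ENNReal.mul_ne_top (ENNReal.rpow_ne_top_of_nonneg (by linarith) hwt) ENNReal.ofReal_ne_top))
    (ENNReal.rpow_ne_top_of_nonneg hp0.le hwt), fun G hG => ?_⟩
  have hpt : ∀ t ∈ Icc (0 : ℝ) 1, ∫⁻ x, ‖cv (kern (evo χ t)) G x‖ₑ ^ q
      ≤ ((∫⁻ y, w y) ^ (p - 1) * ENNReal.ofReal C₀) ^ (q / p - 1) * (∫⁻ y, w y) ^ p
        * (∫⁻ y, ‖G y‖ₑ ^ p) ^ (q / p) := by
    intro t ht
    refine le_trans (lintegral_mono fun x => ?_)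
      (lintegral_conv_rpow_le_of_le hwm hG.1.enorm hwW hp hpq)
    refine ENNReal.rpow_le_rpow ?_ (by linarith)
    refine (enorm_cv_le _ _ _).trans (lintegral_mono fun y => ?_)
    refine mul_le_mul_left ?_ _
    rw [← ofReal_norm]
    exact ENNReal.ofReal_le_ofReal (hk t (by rw [abs_of_nonneg ht.1]; exact ht.2) _)
  refine (setLIntegral_mono' measurableSet_Icc hpt).trans_eq ?_
  rw [lintegral_const, Measure.restrict_apply_univ, Real.volume_Icc]
  simp

/-! ### Summation over dyadic time intervals and negative times, for `p > 2` -/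

theorem AdjointRestriction.lintegral_cv_two_pow_le {p q : ℝ} (hd : 1 ≤ d) (hp : 2 < p)
    (hpq : p ≤ q) (h : AdjointRestriction d p q) {χ : Rd d → ℂ} (hχ : ContDiff ℝ ∞ χ)
    (hc : HasCompactSupport χ) :
    ∃ C : ℝ≥0∞, C ≠ ⊤ ∧ ∀ (G : Rd d → ℂ), MemLp G (ENNReal.ofReal p) volume → ∀ n : ℕ,
      ∫⁻ t in Icc 0 (2 ^ n), ∫⁻ x, ‖cv (kern (evo χ t)) G x‖ₑ ^ q
        ≤ C * ENNReal.ofReal (((2 : ℝ) ^ n) ^ (d * q * (1 / 2 - 1 / p)))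
          * (∫⁻ y, ‖G y‖ₑ ^ p) ^ (q / p) := by
  obtain ⟨C₁, hC₁t, hC₁⟩ := lintegral_cv_unit_le (by linarith) hpq hχ hc
  obtain ⟨C₂, hC₂t, hC₂⟩ := h.lintegral_cv_dyadic_le hp.le hpq hχ hc
  set γ : ℝ := d * q * (1 / 2 - 1 / p) with hγ
  have hγ0 : 0 < γ := by
    have h1 : 1 / p < 1 / 2 := one_div_lt_one_div_of_lt (by norm_num) hp
    have h2 : 0 < 1 / 2 - 1 / p := by linarith
    have h3 : (1 : ℝ) ≤ d := by exact_mod_cast hd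
    have : 0 < q := by linarith
    positivity
  have h2γ : 0 < (2 : ℝ) ^ γ - 1 := by
    have := Real.one_lt_rpow (by norm_num : (1 : ℝ) < 2) hγ0
    linarith
  -- `D` satisfies `D + C₂ ≤ D 2^γ`, which is the inductive step. The factor `(2^γ - 1)⁻¹` sums the
  -- geometric series and requires `γ > 0`, hence `p > 2`.
  set D := C₁ + C₂ * ENNReal.ofReal ((2 ^ γ - 1)⁻¹) with hD
  have hDC : D + C₂ ≤ D * ENNReal.ofReal (2 ^ γ) := by
    have e : ENNReal.ofReal ((2 : ℝ) ^ γ) = 1 + ENNReal.ofReal (2 ^ γ - 1) := by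
      rw [← ENNReal.ofReal_one, ← ENNReal.ofReal_add zero_le_one h2γ.le]; congr 1; ring
    rw [e, mul_add, mul_one]
    refine add_le_add_right ?_ _
    calc C₂ = C₂ * ENNReal.ofReal ((2 ^ γ - 1)⁻¹) * ENNReal.ofReal (2 ^ γ - 1) := by
          rw [mul_assoc, ← ENNReal.ofReal_mul (by positivity), inv_mul_cancel₀ h2γ.ne']; simp
      _ ≤ _ := by
          gcongr
          exact le_add_left le_rfl
  refine ⟨D, ENNReal.add_ne_top.2 ⟨hC₁t, ENNReal.mul_ne_top hC₂t ENNReal.ofReal_ne_top⟩,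
    fun G hG n => ?_⟩
  induction n with
  | zero =>
    simp only [pow_zero, Real.one_rpow, ENNReal.ofReal_one, mul_one]
    refine (hC₁ G hG).trans ?_
    gcongr
    exact le_self_add
  | succ n ih =>
    have h2n : (1 : ℝ) ≤ 2 ^ n := one_le_pow₀ (by norm_num)
    have hsub : Icc (0 : ℝ) (2 ^ (n + 1)) ⊆ Icc 0 (2 ^ n) ∪ Icc (2 ^ n) (2 * 2 ^ n) := by
      intro t ht
      rcases le_total t (2 ^ n) with h | h
      · exact Or.inl ⟨ht.1, h⟩
      · exact Or.inr ⟨h, by rw [← pow_succ']; exact ht.2⟩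
    calc _ ≤ ∫⁻ t in Icc 0 (2 ^ n) ∪ Icc (2 ^ n) (2 * 2 ^ n),
            ∫⁻ x, ‖cv (kern (evo χ t)) G x‖ₑ ^ q := lintegral_mono_set hsub
      _ ≤ _ := lintegral_union_le _ _ _
      _ ≤ D * ENNReal.ofReal (((2 : ℝ) ^ n) ^ γ) * (∫⁻ y, ‖G y‖ₑ ^ p) ^ (q / p)
          + C₂ * ENNReal.ofReal (((2 : ℝ) ^ n) ^ γ) * (∫⁻ y, ‖G y‖ₑ ^ p) ^ (q / p) :=
          add_le_add ih (hC₂ _ h2n G hG)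
      _ = (D + C₂) * (ENNReal.ofReal (((2 : ℝ) ^ n) ^ γ) * (∫⁻ y, ‖G y‖ₑ ^ p) ^ (q / p)) := by
          ring
      _ ≤ D * ENNReal.ofReal (2 ^ γ) *
          (ENNReal.ofReal (((2 : ℝ) ^ n) ^ γ) * (∫⁻ y, ‖G y‖ₑ ^ p) ^ (q / p)) := by gcongr
      _ = _ := by
          rw [pow_succ' (2 : ℝ) n, Real.mul_rpow (by norm_num) (by positivity),
            ENNReal.ofReal_mul (by positivity)]
          ring

/-- The symbol of the complex conjugate of a convolution operator. -/
noncomputable def conjSymbol (χ : Rd d → ℂ) (ξ : Rd d) : ℂ := (starRingEnd ℂ) (χ (-ξ))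

theorem contDiff_conjSymbol {χ : Rd d → ℂ} (hχ : ContDiff ℝ ∞ χ) : ContDiff ℝ ∞ (conjSymbol χ) :=
  (Complex.conjCLE.contDiff).comp (hχ.comp contDiff_neg)

theorem hasCompactSupport_conjSymbol {χ : Rd d → ℂ} (hc : HasCompactSupport χ) :
    HasCompactSupport (conjSymbol χ) :=
  (hc.comp_homeomorph (Homeomorph.neg _)).comp_left (g := starRingEnd ℂ) (map_zero _)

/-- Conjugation reverses time and reflects the frequencies, so the estimate for positive times
applied to `conjSymbol χ` covers negative ones. -/
theorem conj_kern_evo_neg (χ : Rd d → ℂ) (t : ℝ) (x : Rd d) :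
    (starRingEnd ℂ) (kern (evo χ (-t)) x) = kern (evo (conjSymbol χ) t) x := by
  have hr : ∀ r : ℝ, (starRingEnd ℂ) (Complex.exp (Complex.I * (r : ℂ)))
      = Complex.exp (Complex.I * ((-r : ℝ) : ℂ)) := by
    intro r
    rw [← Complex.exp_conj, map_mul, Complex.conj_I, Complex.conj_ofReal]
    push_cast; ring_nf
  rw [kern, kern, map_mul, ← integral_conj, ← integral_neg_eq_self]
  congr 1
  · simp [Complex.conj_ofNat]
  congr 1; ext ξ
  rw [evo, evo, conjSymbol, map_mul, map_mul, inner_neg_right, hr]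
  congr 1
  · congr 1
    have := hr (t * ‖ξ‖ ^ 2)
    rw [norm_neg]
    convert this using 2
    · push_cast; ring_nf
    · push_cast; ring_nf
  · simp

theorem enorm_cv_kern_evo_neg (χ G : Rd d → ℂ) (t : ℝ) (x : Rd d) :
    ‖cv (kern (evo χ (-t))) G x‖ₑ
      = ‖cv (kern (evo (conjSymbol χ) t)) (fun y => (starRingEnd ℂ) (G y)) x‖ₑ := by
  have : cv (kern (evo (conjSymbol χ) t)) (fun y => (starRingEnd ℂ) (G y)) x
      = (starRingEnd ℂ) (cv (kern (evo χ (-t))) G x) := by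
    rw [cv, cv, ← integral_conj]
    congr 1; ext y
    rw [map_mul, conj_kern_evo_neg]
  rw [this, ← ofReal_norm, ← ofReal_norm, RCLike.norm_conj]

theorem AdjointRestriction.lintegral_cv_le_of_two_lt {p q : ℝ} (hd : 1 ≤ d) (hp : 2 < p)
    (hpq : p ≤ q) (h : AdjointRestriction d p q) {χ : Rd d → ℂ} (hχ : ContDiff ℝ ∞ χ)
    (hc : HasCompactSupport χ) :
    ∃ C : ℝ≥0∞, C ≠ ⊤ ∧ ∀ (N : ℝ), 1 ≤ N → ∀ (G : Rd d → ℂ), MemLp G (ENNReal.ofReal p) volume →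
      ∫⁻ t in Icc (-N) N, ∫⁻ x, ‖cv (kern (evo χ t)) G x‖ₑ ^ q
        ≤ C * ENNReal.ofReal (N ^ (d * q * (1 / 2 - 1 / p))) * (∫⁻ y, ‖G y‖ₑ ^ p) ^ (q / p) := by
  obtain ⟨C₁, hC₁t, hC₁⟩ := h.lintegral_cv_two_pow_le hd hp hpq hχ hc
  obtain ⟨C₂, hC₂t, hC₂⟩ := h.lintegral_cv_two_pow_le hd hp hpq (contDiff_conjSymbol hχ)
    (hasCompactSupport_conjSymbol hc)
  set γ : ℝ := d * q * (1 / 2 - 1 / p) with hγ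
  have hγ0 : 0 ≤ γ := by
    have h1 : 1 / p < 1 / 2 := one_div_lt_one_div_of_lt (by norm_num) hp
    have h2 : 0 < 1 / 2 - 1 / p := by linarith
    have : 0 < q := by linarith
    positivity
  refine ⟨(C₁ + C₂) * ENNReal.ofReal (2 ^ γ), ENNReal.mul_ne_top
    (ENNReal.add_ne_top.2 ⟨hC₁t, hC₂t⟩) ENNReal.ofReal_ne_top, fun N hN G hG => ?_⟩
  obtain ⟨n, hn1, hn2⟩ := exists_nat_pow_near hN (by norm_num : (1 : ℝ) < 2)
  have hN0 : 0 < N := by linarith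
  have hG' : MemLp (fun y => (starRingEnd ℂ) (G y)) (ENNReal.ofReal p) volume :=
    ⟨Complex.continuous_conj.comp_aestronglyMeasurable hG.1, by
      rw [eLpNorm_congr_norm_ae (g := G) (Filter.Eventually.of_forall fun y => RCLike.norm_conj _)]
      exact hG.2⟩
  have hconj : ∀ y, ‖(starRingEnd ℂ) (G y)‖ₑ = ‖G y‖ₑ := fun y => by
    rw [← ofReal_norm, ← ofReal_norm, RCLike.norm_conj]
  have hB : ∀ C : ℝ≥0∞, C * ENNReal.ofReal (((2 : ℝ) ^ (n + 1)) ^ γ) * (∫⁻ y, ‖G y‖ₑ ^ p) ^ (q / p)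
      ≤ C * ENNReal.ofReal (2 ^ γ) * ENNReal.ofReal (N ^ γ) * (∫⁻ y, ‖G y‖ₑ ^ p) ^ (q / p) := by
    intro C
    rw [mul_assoc C (ENNReal.ofReal (2 ^ γ)), ← ENNReal.ofReal_mul (by positivity),
      ← Real.mul_rpow (by norm_num) hN0.le, pow_succ']
    gcongr
  have hpos : ∫⁻ t in Icc 0 N, ∫⁻ x, ‖cv (kern (evo χ t)) G x‖ₑ ^ q
      ≤ C₁ * ENNReal.ofReal (2 ^ γ) * ENNReal.ofReal (N ^ γ) * (∫⁻ y, ‖G y‖ₑ ^ p) ^ (q / p) :=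
    (lintegral_mono_set (Icc_subset_Icc_right hn2.le)).trans ((hC₁ G hG (n + 1)).trans (hB C₁))
  have hneg : ∫⁻ t in Icc (-N) 0, ∫⁻ x, ‖cv (kern (evo χ t)) G x‖ₑ ^ q
      ≤ C₂ * ENNReal.ofReal (2 ^ γ) * ENNReal.ofReal (N ^ γ) * (∫⁻ y, ‖G y‖ₑ ^ p) ^ (q / p) := by
    have e : ∫⁻ t in Icc (-N) 0, ∫⁻ x, ‖cv (kern (evo χ t)) G x‖ₑ ^ q
        = ∫⁻ t in Icc 0 N, ∫⁻ x, ‖cv (kern (evo χ (-t))) G x‖ₑ ^ q := by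
      have := (Measure.measurePreserving_neg (volume : Measure ℝ)).setLIntegral_comp_preimage_emb
        (MeasurableEquiv.neg ℝ).measurableEmbedding
        (fun t => ∫⁻ x, ‖cv (kern (evo χ t)) G x‖ₑ ^ q) (Icc (-N) 0)
      rw [← this]
      simp
    rw [e]
    simp only [enorm_cv_kern_evo_neg]
    refine (lintegral_mono_set (Icc_subset_Icc_right hn2.le)).trans ((hC₂ _ hG' (n + 1)).trans ?_)
    simp only [hconj]
    exact hB C₂
  calc _ ≤ ∫⁻ t in Icc (-N) 0 ∪ Icc 0 N, ∫⁻ x, ‖cv (kern (evo χ t)) G x‖ₑ ^ q := by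
        refine lintegral_mono_set fun t ht => ?_
        rcases le_total t 0 with h | h
        · exact Or.inl ⟨ht.1, h⟩
        · exact Or.inr ⟨h, ht.2⟩
    _ ≤ _ := lintegral_union_le _ _ _
    _ ≤ _ := add_le_add hneg hpos
    _ = _ := by ring

/-! ### Scaling of the extension operator and the endpoint `p = 2` -/

theorem setLIntegral_Icc_comp_mul {c : ℝ} (hc : 0 < c) (a b : ℝ) (f : ℝ → ℝ≥0∞) :
    ∫⁻ t in Icc a b, f (c * t) = ENNReal.ofReal c⁻¹ * ∫⁻ s in Icc (c * a) (c * b), f s := by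
  have h1 : ∫⁻ t in Icc a b, f (c * t)
      = ∫⁻ s in Icc (c * a) (c * b), f s ∂(Measure.map (fun t => c * t) (volume : Measure ℝ)) := by
    rw [(measurableEmbedding_mulLeft₀ hc.ne').restrict_map,
      (measurableEmbedding_mulLeft₀ hc.ne').lintegral_map]
    congr 2
    ext t
    rw [mem_preimage, mem_Icc, mem_Icc, mul_le_mul_iff_right₀ hc, mul_le_mul_iff_right₀ hc]
  rw [h1, Real.map_volume_mul_left hc.ne', Measure.restrict_smul, lintegral_smul_measure,
    smul_eq_mul, abs_of_pos (inv_pos.2 hc)]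

theorem lintegral_comp_mul {c : ℝ} (hc : 0 < c) (f : ℝ → ℝ≥0∞) :
    ∫⁻ t, f (c * t) = ENNReal.ofReal c⁻¹ * ∫⁻ s, f s := by
  have h1 : ∫⁻ t, f (c * t) = ∫⁻ s, f s ∂(Measure.map (fun t => c * t) (volume : Measure ℝ)) := by
    rw [(measurableEmbedding_mulLeft₀ hc.ne').lintegral_map]
  rw [h1, Real.map_volume_mul_left hc.ne', lintegral_smul_measure, smul_eq_mul,
    abs_of_pos (inv_pos.2 hc)]

theorem fullExt_smul {R : ℝ} (hR : 0 < R) (h : Rd d → ℂ) (ξ : Rd d) (s : ℝ) :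
    fullExt h (ξ, s) = ((R ^ d : ℝ) : ℂ) * fullExt (fun y => h (R • y)) (R • ξ, R ^ 2 * s) := by
  have h1 := Measure.integral_comp_smul (volume : Measure (Rd d)) (fun y =>
    h y * Complex.exp (Complex.I * ((s * ‖y‖ ^ 2 - ⟪ξ, y⟫ : ℝ) : ℂ))) R
  rw [finrank_euclideanSpace_fin, abs_of_nonneg (by positivity), Complex.real_smul] at h1
  have h2 : fullExt (fun y => h (R • y)) (R • ξ, R ^ 2 * s) = ∫ y, h (R • y) *
      Complex.exp (Complex.I * ((s * ‖R • y‖ ^ 2 - ⟪ξ, R • y⟫ : ℝ) : ℂ)) := by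
    rw [fullExt]
    congr 1; ext y
    congr 4
    rw [norm_smul, real_inner_smul_left, inner_smul_right, Real.norm_of_nonneg hR.le]
    ring
  rw [h2, h1, ← mul_assoc, ← Complex.ofReal_mul, mul_inv_cancel₀ (by positivity), fullExt]
  simp

theorem quasiMeasurePreserving_const_smul {R : ℝ} (hR : R ≠ 0) :
    Measure.QuasiMeasurePreserving (fun y : Rd d => R • y) volume volume := by
  refine ⟨by fun_prop, ?_⟩
  rw [Measure.map_addHaar_smul volume hR]
  exact Measure.smul_absolutelyContinuous

theorem memLp_comp_smul {p : ℝ} (hp : 0 < p) {R : ℝ} (hR : R ≠ 0) {h : Rd d → ℂ}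
    (hh : MemLp h (ENNReal.ofReal p) volume) :
    MemLp (fun y => h (R • y)) (ENNReal.ofReal p) volume := by
  rw [memLp_ofReal_iff hp] at hh ⊢
  refine ⟨hh.1.comp_quasiMeasurePreserving (quasiMeasurePreserving_const_smul hR), fun hcon => ?_⟩
  apply hh.2
  rw [lintegral_smul_comp hR, hcon, ENNReal.mul_top]
  rw [Ne, ENNReal.ofReal_eq_zero, not_le]
  have := abs_pos.2 hR
  positivity

/-- The adjoint restriction estimate for functions supported in an arbitrary ball. -/
theorem AdjointRestriction.lintegral_fullExt_le {p q : ℝ} (hp : 0 < p) (hq : 0 < q)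
    (h : AdjointRestriction d p q) {R : ℝ} (hR : 0 < R) :
    ∃ C : ℝ≥0∞, C ≠ ⊤ ∧ ∀ H : Rd d → ℂ, MemLp H (ENNReal.ofReal p) volume →
      (∀ y, H y ≠ 0 → ‖y‖ ≤ R) →
      ∫⁻ s, ∫⁻ ξ, ‖fullExt H (ξ, s)‖ₑ ^ q ≤ C * (∫⁻ y, ‖H y‖ₑ ^ p) ^ (q / p) := by
  obtain ⟨C, hC⟩ := h
  have hRd : ENNReal.ofReal (|R| ^ d) ≠ 0 := by
    rw [Ne, ENNReal.ofReal_eq_zero, not_le]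
    have := abs_pos.2 hR.ne'
    positivity
  set A := ENNReal.ofReal (R ^ d) ^ q * ((ENNReal.ofReal (|R| ^ d))⁻¹ * ENNReal.ofReal ((R ^ 2)⁻¹))
    with hA
  have hAt : A ≠ ⊤ := ENNReal.mul_ne_top (ENNReal.rpow_ne_top_of_nonneg hq.le ENNReal.ofReal_ne_top)
    (ENNReal.mul_ne_top (ENNReal.inv_ne_top.2 hRd) ENNReal.ofReal_ne_top)
  refine ⟨A * ((C : ℝ≥0∞) ^ q * ((ENNReal.ofReal (|R| ^ d))⁻¹) ^ (q / p)), ENNReal.mul_ne_top hAt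
    (ENNReal.mul_ne_top (ENNReal.rpow_ne_top_of_nonneg hq.le ENNReal.coe_ne_top)
      (ENNReal.rpow_ne_top_of_nonneg (by positivity) (ENNReal.inv_ne_top.2 hRd))), ?_⟩
  intro H hH hs
  set g : Rd d → ℂ := fun y => H (R • y) with hg
  have hgs : ∀ y, g y ≠ 0 → ‖y‖ ≤ 1 := by
    intro y hy
    have := hs _ hy
    rw [norm_smul, Real.norm_of_nonneg hR.le] at this
    exact le_of_mul_le_mul_left (by linarith) hR
  obtain ⟨hE, hEle⟩ := hC g (memLp_comp_smul hp hR.ne' hH)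
  have hEq := ENNReal.rpow_le_rpow hEle hq.le
  rw [eLpNorm_ofReal_rpow hq, ENNReal.mul_rpow_of_nonneg _ _ hq.le, eLpNorm_ofReal_eq hp,
    ← ENNReal.rpow_mul, one_div_mul_eq_div, Measure.volume_eq_prod,
    lintegral_prod_symm _ (hE.1.enorm.pow_const q)] at hEq
  have hgp : ∫⁻ y, ‖g y‖ₑ ^ p = (ENNReal.ofReal (|R| ^ d))⁻¹ * ∫⁻ y, ‖H y‖ₑ ^ p := by
    rw [lintegral_smul_comp hR.ne' (fun y => ‖H y‖ₑ ^ p), ← mul_assoc,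
      ENNReal.inv_mul_cancel hRd ENNReal.ofReal_ne_top, one_mul]
  have hin : ∀ s, ∫⁻ ξ, ‖fullExt H (ξ, s)‖ₑ ^ q = ENNReal.ofReal (R ^ d) ^ q *
      ((ENNReal.ofReal (|R| ^ d))⁻¹ * ∫⁻ ξ, ‖extensionOp g (ξ, R ^ 2 * s)‖ₑ ^ q) := by
    intro s
    rw [lintegral_smul_comp hR.ne' (fun ξ => ‖extensionOp g (ξ, R ^ 2 * s)‖ₑ ^ q), ← mul_assoc _⁻¹,
      ENNReal.inv_mul_cancel hRd ENNReal.ofReal_ne_top, one_mul, ← lintegral_const_mul']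
    · refine lintegral_congr fun ξ => ?_
      rw [fullExt_smul hR, enorm_mul, ENNReal.mul_rpow_of_nonneg _ _ hq.le,
        extensionOp_eq_fullExt hgs]
      congr 2
      rw [← ofReal_norm, Complex.norm_real, Real.norm_of_nonneg (by positivity)]
    · exact ENNReal.rpow_ne_top_of_nonneg hq.le ENNReal.ofReal_ne_top
  calc ∫⁻ s, ∫⁻ ξ, ‖fullExt H (ξ, s)‖ₑ ^ q
      = A * ∫⁻ s, ∫⁻ ξ, ‖extensionOp g (ξ, s)‖ₑ ^ q := by
        simp only [hin]
        rw [lintegral_const_mul' _ _ (ENNReal.rpow_ne_top_of_nonneg hq.le ENNReal.ofReal_ne_top),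
          lintegral_const_mul' _ _ (ENNReal.inv_ne_top.2 hRd),
          lintegral_comp_mul (by positivity) (fun s => ∫⁻ ξ, ‖extensionOp g (ξ, s)‖ₑ ^ q)]
        rw [hA]; ring
    _ ≤ A * ((C : ℝ≥0∞) ^ q * (∫⁻ y, ‖g y‖ₑ ^ p) ^ (q / p)) := by gcongr
    _ = _ := by
        rw [hgp, ENNReal.mul_rpow_of_nonneg _ _ (by positivity)]; ring

/-- Here the extension acts on the frequency side, on `χ` times the Fourier transform of `G`,
without any pseudoconformal transformation. This form suits `p = 2`, where Plancherel controls the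
density. -/
theorem cv_kern_evo_eq_fullExt {χ : Rd d → ℂ} (hχ : ContDiff ℝ ∞ χ) (hc : HasCompactSupport χ)
    {G : Rd d → ℂ} (hG : Integrable G) (t : ℝ) (x : Rd d) :
    cv (kern (evo χ t)) G x = (((2 * Real.pi) ^ d : ℝ) : ℂ)⁻¹ *
      fullExt (fun ξ => χ ξ * ∫ y, G y * Complex.exp (-Complex.I * ((⟪y, ξ⟫ : ℝ) : ℂ))) (-x, -t) := by
  have hχi : Integrable χ := hχ.continuous.integrable_of_hasCompactSupport hc
  have hprod : Integrable (fun z : Rd d × Rd d => evo χ t z.2 *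
      Complex.exp (Complex.I * ((⟪x - z.1, z.2⟫ : ℝ) : ℂ)) * G z.1) (volume.prod volume) := by
    refine (hG.mul_prod hχi).norm.mono' ?_ (Filter.Eventually.of_forall fun z => ?_)
    · refine AEStronglyMeasurable.mul (Continuous.aestronglyMeasurable ?_) hG.1.comp_fst
      have := (contDiff_evo hχ t).continuous
      fun_prop
    · have h1 : ‖evo χ t z.2‖ = ‖χ z.2‖ := by
        rw [evo, norm_mul, neg_mul_comm, ← Complex.ofReal_neg, norm_exp_I_mul_ofReal, mul_one]
      rw [norm_mul, norm_mul, norm_mul, norm_exp_I_mul_ofReal, mul_one, mul_comm, h1]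
  calc cv (kern (evo χ t)) G x = (((2 * Real.pi) ^ d : ℝ) : ℂ)⁻¹ * ∫ y, ∫ ξ, evo χ t ξ *
      Complex.exp (Complex.I * ((⟪x - y, ξ⟫ : ℝ) : ℂ)) * G y := by
        rw [cv, ← integral_const_mul]
        congr 1; ext y
        rw [kern, integral_mul_const, mul_assoc]
    _ = (((2 * Real.pi) ^ d : ℝ) : ℂ)⁻¹ * ∫ ξ, ∫ y, evo χ t ξ *
      Complex.exp (Complex.I * ((⟪x - y, ξ⟫ : ℝ) : ℂ)) * G y := by
        rw [integral_integral_swap hprod]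
    _ = _ := by
        rw [fullExt]
        congr 2; ext ξ
        rw [mul_right_comm, ← integral_const_mul]
        congr 1; ext y
        have : Complex.exp (Complex.I * ((⟪x - y, ξ⟫ : ℝ) : ℂ))
            * Complex.exp (-Complex.I * ((t * ‖ξ‖ ^ 2 : ℝ) : ℂ))
            = Complex.exp (Complex.I * ((-t * ‖ξ‖ ^ 2 - ⟪-x, ξ⟫ : ℝ) : ℂ)) *
              Complex.exp (-Complex.I * ((⟪y, ξ⟫ : ℝ) : ℂ)) := by
          rw [← Complex.exp_add, ← Complex.exp_add, inner_sub_left, inner_neg_left]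
          push_cast; ring_nf
        rw [evo]
        linear_combination (χ ξ * G y) * this

theorem lintegral_fourier_sq (g : 𝓢(Rd d, ℂ)) :
    ∫⁻ ξ, ‖∫ y, g y * Complex.exp (-Complex.I * ((⟪y, ξ⟫ : ℝ) : ℂ))‖ₑ ^ (2 : ℝ)
      = ENNReal.ofReal ((2 * Real.pi) ^ d) * ∫⁻ y, ‖g y‖ₑ ^ (2 : ℝ) := by
  have h2 : ∀ f : 𝓢(Rd d, ℂ), ∫⁻ y, ‖f y‖ₑ ^ (2 : ℝ) = ENNReal.ofReal (∫ y, ‖f y‖ ^ 2) := by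
    intro f
    have hi : Integrable (fun y => ‖f y‖ ^ 2) := by
      have := (f.memLp 2 volume)
      exact (memLp_two_iff_integrable_sq_norm this.1).1 this
    rw [ofReal_integral_eq_lintegral_ofReal hi (Filter.Eventually.of_forall fun y => by positivity)]
    refine lintegral_congr fun y => ?_
    rw [← ofReal_norm, ENNReal.ofReal_rpow_of_nonneg (norm_nonneg _) (by norm_num), Real.rpow_two]
  rw [lintegral_smul_comp (r := 2 * Real.pi) (by positivity), abs_of_nonneg (by positivity), h2,
    ← SchwartzMap.integral_norm_sq_fourier, ← h2]
  congr 2; ext ξ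
  rw [SchwartzMap.fourier_coe, Real.fourier_eq']
  congr 3; ext y
  rw [smul_eq_mul, mul_comm]
  congr 2
  rw [inner_smul_right]
  push_cast; ring

theorem cv_sub {k g h : Rd d → ℂ} {x : Rd d} (hg : Integrable fun y => k (x - y) * g y)
    (hh : Integrable fun y => k (x - y) * h y) :
    cv k (fun y => g y - h y) x = cv k g x - cv k h x := by
  rw [cv, cv, cv, ← integral_sub hg hh]
  congr 1; ext y; ring

/-- At `p = 2` the exponent `1/2 - 1/p` vanishes and the dyadic time intervals no longer sum
geometrically; a bound global in time is obtained instead from the frequency side. -/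
theorem AdjointRestriction.lintegral_cv_le_of_two_schwartz {q : ℝ} (hq : 2 ≤ q)
    (h : AdjointRestriction d 2 q) {χ : Rd d → ℂ} (hχ : ContDiff ℝ ∞ χ)
    (hc : HasCompactSupport χ) :
    ∃ C : ℝ≥0∞, C ≠ ⊤ ∧ ∀ G : 𝓢(Rd d, ℂ),
      ∫⁻ t, ∫⁻ x, ‖cv (kern (evo χ t)) G x‖ₑ ^ q ≤ C * (∫⁻ y, ‖G y‖ₑ ^ (2 : ℝ)) ^ (q / 2) := by
  have hq0 : 0 < q := by linarith
  obtain ⟨R, hR, hs⟩ : ∃ R : ℝ, 0 < R ∧ ∀ ξ, χ ξ ≠ 0 → ‖ξ‖ ≤ R := by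
    obtain ⟨R, hR, hs⟩ := hc.isCompact.isBounded.subset_closedBall_lt 0 0
    refine ⟨R, hR, fun ξ hξ => ?_⟩
    simpa using hs (subset_tsupport _ hξ)
  obtain ⟨B, hB⟩ := hχ.continuous.bounded_above_of_compact_support hc
  obtain ⟨C, hCt, hC⟩ := h.lintegral_fullExt_le (by norm_num) hq0 hR
  set c : ℝ≥0∞ := ‖(((2 * Real.pi) ^ d : ℝ) : ℂ)⁻¹‖ₑ ^ q with hcdef
  have hct : c ≠ ⊤ := ENNReal.rpow_ne_top_of_nonneg hq0.le enorm_ne_top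
  set B' : ℝ≥0∞ := ENNReal.ofReal B ^ (2 : ℝ) * ENNReal.ofReal ((2 * Real.pi) ^ d) with hB'
  have hB't : B' ≠ ⊤ := ENNReal.mul_ne_top
    (ENNReal.rpow_ne_top_of_nonneg (by norm_num) ENNReal.ofReal_ne_top) ENNReal.ofReal_ne_top
  refine ⟨c * (C * B' ^ (q / 2)), ENNReal.mul_ne_top hct (ENNReal.mul_ne_top hCt
    (ENNReal.rpow_ne_top_of_nonneg (by positivity) hB't)), fun G => ?_⟩
  set H : Rd d → ℂ := fun ξ => χ ξ * ∫ y, G y * Complex.exp (-Complex.I * ((⟪y, ξ⟫ : ℝ) : ℂ)) with hH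
  have hHle : ∫⁻ ξ, ‖H ξ‖ₑ ^ (2 : ℝ) ≤ B' * ∫⁻ y, ‖G y‖ₑ ^ (2 : ℝ) := by
    rw [hB', mul_assoc, ← lintegral_fourier_sq, ← lintegral_const_mul' _ _
      (ENNReal.rpow_ne_top_of_nonneg (by norm_num) ENNReal.ofReal_ne_top)]
    refine lintegral_mono fun ξ => ?_
    simp only [hH]
    rw [enorm_mul, ENNReal.mul_rpow_of_nonneg _ _ (by norm_num)]
    gcongr
    rw [← ofReal_norm]
    exact ENNReal.ofReal_le_ofReal (hB ξ)
  have hGm : MemLp G (ENNReal.ofReal 2) volume := G.memLp _ _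
  have hHm : MemLp H (ENNReal.ofReal 2) volume := by
    rw [memLp_ofReal_iff (by norm_num)] at hGm ⊢
    refine ⟨?_, ne_top_of_le_ne_top (ENNReal.mul_ne_top hB't hGm.2) hHle⟩
    refine (hχ.continuous.mul ?_).aestronglyMeasurable
    refine continuous_of_dominated (bound := fun y => ‖G y‖) ?_ ?_ G.integrable.norm ?_
    · intro x
      exact G.integrable.1.mul (Continuous.aestronglyMeasurable (by fun_prop))
    · intro x
      refine Filter.Eventually.of_forall fun y => ?_
      rw [norm_mul, neg_mul_comm, ← Complex.ofReal_neg, norm_exp_I_mul_ofReal, mul_one]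
    · exact Filter.Eventually.of_forall fun y => by fun_prop
  calc ∫⁻ t, ∫⁻ x, ‖cv (kern (evo χ t)) G x‖ₑ ^ q
      = ∫⁻ t, ∫⁻ x, c * ‖fullExt H (-x, -t)‖ₑ ^ q := by
        refine lintegral_congr fun t => lintegral_congr fun x => ?_
        rw [cv_kern_evo_eq_fullExt hχ hc G.integrable, enorm_mul,
          ENNReal.mul_rpow_of_nonneg _ _ hq0.le]
    _ = c * ∫⁻ t, ∫⁻ x, ‖fullExt H (x, t)‖ₑ ^ q := by
        have e1 : ∀ t, ∫⁻ x, c * ‖fullExt H (-x, -t)‖ₑ ^ q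
            = c * ∫⁻ x, ‖fullExt H (x, -t)‖ₑ ^ q := by
          intro t
          rw [lintegral_const_mul' _ _ hct,
            lintegral_neg_eq_self (fun x => ‖fullExt H (x, -t)‖ₑ ^ q)]
        simp only [e1]
        rw [lintegral_const_mul' _ _ hct,
          lintegral_neg_eq_self (fun t => ∫⁻ x, ‖fullExt H (x, t)‖ₑ ^ q)]
    _ ≤ c * (C * (∫⁻ ξ, ‖H ξ‖ₑ ^ (2 : ℝ)) ^ (q / 2)) := by
        gcongr
        exact hC H hHm fun ξ hξ => hs ξ (left_ne_zero_of_mul hξ)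
    _ ≤ c * (C * (B' * ∫⁻ y, ‖G y‖ₑ ^ (2 : ℝ)) ^ (q / 2)) := by gcongr
    _ = _ := by
        rw [ENNReal.mul_rpow_of_nonneg _ _ (by positivity)]; ring

/-- Approximation in `L²` by Schwartz functions: at each time the kernel maps `L²` boundedly into
`L^∞`, so the evolutions converge pointwise and Fatou's lemma transfers the bound. -/
theorem AdjointRestriction.lintegral_cv_le_of_two {q : ℝ} (hq : 2 ≤ q)
    (h : AdjointRestriction d 2 q) {χ : Rd d → ℂ} (hχ : ContDiff ℝ ∞ χ)
    (hc : HasCompactSupport χ) :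
    ∃ C : ℝ≥0∞, C ≠ ⊤ ∧ ∀ G : Rd d → ℂ, MemLp G (ENNReal.ofReal 2) volume →
      ∫⁻ t, ∫⁻ x, ‖cv (kern (evo χ t)) G x‖ₑ ^ q ≤ C * (∫⁻ y, ‖G y‖ₑ ^ (2 : ℝ)) ^ (q / 2) := by
  have hq0 : 0 < q := by linarith
  obtain ⟨C, hCt, hC⟩ := h.lintegral_cv_le_of_two_schwartz hq hχ hc
  refine ⟨C, hCt, fun G hG => ?_⟩
  have happ : ∀ n : ℕ, ∃ g : 𝓢(Rd d, ℂ),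
      eLpNorm (fun y => g y - G y) (ENNReal.ofReal 2) volume ≤ ENNReal.ofReal (1 / (n + 1 : ℝ)) := by
    intro n
    obtain ⟨g, hg₁, hg₂, hg₃⟩ := MemLp.exist_eLpNorm_sub_le (by norm_num)
      (one_le_ofReal_of_two_le le_rfl) hG (ε := 1 / (n + 1 : ℝ)) (by positivity)
    refine ⟨hg₁.toSchwartzMap hg₂, ?_⟩
    rw [eLpNorm_sub_comm] at hg₃
    exact hg₃
  choose g hg using happ
  have hlim0 : Filter.Tendsto (fun n => eLpNorm (fun y => g n y - G y) (ENNReal.ofReal 2) volume)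
      Filter.atTop (nhds 0) := by
    refine tendsto_of_tendsto_of_tendsto_of_le_of_le tendsto_const_nhds ?_ (fun n => zero_le) hg
    have := (ENNReal.continuous_ofReal.tendsto 0).comp tendsto_one_div_add_atTop_nhds_zero_nat
    simpa [Function.comp_def] using this
  have hgm : ∀ n, MemLp (g n) (ENNReal.ofReal 2) volume := fun n => (g n).memLp _ _
  have hsub : ∀ n, MemLp (fun y => g n y - G y) (ENNReal.ofReal 2) volume := fun n =>
    (hgm n).sub hG
  have hpt : ∀ t x, Filter.Tendsto (fun n => ‖cv (kern (evo χ t)) (g n) x‖ₑ ^ q) Filter.atTop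
      (nhds (‖cv (kern (evo χ t)) G x‖ₑ ^ q)) := by
    intro t x
    refine ((ENNReal.continuous_rpow_const).tendsto _).comp (Filter.Tendsto.enorm ?_)
    rw [tendsto_iff_enorm_sub_tendsto_zero]
    obtain ⟨W, hW⟩ : ∃ W : ℝ, ∀ x, ‖kern (evo χ t) x‖ ≤ W := ⟨_, norm_kern_evo_le χ t⟩
    set K := (∫⁻ y, ‖kern (evo χ t) y‖ₑ) ^ ((2 : ℝ) - 1) * ENNReal.ofReal W with hK
    have hKt : K ≠ ⊤ := ENNReal.mul_ne_top (ENNReal.rpow_ne_top_of_nonneg (by norm_num)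
      (integrable_kern (contDiff_evo hχ t) (hasCompactSupport_evo hc t)).2.ne) ENNReal.ofReal_ne_top
    have hle : ∀ n, ‖cv (kern (evo χ t)) (g n) x - cv (kern (evo χ t)) G x‖ₑ
        ≤ K ^ (1 / 2 : ℝ) * eLpNorm (fun y => g n y - G y) (ENNReal.ofReal 2) volume := by
      intro n
      rw [← cv_sub (integrable_kern_mul (contDiff_evo hχ t) (hasCompactSupport_evo hc t)
        (by norm_num : (1 : ℝ) ≤ 2) (hgm n) x) (integrable_kern_mul (contDiff_evo hχ t)
        (hasCompactSupport_evo hc t) (by norm_num : (1 : ℝ) ≤ 2) hG x), eLpNorm_ofReal_eq (by norm_num),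
        ← ENNReal.mul_rpow_of_nonneg _ _ (by norm_num), one_div, ENNReal.le_rpow_inv_iff (by norm_num)]
      refine (ENNReal.rpow_le_rpow (enorm_cv_le _ _ _) (by norm_num)).trans ?_
      refine conv_rpow_le_of_le (continuous_kern (contDiff_evo hχ t)
        (hasCompactSupport_evo hc t)).measurable.enorm (hsub n).1.enorm (fun x => ?_) (by norm_num) x
      rw [← ofReal_norm]
      exact ENNReal.ofReal_le_ofReal (hW x)
    refine tendsto_of_tendsto_of_tendsto_of_le_of_le tendsto_const_nhds ?_ (fun n => zero_le) hle
    have := ENNReal.Tendsto.const_mul hlim0 (a := K ^ (1 / 2 : ℝ))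
      (Or.inr (ENNReal.rpow_ne_top_of_nonneg (by norm_num) hKt))
    simpa using this
  set μ : Measure (Rd d × ℝ) := volume.prod volume with hμ
  have hm : ∀ F : Rd d → ℂ, AEStronglyMeasurable F volume →
      AEMeasurable (fun v : Rd d × ℝ => ‖cv (kern (evo χ v.2)) F v.1‖ₑ ^ q) μ := fun F hF =>
    (aestronglyMeasurable_cv_kern_evo hχ hc hF μ).enorm.pow_const q
  have hnorm : Filter.Tendsto (fun n => C * (∫⁻ y, ‖g n y‖ₑ ^ (2 : ℝ)) ^ (q / 2)) Filter.atTop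
      (nhds (C * (∫⁻ y, ‖G y‖ₑ ^ (2 : ℝ)) ^ (q / 2))) := by
    refine ENNReal.Tendsto.const_mul ?_ (Or.inr hCt)
    have e : ∀ F : Rd d → ℂ, (∫⁻ y, ‖F y‖ₑ ^ (2 : ℝ)) ^ (q / 2)
        = eLpNorm F (ENNReal.ofReal 2) volume ^ q := by
      intro F
      rw [eLpNorm_ofReal_eq (by norm_num), ← ENNReal.rpow_mul]
      congr 1; ring
    simp only [e]
    refine ((ENNReal.continuous_rpow_const).tendsto _).comp ?_
    refine tendsto_of_tendsto_of_tendsto_of_le_of_le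
      (g := fun n => eLpNorm G (ENNReal.ofReal 2) volume
        - eLpNorm (fun y => g n y - G y) (ENNReal.ofReal 2) volume)
      (h := fun n => eLpNorm G (ENNReal.ofReal 2) volume
        + eLpNorm (fun y => g n y - G y) (ENNReal.ofReal 2) volume) ?_ ?_ ?_ ?_
    · simpa using ENNReal.Tendsto.sub (tendsto_const_nhds
        (x := eLpNorm G (ENNReal.ofReal 2) volume)) hlim0 (Or.inl hG.2.ne)
    · simpa using hlim0.const_add (eLpNorm G (ENNReal.ofReal 2) volume)
    · intro n
      rw [tsub_le_iff_right]
      have := eLpNorm_sub_le (hgm n).1 (hsub n).1 (one_le_ofReal_of_two_le le_rfl)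
      simpa [Pi.sub_def] using this
    · intro n
      have := eLpNorm_add_le hG.1 (hsub n).1 (one_le_ofReal_of_two_le le_rfl)
      simpa [Pi.add_def] using this
  calc ∫⁻ t, ∫⁻ x, ‖cv (kern (evo χ t)) G x‖ₑ ^ q
      = ∫⁻ v, ‖cv (kern (evo χ v.2)) G v.1‖ₑ ^ q ∂μ := (lintegral_prod_symm _ (hm G hG.1)).symm
    _ = ∫⁻ v, Filter.liminf (fun n => ‖cv (kern (evo χ v.2)) (g n) v.1‖ₑ ^ q) Filter.atTop ∂μ :=
        lintegral_congr fun v => (hpt v.2 v.1).liminf_eq.symm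
    _ ≤ Filter.liminf (fun n => ∫⁻ v, ‖cv (kern (evo χ v.2)) (g n) v.1‖ₑ ^ q ∂μ) Filter.atTop :=
        lintegral_liminf_le' fun n => hm _ (hgm n).1
    _ ≤ Filter.liminf (fun n => C * (∫⁻ y, ‖g n y‖ₑ ^ (2 : ℝ)) ^ (q / 2)) Filter.atTop := by
        refine Filter.liminf_le_liminf (Filter.Eventually.of_forall fun n => ?_)
        rw [hμ, lintegral_prod_symm _ (hm _ (hgm n).1)]
        exact hC (g n)
    _ = _ := hnorm.liminf_eq

/-- The space-time estimate for evolutions with a fixed frequency localization. -/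
theorem AdjointRestriction.lintegral_cv_le {p q : ℝ} (hd : 1 ≤ d) (hp : 2 ≤ p)
    (hpq : p ≤ q) (h : AdjointRestriction d p q) {χ : Rd d → ℂ} (hχ : ContDiff ℝ ∞ χ)
    (hc : HasCompactSupport χ) :
    ∃ C : ℝ≥0∞, C ≠ ⊤ ∧ ∀ (N : ℝ), 1 ≤ N → ∀ (G : Rd d → ℂ), MemLp G (ENNReal.ofReal p) volume →
      ∫⁻ t in Icc (-N) N, ∫⁻ x, ‖cv (kern (evo χ t)) G x‖ₑ ^ q
        ≤ C * ENNReal.ofReal (N ^ (d * q * (1 / 2 - 1 / p))) * (∫⁻ y, ‖G y‖ₑ ^ p) ^ (q / p) := by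
  rcases hp.lt_or_eq with hp | rfl
  · exact h.lintegral_cv_le_of_two_lt hd hp hpq hχ hc
  · obtain ⟨C, hCt, hC⟩ := h.lintegral_cv_le_of_two hpq hχ hc
    refine ⟨C, hCt, fun N _ G hG => ?_⟩
    simp only [sub_self, mul_zero, Real.rpow_zero, ENNReal.ofReal_one, mul_one]
    exact (setLIntegral_le_lintegral _ _).trans (hC G hG)

/-! ### Parabolic scaling to frequency `r` -/

theorem kern_evo_comp_smul {r : ℝ} (hr : 0 < r) (χ : Rd d → ℂ) (t : ℝ) (x : Rd d) :
    kern (evo (fun ξ => χ (r⁻¹ • ξ)) t) x = ((r ^ d : ℝ) : ℂ) * kern (evo χ (r ^ 2 * t)) (r • x) := by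
  have h := Measure.integral_comp_smul (volume : Measure (Rd d)) (fun ξ =>
    evo (fun ξ => χ (r⁻¹ • ξ)) t ξ * Complex.exp (Complex.I * ((⟪x, ξ⟫ : ℝ) : ℂ))) r
  rw [finrank_euclideanSpace_fin, abs_of_nonneg (by positivity), Complex.real_smul] at h
  have h2 : ∫ ξ, evo (fun ξ => χ (r⁻¹ • ξ)) t ξ * Complex.exp (Complex.I * ((⟪x, ξ⟫ : ℝ) : ℂ))
      = ((r ^ d : ℝ) : ℂ) * ∫ ξ, evo χ (r ^ 2 * t) ξ *
        Complex.exp (Complex.I * ((⟪r • x, ξ⟫ : ℝ) : ℂ)) := by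
    have h3 : ∀ ξ, evo (fun ξ => χ (r⁻¹ • ξ)) t (r • ξ) *
        Complex.exp (Complex.I * ((⟪x, r • ξ⟫ : ℝ) : ℂ)) = evo χ (r ^ 2 * t) ξ *
        Complex.exp (Complex.I * ((⟪r • x, ξ⟫ : ℝ) : ℂ)) := by
      intro ξ
      rw [evo, evo, smul_smul, inv_mul_cancel₀ hr.ne', one_smul, norm_smul,
        Real.norm_of_nonneg hr.le, inner_smul_right, real_inner_smul_left]
      congr 5
      ring
    simp only [h3] at h
    rw [h, ← mul_assoc, ← Complex.ofReal_mul, mul_inv_cancel₀ (by positivity)]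
    simp
  rw [kern, kern, h2]
  ring

theorem cv_kern_evo_comp_smul {r : ℝ} (hr : 0 < r) (χ g : Rd d → ℂ) (t : ℝ) (x : Rd d) :
    cv (kern (evo (fun ξ => χ (r⁻¹ • ξ)) t)) g x
      = cv (kern (evo χ (r ^ 2 * t))) (fun y => g (r⁻¹ • y)) (r • x) := by
  have h := Measure.integral_comp_smul (volume : Measure (Rd d)) (fun y =>
    kern (evo χ (r ^ 2 * t)) (r • x - y) * g (r⁻¹ • y)) r
  rw [finrank_euclideanSpace_fin, abs_of_nonneg (by positivity), Complex.real_smul] at h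
  have h1 : ∫ y, kern (evo χ (r ^ 2 * t)) (r • x - y) * g (r⁻¹ • y)
      = ((r ^ d : ℝ) : ℂ) * ∫ y, kern (evo χ (r ^ 2 * t)) (r • x - r • y) * g (r⁻¹ • r • y) := by
    rw [h, ← mul_assoc, ← Complex.ofReal_mul, mul_inv_cancel₀ (by positivity)]
    simp
  rw [cv, cv, h1, ← integral_const_mul]
  congr 1; ext y
  rw [kern_evo_comp_smul hr, smul_smul, inv_mul_cancel₀ hr.ne', one_smul, smul_sub, mul_assoc]

/-- The space-time estimate for evolutions of functions of frequency at most `r`. -/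
theorem AdjointRestriction.lintegral_cv_comp_smul_le {p q : ℝ} (hd : 1 ≤ d) (hp : 2 ≤ p)
    (hpq : p ≤ q) (h : AdjointRestriction d p q) {χ : Rd d → ℂ} (hχ : ContDiff ℝ ∞ χ)
    (hc : HasCompactSupport χ) {T : ℝ} (hT : 1 ≤ T) :
    ∃ C : ℝ≥0∞, C ≠ ⊤ ∧ ∀ (r : ℝ), 1 ≤ r → ∀ (g : Rd d → ℂ), MemLp g (ENNReal.ofReal p) volume →
      ∫⁻ t in Icc (-T) T, ∫⁻ x, ‖cv (kern (evo (fun ξ => χ (r⁻¹ • ξ)) t)) g x‖ₑ ^ q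
        ≤ C * ENNReal.ofReal (r ^ (q * (d * (1 - 1 / p - 1 / q) - 2 / q)))
          * (∫⁻ y, ‖g y‖ₑ ^ p) ^ (q / p) := by
  have hp0 : 0 < p := by linarith
  have hq0 : 0 < q := by linarith
  obtain ⟨C, hCt, hC⟩ := h.lintegral_cv_le hd hp hpq hχ hc
  set γ : ℝ := d * q * (1 / 2 - 1 / p) with hγ
  refine ⟨C * ENNReal.ofReal (T ^ γ), ENNReal.mul_ne_top hCt ENNReal.ofReal_ne_top,
    fun r hr g hg => ?_⟩
  have hr0 : 0 < r := by linarith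
  have hT0 : 0 < T := by linarith
  have hrd : ENNReal.ofReal (|r| ^ d) ≠ 0 := by
    rw [Ne, ENNReal.ofReal_eq_zero, not_le, abs_of_pos hr0]; positivity
  have hin : ∀ t, ∫⁻ x, ‖cv (kern (evo (fun ξ => χ (r⁻¹ • ξ)) t)) g x‖ₑ ^ q
      = ENNReal.ofReal (r ^ d)⁻¹ *
        ∫⁻ x, ‖cv (kern (evo χ (r ^ 2 * t))) (fun y => g (r⁻¹ • y)) x‖ₑ ^ q := by
    intro t
    rw [lintegral_smul_comp hr0.ne'
      (fun x => ‖cv (kern (evo χ (r ^ 2 * t))) (fun y => g (r⁻¹ • y)) x‖ₑ ^ q), ← mul_assoc,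
      ← ENNReal.ofReal_mul (by positivity), abs_of_pos hr0, inv_mul_cancel₀ (by positivity),
      ENNReal.ofReal_one, one_mul]
    simp only [cv_kern_evo_comp_smul hr0]
  have hgp : ∫⁻ y, ‖g (r⁻¹ • y)‖ₑ ^ p = ENNReal.ofReal (r ^ d) * ∫⁻ y, ‖g y‖ₑ ^ p := by
    rw [lintegral_smul_comp hr0.ne' (fun y => ‖g (r⁻¹ • y)‖ₑ ^ p), abs_of_pos hr0]
    simp only [smul_smul, inv_mul_cancel₀ hr0.ne', one_smul]
  have hN : 1 ≤ r ^ 2 * T := by nlinarith [sq_nonneg (r - 1)]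
  calc ∫⁻ t in Icc (-T) T, ∫⁻ x, ‖cv (kern (evo (fun ξ => χ (r⁻¹ • ξ)) t)) g x‖ₑ ^ q
      = ENNReal.ofReal (r ^ d)⁻¹ * (ENNReal.ofReal (r ^ 2)⁻¹ * ∫⁻ t in Icc (-(r ^ 2 * T)) (r ^ 2 * T),
          ∫⁻ x, ‖cv (kern (evo χ t)) (fun y => g (r⁻¹ • y)) x‖ₑ ^ q) := by
        simp only [hin]
        rw [lintegral_const_mul' _ _ ENNReal.ofReal_ne_top, setLIntegral_Icc_comp_mul (by positivity)
          _ _ (fun t => ∫⁻ x, ‖cv (kern (evo χ t)) (fun y => g (r⁻¹ • y)) x‖ₑ ^ q), mul_neg]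
    _ ≤ ENNReal.ofReal (r ^ d)⁻¹ * (ENNReal.ofReal (r ^ 2)⁻¹ * (C * ENNReal.ofReal ((r ^ 2 * T) ^ γ) *
          (∫⁻ y, ‖g (r⁻¹ • y)‖ₑ ^ p) ^ (q / p))) := by
        gcongr
        exact hC _ hN _ (memLp_comp_smul hp0 (inv_ne_zero hr0.ne') hg)
    _ = C * ENNReal.ofReal (T ^ γ) * (ENNReal.ofReal (r ^ d)⁻¹ * ENNReal.ofReal (r ^ 2)⁻¹ *
          ENNReal.ofReal ((r ^ 2) ^ γ) * ENNReal.ofReal ((r ^ d) ^ (q / p))) *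
          (∫⁻ y, ‖g y‖ₑ ^ p) ^ (q / p) := by
        rw [hgp, ENNReal.mul_rpow_of_nonneg _ _ (by positivity),
          ENNReal.ofReal_rpow_of_nonneg (by positivity) (by positivity),
          Real.mul_rpow (by positivity) hT0.le, ENNReal.ofReal_mul (by positivity)]
        ring
    -- The powers of `r`: `-d - 2` from the Jacobians, `2γ` from the rescaled time span `r² T`, and
    -- `d q / p` from the dilated datum. Their sum is `q α`.
    _ = _ := by
        congr 2
        rw [← ENNReal.ofReal_mul (by positivity), ← ENNReal.ofReal_mul (by positivity),
          ← ENNReal.ofReal_mul (by positivity), ← Real.rpow_natCast, ← Real.rpow_natCast,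
          ← Real.rpow_neg hr0.le, ← Real.rpow_neg hr0.le, ← Real.rpow_mul hr0.le,
          ← Real.rpow_mul hr0.le, ← Real.rpow_add hr0, ← Real.rpow_add hr0, ← Real.rpow_add hr0]
        congr 2
        rw [hγ]
        push_cast
        field_simp
        ring

/-! ### Fourier multipliers on tempered distributions and representing functions -/

/-- The symbol `m` has temperate growth. -/
abbrev TemperateSymbol (m : Rd d → ℂ) : Prop := Function.HasTemperateGrowth m

theorem TemperateSymbol.comp_smul {m : Rd d → ℂ} (hm : TemperateSymbol m) (r : ℝ) :
    Function.HasTemperateGrowth (fun ξ => m (r • ξ)) :=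
  Function.HasTemperateGrowth.comp hm (r • ContinuousLinearMap.id ℝ (Rd d)).hasTemperateGrowth

theorem hasTemperateGrowth_exp_I_mul :
    Function.HasTemperateGrowth (fun r : ℝ => Complex.exp (Complex.I * (r : ℂ))) := by
  have hc : ContDiff ℝ ∞ (fun r : ℝ => Complex.exp (Complex.I * (r : ℂ))) :=
    ContDiff.cexp (contDiff_const.mul Complex.ofRealCLM.contDiff)
  have hn : ∀ n : ℕ, iteratedDeriv n (fun r : ℝ => Complex.exp (Complex.I * (r : ℂ)))
      = fun r : ℝ => Complex.I ^ n * Complex.exp (Complex.I * (r : ℂ)) := by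
    intro n
    induction n with
    | zero => ext r; simp
    | succ n ih =>
      ext r
      rw [iteratedDeriv_succ, ih]
      have h1 : HasDerivAt (fun r : ℝ => Complex.exp (Complex.I * (r : ℂ)))
          (Complex.exp (Complex.I * (r : ℂ)) * (Complex.I * 1)) r :=
        ((Complex.ofRealCLM.hasDerivAt (x := r)).const_mul Complex.I).cexp
      rw [(h1.const_mul (Complex.I ^ n)).deriv]
      ring
  refine ⟨hc, fun n => ⟨0, 1, fun r => ?_⟩⟩
  rw [norm_iteratedFDeriv_eq_norm_iteratedDeriv, hn, norm_mul, norm_exp_I_mul_ofReal]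
  simp

theorem temperateSymbol_exp (t : ℝ) : TemperateSymbol (fun ξ : Rd d =>
    Complex.exp (-Complex.I * ((t * ‖ξ‖ ^ 2 : ℝ) : ℂ))) := by
  have h1 : Function.HasTemperateGrowth (fun ξ : Rd d => -t * ‖ξ‖ ^ 2) :=
    (Function.HasTemperateGrowth.const (-t)).mul (Function.hasTemperateGrowth_norm_sq _)
  have h2 := hasTemperateGrowth_exp_I_mul.comp h1
  have e : (fun ξ : Rd d => Complex.exp (-Complex.I * ((t * ‖ξ‖ ^ 2 : ℝ) : ℂ)))
      = (fun r : ℝ => Complex.exp (Complex.I * (r : ℂ))) ∘ (fun ξ : Rd d => -t * ‖ξ‖ ^ 2) := by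
    ext ξ
    simp only [Function.comp]
    push_cast
    ring_nf
  rw [TemperateSymbol, e]
  exact h2

theorem multiplierOp_multiplierOp {m₁ m₂ : Rd d → ℂ} (h₁ : TemperateSymbol m₁)
    (h₂ : TemperateSymbol m₂) (T : 𝓢'(Rd d, ℂ)) :
    multiplierOp m₂ (multiplierOp m₁ T) = multiplierOp (fun ξ => m₁ ξ * m₂ ξ) T :=
  TemperedDistribution.fourierMultiplierCLM_fourierMultiplierCLM_apply (h₁.comp_smul _)
    (h₂.comp_smul _) T

theorem multiplierOp_sum {m : ℕ → Rd d → ℂ} (h : ∀ k, TemperateSymbol (m k)) (s : Finset ℕ)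
    (T : 𝓢'(Rd d, ℂ)) :
    ∑ k ∈ s, multiplierOp (m k) T = multiplierOp (fun ξ => ∑ k ∈ s, m k ξ) T := by
  have := TemperedDistribution.fourierMultiplierCLM_sum ℂ (s := s)
    (g := fun k ξ => m k ((2 * Real.pi) • ξ)) fun k _ => (h k).comp_smul _
  unfold multiplierOp
  rw [this, sum_apply]

theorem schrodinger_multiplierOp {m : Rd d → ℂ} (hm : TemperateSymbol m) (t : ℝ)
    (T : 𝓢'(Rd d, ℂ)) : schrodinger t (multiplierOp m T) = multiplierOp (evo m t) T :=
  multiplierOp_multiplierOp hm (temperateSymbol_exp t) T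

open FourierTransform in
theorem multiplierOp_apply (m : Rd d → ℂ) (T : 𝓢'(Rd d, ℂ)) (φ : 𝓢(Rd d, ℂ)) :
    multiplierOp m T φ
      = T (𝓕 (SchwartzMap.smulLeftCLM ℂ (fun ξ => m ((2 * Real.pi) • ξ)) (𝓕⁻ φ))) := rfl

open FourierTransform in
/-- The transpose of a Fourier multiplier is an integral operator. -/
theorem fourier_smulLeft_fourierInv_apply {m : Rd d → ℂ} (hm : ContDiff ℝ ∞ m)
    (hc : HasCompactSupport m) (φ : 𝓢(Rd d, ℂ)) (y : Rd d) :
    𝓕 (SchwartzMap.smulLeftCLM ℂ (fun ξ => m ((2 * Real.pi) • ξ)) (𝓕⁻ φ)) y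
      = ∫ x, φ x * kern m (x - y) := by
  have hmT : TemperateSymbol m := hc.hasTemperateGrowth hm
  have hmi : Integrable m := hm.continuous.integrable_of_hasCompactSupport hc
  have hprod : Integrable (fun z : Rd d × Rd d => m z.2 *
      Complex.exp (Complex.I * ((⟪z.1 - y, z.2⟫ : ℝ) : ℂ)) * φ z.1) (volume.prod volume) := by
    refine (φ.integrable.mul_prod hmi).norm.mono' ?_ (Filter.Eventually.of_forall fun z => ?_)
    · refine Continuous.aestronglyMeasurable ?_
      have := hm.continuous
      have := φ.continuous
      fun_prop
    · rw [norm_mul, norm_mul, norm_mul, norm_exp_I_mul_ofReal, mul_one, mul_comm]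
  calc _ = ∫ η, m ((2 * Real.pi) • η) * (Complex.exp (-Complex.I * ((⟪y, (2 * Real.pi) • η⟫ : ℝ) : ℂ)) *
        ∫ x, φ x * Complex.exp (Complex.I * ((⟪x, (2 * Real.pi) • η⟫ : ℝ) : ℂ))) := by
        rw [SchwartzMap.fourier_coe, Real.fourier_eq']
        congr 1; ext η
        rw [SchwartzMap.smulLeftCLM_apply_apply (hmT.comp_smul _), SchwartzMap.fourierInv_coe,
          Real.fourierInv_eq', smul_eq_mul, smul_eq_mul, mul_left_comm]
        congr 2
        · congr 1
          rw [inner_smul_right, real_inner_comm]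
          push_cast; ring
        · congr 1; ext x
          rw [smul_eq_mul, mul_comm]
          congr 2
          rw [inner_smul_right]
          push_cast; ring
    _ = (((2 * Real.pi) ^ d : ℝ) : ℂ)⁻¹ * ∫ ξ, ∫ x, m ξ *
      Complex.exp (Complex.I * ((⟪x - y, ξ⟫ : ℝ) : ℂ)) * φ x := by
        rw [integral_comp_two_pi_smul (fun ξ => m ξ * (Complex.exp (-Complex.I * ((⟪y, ξ⟫ : ℝ) : ℂ)) *
          ∫ x, φ x * Complex.exp (Complex.I * ((⟪x, ξ⟫ : ℝ) : ℂ))))]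
        congr 2; ext ξ
        rw [← integral_const_mul, ← integral_const_mul]
        congr 1; ext x
        have : Complex.exp (Complex.I * ((⟪x - y, ξ⟫ : ℝ) : ℂ))
            = Complex.exp (-Complex.I * ((⟪y, ξ⟫ : ℝ) : ℂ)) *
              Complex.exp (Complex.I * ((⟪x, ξ⟫ : ℝ) : ℂ)) := by
          rw [← Complex.exp_add, inner_sub_left]
          push_cast; ring_nf
        rw [this]; ring
    _ = (((2 * Real.pi) ^ d : ℝ) : ℂ)⁻¹ * ∫ x, ∫ ξ, m ξ *
      Complex.exp (Complex.I * ((⟪x - y, ξ⟫ : ℝ) : ℂ)) * φ x := by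
        rw [← integral_integral_swap hprod]
    _ = _ := by
        rw [← integral_const_mul]
        congr 1; ext x
        rw [kern, integral_mul_const]; ring

/-- Uniformity in `x` provides the absolute integrability needed for Fubini against a Schwartz
function. -/
theorem exists_lintegral_kern_mul_le {m : Rd d → ℂ} (hm : ContDiff ℝ ∞ m)
    (hc : HasCompactSupport m) {p : ℝ} (hp : 1 ≤ p) {g : Rd d → ℂ}
    (hg : MemLp g (ENNReal.ofReal p) volume) :
    ∃ B : ℝ≥0∞, B ≠ ⊤ ∧ ∀ x, ∫⁻ y, ‖kern m (x - y)‖ₑ * ‖g y‖ₑ ≤ B := by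
  have hp0 : 0 < p := by linarith
  rw [memLp_ofReal_iff hp0] at hg
  obtain ⟨W, hW⟩ : ∃ W : ℝ, ∀ x, ‖kern m x‖ ≤ W :=
    ⟨_, fun x => by simpa [evo_zero] using norm_kern_evo_le m 0 x⟩
  refine ⟨((∫⁻ y, ‖kern m y‖ₑ) ^ (p - 1) * ENNReal.ofReal W * ∫⁻ y, ‖g y‖ₑ ^ p) ^ p⁻¹, ?_, fun x => ?_⟩
  · refine ENNReal.rpow_ne_top_of_nonneg (by positivity) (ENNReal.mul_ne_top (ENNReal.mul_ne_top
      (ENNReal.rpow_ne_top_of_nonneg (by linarith) (integrable_kern hm hc).2.ne)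
      ENNReal.ofReal_ne_top) hg.2)
  · rw [ENNReal.le_rpow_inv_iff hp0]
    refine conv_rpow_le_of_le (continuous_kern hm hc).measurable.enorm hg.1.enorm (fun x => ?_) hp x
    rw [← ofReal_norm]
    exact ENNReal.ofReal_le_ofReal (hW x)

/-- Fourier multipliers act on functions by convolution. -/
theorem IsRepresentedBy.multiplierOp {m : Rd d → ℂ} (hm : ContDiff ℝ ∞ m)
    (hc : HasCompactSupport m) {p : ℝ} (hp : 1 ≤ p) {g : Rd d → ℂ}
    (hg : MemLp g (ENNReal.ofReal p) volume) {T : 𝓢'(Rd d, ℂ)} (hT : IsRepresentedBy T g) :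
    IsRepresentedBy (multiplierOp m T) (cv (kern m) g) := by
  intro φ
  obtain ⟨B, hBt, hB⟩ := exists_lintegral_kern_mul_le hm hc hp hg
  have hprod : Integrable (fun z : Rd d × Rd d => φ z.1 * (kern m (z.1 - z.2) * g z.2))
      (volume.prod volume) := by
    have hm1 : AEStronglyMeasurable (fun z : Rd d × Rd d => φ z.1 * (kern m (z.1 - z.2) * g z.2))
        (volume.prod volume) := by
      refine AEStronglyMeasurable.mul (Continuous.aestronglyMeasurable ?_)
        (AEStronglyMeasurable.mul (Continuous.aestronglyMeasurable ?_) hg.1.comp_snd)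
      · have := φ.continuous
        fun_prop
      · have := continuous_kern hm hc
        fun_prop
    refine ⟨hm1, ?_⟩
    rw [hasFiniteIntegral_iff_enorm, lintegral_prod _ hm1.enorm]
    calc ∫⁻ x, ∫⁻ y, ‖φ x * (kern m (x - y) * g y)‖ₑ
        ≤ ∫⁻ x, ‖φ x‖ₑ * B := by
          refine lintegral_mono fun x => ?_
          simp only [enorm_mul]
          rw [lintegral_const_mul' _ _ enorm_ne_top]
          gcongr
          exact hB x
      _ < ⊤ := by
          rw [lintegral_mul_const' _ _ hBt]
          exact (ENNReal.mul_ne_top φ.integrable.2.ne hBt).lt_top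
  have e : (fun x => φ x * cv (kern m) g x) = fun x => ∫ y, φ x * (kern m (x - y) * g y) := by
    ext x; rw [cv, integral_const_mul]
  refine ⟨?_, ?_⟩
  · rw [e]; exact hprod.integral_prod_left
  · rw [multiplierOp_apply, (hT _).2, e, integral_integral_swap hprod]
    congr 1; ext y
    rw [fourier_smulLeft_fourierInv_apply hm hc, ← integral_mul_const]
    congr 1; ext x
    ring

/-- The function representing a distribution is unique. -/
theorem IsRepresentedBy.ae_eq {T : 𝓢'(Rd d, ℂ)} {g g' : Rd d → ℂ} (h : IsRepresentedBy T g)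
    (h' : IsRepresentedBy T g') (hg : LocallyIntegrable g) (hg' : LocallyIntegrable g') :
    g =ᵐ[volume] g' := by
  refine ae_eq_of_integral_contDiff_smul_eq hg hg' fun φ hφ hc => ?_
  have hφ' : ContDiff ℝ ∞ (fun x => (φ x : ℂ)) := Complex.ofRealCLM.contDiff.comp hφ
  have hc' : HasCompactSupport (fun x => (φ x : ℂ)) := hc.comp_left Complex.ofReal_zero
  have h1 := (h (hc'.toSchwartzMap hφ')).2
  have h2 := (h' (hc'.toSchwartzMap hφ')).2
  simpa using h1.symm.trans h2

theorem IsRepresentedBy.sum {T : ℕ → 𝓢'(Rd d, ℂ)} {g : ℕ → Rd d → ℂ} (s : Finset ℕ)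
    (h : ∀ k ∈ s, IsRepresentedBy (T k) (g k)) :
    IsRepresentedBy (∑ k ∈ s, T k) (fun x => ∑ k ∈ s, g k x) := by
  intro φ
  simp only [Finset.mul_sum]
  refine ⟨integrable_finsetSum _ fun k hk => (h k hk φ).1, ?_⟩
  rw [integral_finsetSum _ fun k hk => (h k hk φ).1]
  have : (∑ k ∈ s, T k) φ = ∑ k ∈ s, T k φ := by
    exact map_sum (PointwiseConvergenceCLM.evalCLM (RingHom.id ℂ) ℂ φ : 𝓢'(Rd d, ℂ) →L[ℂ] ℂ) T s
  rw [this]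
  exact Finset.sum_congr rfl fun k hk => (h k hk φ).2

/-- The representing function is unique almost everywhere, so the infimum runs over a single class.
-/
theorem distLpNorm_eq {p : ℝ} (hp : 1 ≤ p) {T : 𝓢'(Rd d, ℂ)} {g : Rd d → ℂ}
    (hg : MemLp g (ENNReal.ofReal p) volume) (hT : IsRepresentedBy T g) :
    distLpNorm p T = eLpNorm g (ENNReal.ofReal p) volume := by
  have h1 : (1 : ℝ≥0∞) ≤ ENNReal.ofReal p := by rwa [ENNReal.one_le_ofReal]
  refine le_antisymm (iInf₂_le g ⟨hg, hT⟩) (le_iInf₂ fun g' hg' => ?_)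
  rw [eLpNorm_congr_ae (hT.ae_eq hg'.2 (hg.locallyIntegrable h1) (hg'.1.locallyIntegrable h1))]

theorem exists_of_distLpNorm_ne_top {p : ℝ} {T : 𝓢'(Rd d, ℂ)} (h : distLpNorm p T ≠ ⊤) :
    ∃ g, MemLp g (ENNReal.ofReal p) volume ∧ IsRepresentedBy T g := by
  by_contra! hcon
  refine h (iInf₂_eq_top.2 fun g hg => absurd hg.2 (hcon g hg.1))

/-! ### Dyadic symbols and convergence of the dyadic decomposition -/

namespace IsDyadicCutoff

variable {ψ : Rd d → ℝ}

theorem apply_eq_zero (hψ : IsDyadicCutoff ψ) {K k : ℕ} (hk : K ≤ k) {ξ : Rd d}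
    (hξ : ‖ξ‖ < 2 ^ K) : ψ (((2 : ℝ) ^ (k + 1))⁻¹ • ξ) = 0 := by
  by_contra hne
  have h := (hψ.support _ hne).1
  rw [norm_smul, Real.norm_of_nonneg (by positivity), ← div_eq_inv_mul, le_div_iff₀ (by positivity),
    pow_succ] at h
  have : (2 : ℝ) ^ K ≤ 2 ^ k := pow_le_pow_right₀ (by norm_num) hk
  linarith

theorem tsum_eq_sum (hψ : IsDyadicCutoff ψ) {K : ℕ} {ξ : Rd d} (hξ : ‖ξ‖ < 2 ^ K) :
    ∑' k : ℕ, ψ (((2 : ℝ) ^ (k + 1))⁻¹ • ξ)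
      = ∑ k ∈ Finset.range K, ψ (((2 : ℝ) ^ (k + 1))⁻¹ • ξ) :=
  _root_.tsum_eq_sum fun _ hk => hψ.apply_eq_zero (not_lt.1 fun h => hk (Finset.mem_range.2 h)) hξ

theorem exists_norm_lt (ξ : Rd d) : ∃ K : ℕ, ‖ξ‖ < (2 : ℝ) ^ K :=
  pow_unbounded_of_one_lt _ (by norm_num)

theorem contDiff_dyadicSymbol (hψ : IsDyadicCutoff ψ) (k : ℕ) : ContDiff ℝ ∞ (dyadicSymbol ψ k) := by
  have h1 : ∀ k : ℕ, ContDiff ℝ ∞ fun ξ : Rd d => ψ (((2 : ℝ) ^ (k + 1))⁻¹ • ξ) := fun k =>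
    hψ.smooth.comp (contDiff_const_smul _)
  cases k with
  | succ k => exact Complex.ofRealCLM.contDiff.comp (h1 k)
  | zero =>
    refine Complex.ofRealCLM.contDiff.comp (contDiff_const.sub (contDiff_iff_contDiffAt.2 fun ξ => ?_))
    obtain ⟨K, hK⟩ := exists_norm_lt ξ
    have h2 : ContDiffAt ℝ ∞ (fun ξ : Rd d => ∑ k ∈ Finset.range K, ψ (((2 : ℝ) ^ (k + 1))⁻¹ • ξ)) ξ :=
      (ContDiff.sum fun k _ => h1 k).contDiffAt
    refine h2.congr_of_eventuallyEq ?_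
    filter_upwards [(isOpen_lt continuous_norm continuous_const).mem_nhds hK] with η hη
    exact hψ.tsum_eq_sum hη

theorem dyadicSymbol_eq_zero_of_norm_gt (hψ : IsDyadicCutoff ψ) {k : ℕ} {ξ : Rd d}
    (hξ : 2 ^ (k + 1) < ‖ξ‖) : dyadicSymbol ψ k ξ = 0 := by
  cases k with
  | zero =>
    have := hψ.sum_eq_one ξ (by simpa using hξ.le)
    rw [dyadicSymbol, this]; simp
  | succ k =>
    rw [dyadicSymbol, Complex.ofReal_eq_zero]
    by_contra hne
    have h := (hψ.support _ hne).2
    rw [norm_smul, Real.norm_of_nonneg (by positivity), ← div_eq_inv_mul, div_le_iff₀ (by positivity),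
      ← pow_succ'] at h
    linarith

theorem hasCompactSupport_dyadicSymbol (hψ : IsDyadicCutoff ψ) (k : ℕ) :
    HasCompactSupport (dyadicSymbol ψ k) :=
  HasCompactSupport.intro (isCompact_closedBall (0 : Rd d) (2 ^ (k + 1))) fun ξ hξ =>
    hψ.dyadicSymbol_eq_zero_of_norm_gt (by simpa using hξ)

theorem dyadicSymbol_eq_zero_of_norm_lt (hψ : IsDyadicCutoff ψ) {k : ℕ} {ξ : Rd d}
    (hξ : ‖ξ‖ < 2 ^ k) : dyadicSymbol ψ (k + 1) ξ = 0 := by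
  rw [dyadicSymbol, hψ.apply_eq_zero le_rfl hξ, Complex.ofReal_zero]

theorem dyadicSymbol_zero_eq_one (hψ : IsDyadicCutoff ψ) {ξ : Rd d} (hξ : ‖ξ‖ < 1) :
    dyadicSymbol ψ 0 ξ = 1 := by
  rw [dyadicSymbol, hψ.tsum_eq_sum (K := 0) (by simpa using hξ)]
  simp

/-- Telescoping: adding `n` annuli to the low frequency symbol only dilates that symbol by `2^n`.
The partial sums are therefore smooth truncations at scale `2^n`. -/
theorem sum_dyadicSymbol (hψ : IsDyadicCutoff ψ) (n : ℕ) (ξ : Rd d) :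
    ∑ k ∈ Finset.range (n + 1), dyadicSymbol ψ k ξ = dyadicSymbol ψ 0 (((2 : ℝ) ^ n)⁻¹ • ξ) := by
  induction n with
  | zero => simp
  | succ n ih =>
    rw [Finset.sum_range_succ, ih, dyadicSymbol, dyadicSymbol, dyadicSymbol, ← Complex.ofReal_add]
    congr 1
    have hs : Summable fun k : ℕ => ψ (((2 : ℝ) ^ (k + 1))⁻¹ • ((2 : ℝ) ^ n)⁻¹ • ξ) := by
      obtain ⟨K, hK⟩ := exists_norm_lt (((2 : ℝ) ^ n)⁻¹ • ξ)
      exact summable_of_ne_finset_zero (s := Finset.range K) fun k hk =>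
        hψ.apply_eq_zero (not_lt.1 fun h => hk (Finset.mem_range.2 h)) hK
    rw [hs.tsum_eq_zero_add]
    simp only [smul_smul, ← mul_inv, ← pow_add]
    rw [show 0 + 1 + n = n + 1 by ring]
    simp only [show ∀ k, k + 1 + (n + 1) = k + 1 + 1 + n from fun k => by ring]
    ring

end IsDyadicCutoff

/-- `m - 1` vanishes near the origin and its derivatives are bounded, hence they are at most linear
in `‖ξ‖`. Evaluated at `ε • x` this gives a small factor `ε`, at the cost of one power of `‖x‖` that
a Schwartz function absorbs. -/
theorem exists_norm_iteratedFDeriv_sub_one_le {m : Rd d → ℂ} (hm : ContDiff ℝ ∞ m)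
    (hc : HasCompactSupport m) {r : ℝ} (hr : 0 < r) (h1 : ∀ ξ, ‖ξ‖ < r → m ξ = 1) (i : ℕ) :
    ∃ B : ℝ, 0 ≤ B ∧ ∀ ξ, ‖iteratedFDeriv ℝ i (fun ξ => m ξ - 1) ξ‖ ≤ B * ‖ξ‖ := by
  have hg : Continuous (iteratedFDeriv ℝ i m) := hm.continuous_iteratedFDeriv (mod_cast le_top)
  obtain ⟨B, hB⟩ := hg.bounded_above_of_compact_support (hc.iteratedFDeriv i)
  have hB0 : 0 ≤ B := (norm_nonneg _).trans (hB 0)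
  have hconst : ∀ ξ, ‖iteratedFDeriv ℝ i (fun _ : Rd d => (1 : ℂ)) ξ‖ ≤ 1 := by
    intro ξ
    rcases eq_or_ne i 0 with rfl | hi
    · simp
    · rw [iteratedFDeriv_const_of_ne hi]; simp
  refine ⟨(B + 1) / r, by positivity, fun ξ => ?_⟩
  rcases lt_or_ge ‖ξ‖ r with h | h
  · have : (fun ξ => m ξ - 1) =ᶠ[nhds ξ] fun _ => 0 := by
      filter_upwards [(isOpen_lt continuous_norm continuous_const).mem_nhds h] with η hη
      rw [h1 η hη, sub_self]
    have h2 := (this.iteratedFDeriv (𝕜 := ℝ) i).eq_of_nhds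
    rw [h2, iteratedFDeriv_fun_zero]
    simp only [Pi.zero_apply, norm_zero]
    positivity
  · have e : iteratedFDeriv ℝ i (fun ξ => m ξ - 1) ξ
        = iteratedFDeriv ℝ i m ξ - iteratedFDeriv ℝ i (fun _ : Rd d => (1 : ℂ)) ξ :=
      iteratedFDeriv_sub_apply (hm.of_le (mod_cast le_top)).contDiffAt contDiff_const.contDiffAt
    rw [e]
    calc _ ≤ B + 1 := (norm_sub_le _ _).trans (add_le_add (hB ξ) (hconst ξ))
      _ = (B + 1) / r * r := by field_simp
      _ ≤ _ := by gcongr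

/-- Smooth truncations of a Schwartz function to large balls converge to it. -/
theorem tendsto_smulLeftCLM_comp_smul {m : Rd d → ℂ} (hm : ContDiff ℝ ∞ m)
    (hc : HasCompactSupport m) {r : ℝ} (hr : 0 < r) (h1 : ∀ ξ, ‖ξ‖ < r → m ξ = 1)
    {ε : ℕ → ℝ} (hε0 : ∀ n, 0 < ε n) (hε1 : ∀ n, ε n ≤ 1)
    (hε : Filter.Tendsto ε Filter.atTop (nhds 0)) (h : 𝓢(Rd d, ℂ)) :
    Filter.Tendsto (fun n => SchwartzMap.smulLeftCLM ℂ (fun ξ => m (ε n • ξ)) h) Filter.atTop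
      (nhds h) := by
  have hmT : TemperateSymbol m := hc.hasTemperateGrowth hm
  choose B hB0 hB using fun i => exists_norm_iteratedFDeriv_sub_one_le hm hc hr h1 i
  rw [(schwartz_withSeminorms ℝ (Rd d) ℂ).tendsto_nhds _ h]
  rintro ⟨k, l⟩ δ hδ
  set S : ℝ := ∑ i ∈ Finset.range (l + 1), (l.choose i : ℝ) * B i *
    SchwartzMap.seminorm ℝ (k + 1) (l - i) h with hS
  have hS0 : 0 ≤ S := Finset.sum_nonneg fun i _ => by
    have := hB0 i
    have := apply_nonneg (SchwartzMap.seminorm ℝ (k + 1) (l - i)) h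
    positivity
  have hbound : ∀ n, SchwartzMap.seminorm ℝ k l
      (SchwartzMap.smulLeftCLM ℂ (fun ξ => m (ε n • ξ)) h - h) ≤ ε n * S := by
    intro n
    refine SchwartzMap.seminorm_le_bound ℝ k l _ (mul_nonneg (hε0 n).le hS0) fun x => ?_
    have e : ⇑(SchwartzMap.smulLeftCLM ℂ (fun ξ => m (ε n • ξ)) h - h)
        = fun x => (fun x => (fun ξ => m ξ - 1) (ε n • x)) x * h x := by
      ext x
      rw [sub_apply, SchwartzMap.smulLeftCLM_apply_apply (hmT.comp_smul _), smul_eq_mul]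
      ring
    have hf : ContDiff ℝ ∞ fun ξ => m ξ - 1 := hm.sub contDiff_const
    have hfe : ContDiff ℝ ∞ fun x => (fun ξ => m ξ - 1) (ε n • x) :=
      hf.comp (contDiff_const_smul _)
    rw [e]
    have hmul := norm_iteratedFDeriv_mul_le hfe (h.smooth ⊤) x (n := l) (mod_cast le_top)
    calc _ ≤ ‖x‖ ^ k * _ := mul_le_mul_of_nonneg_left hmul (by positivity)
      _ ≤ ε n * S := by
        rw [hS, Finset.mul_sum, Finset.mul_sum]
        refine Finset.sum_le_sum fun i _ => ?_
        have h2 : ‖iteratedFDeriv ℝ i (fun x => (fun ξ => m ξ - 1) (ε n • x)) x‖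
            ≤ B i * (ε n * ‖x‖) := by
          rw [iteratedFDeriv_comp_const_smul (ε n) (hf.of_le (mod_cast le_top)), norm_smul]
          refine (mul_le_of_le_one_left (norm_nonneg _) ?_).trans ((hB i _).trans_eq ?_)
          · rw [norm_pow, Real.norm_of_nonneg (hε0 n).le]
            exact pow_le_one₀ (hε0 n).le (hε1 n)
          · rw [norm_smul, Real.norm_of_nonneg (hε0 n).le]
        have h3 := SchwartzMap.le_seminorm ℝ (k + 1) (l - i) h x
        calc _ ≤ ‖x‖ ^ k * ((l.choose i : ℝ) * (B i * (ε n * ‖x‖)) * ‖iteratedFDeriv ℝ (l - i) h x‖) := by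
              gcongr
          _ = ε n * ((l.choose i : ℝ) * B i * (‖x‖ ^ (k + 1) * ‖iteratedFDeriv ℝ (l - i) h x‖)) := by
              ring
          _ ≤ _ := by
              have := hB0 i
              have := (hε0 n).le
              gcongr
  have hlim : Filter.Tendsto (fun n => ε n * S) Filter.atTop (nhds 0) := by
    simpa using hε.mul_const S
  filter_upwards [hlim.eventually_lt_const hδ] with n hn
  exact (hbound n).trans_lt hn

open FourierTransform in
theorem tendsto_multiplierOp_comp_smul {m : Rd d → ℂ} (hm : ContDiff ℝ ∞ m)
    (hc : HasCompactSupport m) {r : ℝ} (hr : 0 < r) (h1 : ∀ ξ, ‖ξ‖ < r → m ξ = 1)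
    {ε : ℕ → ℝ} (hε0 : ∀ n, 0 < ε n) (hε1 : ∀ n, ε n ≤ 1)
    (hε : Filter.Tendsto ε Filter.atTop (nhds 0)) (T : 𝓢'(Rd d, ℂ)) (φ : 𝓢(Rd d, ℂ)) :
    Filter.Tendsto (fun n => multiplierOp (fun ξ => m (ε n • ξ)) T φ) Filter.atTop (nhds (T φ)) := by
  simp only [multiplierOp_apply]
  refine (T.continuous.tendsto φ).comp ?_
  have h := tendsto_smulLeftCLM_comp_smul (m := fun ξ => m ((2 * Real.pi) • ξ))
    (hm.comp (contDiff_const_smul _)) (hc.comp_smul (by positivity)) (r := (2 * Real.pi)⁻¹ * r)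
    (by positivity) (fun ξ hξ => h1 _ (by
      rw [norm_smul, Real.norm_of_nonneg (by positivity)]
      rwa [← div_eq_inv_mul, lt_div_iff₀' (by positivity)] at hξ)) hε0 hε1 hε (𝓕⁻ φ)
  have h2 := ((FourierTransform.fourierCLM ℂ 𝓢(Rd d, ℂ)).continuous.tendsto _).comp h
  simp only [smul_comm _ (2 * Real.pi)] at h2 ⊢
  simpa [Function.comp_def] using h2

theorem IsDyadicCutoff.tendsto_sum_apply {ψ : Rd d → ℝ} (hψ : IsDyadicCutoff ψ)
    (T : 𝓢'(Rd d, ℂ)) (φ : 𝓢(Rd d, ℂ)) :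
    Filter.Tendsto (fun n => multiplierOp (fun ξ => ∑ k ∈ Finset.range n, dyadicSymbol ψ k ξ) T φ)
      Filter.atTop (nhds (T φ)) := by
  -- The telescoping identity concerns `range (n + 1)`, hence the shift.
  rw [← Filter.tendsto_add_atTop_iff_nat 1]
  simp only [hψ.sum_dyadicSymbol]
  refine tendsto_multiplierOp_comp_smul (hψ.contDiff_dyadicSymbol 0)
    (hψ.hasCompactSupport_dyadicSymbol 0) one_pos (fun ξ hξ => hψ.dyadicSymbol_zero_eq_one hξ)
    (fun n => by positivity) (fun n => inv_le_one_of_one_le₀ (one_le_pow₀ (by norm_num))) ?_ T φ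
  simp only [← inv_pow]
  exact tendsto_pow_atTop_nhds_zero_of_lt_one (by norm_num) (by norm_num)

/-! ### Moduli of continuity and first moments of dilated kernels -/

/-- Fundamental theorem of calculus on the segment from `x` to `x + y`, integrated in `x`; the
constant is the `L¹` norm of the derivative. -/
theorem exists_lintegral_schwartz_translate_le (K : 𝓢(Rd d, ℂ)) :
    ∃ L : ℝ≥0, ∀ y, ∫⁻ x, ‖K (x + y) - K x‖ₑ ≤ L * ‖y‖ₑ := by
  have hD : Integrable (fderiv ℝ K) := (SchwartzMap.fderivCLM ℝ (Rd d) ℂ K).integrable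
  have hDc : Continuous (fderiv ℝ K) := (SchwartzMap.fderivCLM ℝ (Rd d) ℂ K).continuous
  refine ⟨(∫⁻ x, ‖fderiv ℝ K x‖ₑ).toNNReal, fun y => ?_⟩
  rw [ENNReal.coe_toNNReal hD.2.ne]
  have hpt : ∀ x, ‖K (x + y) - K x‖ₑ ≤ ∫⁻ s in Ioc (0 : ℝ) 1, ‖fderiv ℝ K (x + s • y)‖ₑ * ‖y‖ₑ := by
    intro x
    have hder : ∀ s : ℝ, HasDerivAt (fun s : ℝ => K (x + s • y)) (fderiv ℝ K (x + s • y) y) s := by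
      intro s
      have h1 : HasDerivAt (fun s : ℝ => x + s • y) y s := by
        simpa using ((hasDerivAt_id s).smul_const y).const_add x
      exact (K.differentiable.differentiableAt.hasFDerivAt).comp_hasDerivAt s h1
    have hcont : Continuous fun s : ℝ => fderiv ℝ K (x + s • y) y := by fun_prop
    have h2 := intervalIntegral.integral_eq_sub_of_hasDerivAt (a := 0) (b := 1)
      (fun s _ => hder s) (hcont.intervalIntegrable _ _)
    simp only [one_smul, zero_smul, add_zero] at h2
    rw [← h2, intervalIntegral.integral_of_le zero_le_one]
    refine (enorm_integral_le_lintegral_enorm _).trans (lintegral_mono fun s => ?_)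
    exact ContinuousLinearMap.le_opENorm _ _
  calc ∫⁻ x, ‖K (x + y) - K x‖ₑ
      ≤ ∫⁻ x, ∫⁻ s in Ioc (0 : ℝ) 1, ‖fderiv ℝ K (x + s • y)‖ₑ * ‖y‖ₑ := lintegral_mono hpt
    _ = ∫⁻ s in Ioc (0 : ℝ) 1, ∫⁻ x, ‖fderiv ℝ K (x + s • y)‖ₑ * ‖y‖ₑ := by
        refine lintegral_lintegral_swap (Continuous.aemeasurable ?_)
        simp only [Function.uncurry_def]
        refine ENNReal.continuous_mul_const enorm_ne_top |>.comp ?_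
        fun_prop
    _ = ∫⁻ _ in Ioc (0 : ℝ) 1, (∫⁻ x, ‖fderiv ℝ K x‖ₑ) * ‖y‖ₑ := by
        refine lintegral_congr fun s => ?_
        rw [lintegral_mul_const' _ _ enorm_ne_top,
          lintegral_add_right_eq_self (fun x => ‖fderiv ℝ K x‖ₑ)]
    _ = _ := by simp

theorem kern_comp_smul {r : ℝ} (hr : 0 < r) (m : Rd d → ℂ) (x : Rd d) :
    kern (fun ξ => m (r⁻¹ • ξ)) x = ((r ^ d : ℝ) : ℂ) * kern m (r • x) := by
  have h := kern_evo_comp_smul hr m 0 x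
  rwa [evo_zero, mul_zero, evo_zero] at h

/-- A kernel at frequency `r` has length scale `1/r` and unchanged `L¹` norm, so its modulus of
continuity gains a factor `r`. This supplies the constant `L` of `nq_sum_sq_le`. -/
theorem exists_lintegral_kern_translate_le {m : Rd d → ℂ} (hm : ContDiff ℝ ∞ m)
    (hc : HasCompactSupport m) : ∃ L : ℝ≥0, ∀ r : ℝ, 0 < r → ∀ y,
      ∫⁻ x, ‖kern (fun ξ => m (r⁻¹ • ξ)) (x + y) - kern (fun ξ => m (r⁻¹ • ξ)) x‖ₑ
        ≤ L * ENNReal.ofReal r * ‖y‖ₑ := by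
  obtain ⟨L, hL⟩ := exists_lintegral_schwartz_translate_le (kerS hm hc)
  refine ⟨L, fun r hr y => ?_⟩
  have e : ∀ x, ‖kern (fun ξ => m (r⁻¹ • ξ)) (x + y) - kern (fun ξ => m (r⁻¹ • ξ)) x‖ₑ
      = ENNReal.ofReal (|r| ^ d) * ‖kern m (r • x + r • y) - kern m (r • x)‖ₑ := by
    intro x
    rw [kern_comp_smul hr, kern_comp_smul hr, ← mul_sub, enorm_mul, smul_add, ← ofReal_norm,
      Complex.norm_real, Real.norm_of_nonneg (by positivity), abs_of_pos hr]
  simp only [e]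
  rw [lintegral_const_mul' _ _ ENNReal.ofReal_ne_top,
    ← lintegral_smul_comp hr.ne' (fun x => ‖kern m (x + r • y) - kern m x‖ₑ)]
  have h := hL (r • y)
  simp only [coe_kerS] at h
  refine h.trans_eq ?_
  rw [enorm_smul, mul_assoc, ← ofReal_norm, Real.norm_of_nonneg hr.le]

/-- The same scaling applied to the first moment; this supplies the constant `B` of `nq_sum_sq_le`.
-/
theorem exists_lintegral_kern_mul_norm_le {m : Rd d → ℂ} (hm : ContDiff ℝ ∞ m)
    (hc : HasCompactSupport m) : ∃ B : ℝ≥0, ∀ r : ℝ, 0 < r →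
      ∫⁻ y, ‖kern (fun ξ => m (r⁻¹ • ξ)) y‖ₑ * ‖y‖ₑ ≤ B * ENNReal.ofReal r⁻¹ := by
  have hfin : ∫⁻ y, ‖kern m y‖ₑ * ‖y‖ₑ ≠ ⊤ := by
    have h := ((kerS hm hc).integrable_pow_mul volume 1).2
    rw [hasFiniteIntegral_iff_enorm] at h
    refine (lt_of_le_of_lt (lintegral_congr fun y => ?_).le h).ne
    rw [kerS_apply, pow_one, enorm_mul, enorm_norm, enorm_norm, mul_comm]
  refine ⟨(∫⁻ y, ‖kern m y‖ₑ * ‖y‖ₑ).toNNReal, fun r hr => ?_⟩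
  rw [ENNReal.coe_toNNReal hfin, lintegral_smul_comp hr.ne' (fun y => ‖kern m y‖ₑ * ‖y‖ₑ),
    mul_comm, ← lintegral_const_mul' _ _ ENNReal.ofReal_ne_top,
    ← lintegral_const_mul' _ _ ENNReal.ofReal_ne_top]
  refine (lintegral_congr fun y => ?_).le
  rw [kern_comp_smul hr, enorm_mul, enorm_smul, ← ofReal_norm ((r ^ d : ℝ) : ℂ),
    Complex.norm_real, Real.norm_of_nonneg (by positivity), abs_of_pos hr, ← ofReal_norm r,
    Real.norm_of_nonneg hr.le, mul_left_comm (‖kern m (r • y)‖ₑ), mul_left_comm _ (ENNReal.ofReal r),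
    ← mul_assoc (ENNReal.ofReal r⁻¹), ← ENNReal.ofReal_mul (by positivity), inv_mul_cancel₀ hr.ne',
    ENNReal.ofReal_one, one_mul, mul_assoc]

theorem aestronglyMeasurable_cv {k g : Rd d → ℂ} (hk : Continuous k)
    (hg : AEStronglyMeasurable g volume) : AEStronglyMeasurable (cv k g) volume := by
  refine AEStronglyMeasurable.integral_prod_right' (f := fun v : Rd d × Rd d => k (v.1 - v.2) * g v.2) ?_
  exact (Continuous.aestronglyMeasurable (by fun_prop)).mul hg.comp_snd

theorem memLp_cv_kern {m : Rd d → ℂ} (hm : ContDiff ℝ ∞ m) (hc : HasCompactSupport m) {p q : ℝ}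
    (hp : 1 ≤ p) (hpq : p ≤ q) {g : Rd d → ℂ} (hg : MemLp g (ENNReal.ofReal p) volume) :
    MemLp (cv (kern m) g) (ENNReal.ofReal q) volume := by
  have hp0 : 0 < p := by linarith
  have hqp : 0 ≤ q / p - 1 := by rw [sub_nonneg, le_div_iff₀ hp0]; linarith
  rw [memLp_ofReal_iff (by linarith)]
  rw [memLp_ofReal_iff hp0] at hg
  obtain ⟨W, hW⟩ : ∃ W : ℝ, ∀ x, ‖kern m x‖ ≤ W :=
    ⟨_, fun x => by simpa [evo_zero] using norm_kern_evo_le m 0 x⟩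
  refine ⟨aestronglyMeasurable_cv (continuous_kern hm hc) hg.1, ?_⟩
  have hkt := (integrable_kern hm hc).2.ne
  refine ne_top_of_le_ne_top ?_ ((lintegral_mono fun x => ENNReal.rpow_le_rpow (enorm_cv_le _ _ _)
    (by linarith)).trans (lintegral_conv_rpow_le_of_le (continuous_kern hm hc).measurable.enorm
      hg.1.enorm (W := ENNReal.ofReal W) (fun x => ?_) hp hpq))
  · exact ENNReal.mul_ne_top (ENNReal.mul_ne_top (ENNReal.rpow_ne_top_of_nonneg hqp
      (ENNReal.mul_ne_top (ENNReal.rpow_ne_top_of_nonneg (by linarith) hkt) ENNReal.ofReal_ne_top))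
      (ENNReal.rpow_ne_top_of_nonneg hp0.le hkt)) (ENNReal.rpow_ne_top_of_nonneg (by linarith) hg.2)
  · rw [← ofReal_norm]
    exact ENNReal.ofReal_le_ofReal (hW x)

/-- A difference of translates of a convolution is the convolution with the differenced kernel, to
which Young's inequality applies. -/
theorem nq_cv_sub_le {m : Rd d → ℂ} (hm : ContDiff ℝ ∞ m) (hc : HasCompactSupport m) {q : ℝ}
    (hq : 1 ≤ q) {g : Rd d → ℂ} (hg : MemLp g (ENNReal.ofReal q) volume) (y : Rd d) :
    nq q (fun x => cv (kern m) g (x + y) - cv (kern m) g x)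
      ≤ (∫⁻ x, ‖kern m (x + y) - kern m x‖ₑ) * nq q g := by
  have hk := continuous_kern hm hc
  have e : (fun x => cv (kern m) g (x + y) - cv (kern m) g x)
      = cv (fun x => kern m (x + y) - kern m x) g := by
    ext x
    rw [cv, cv, cv, ← integral_sub (integrable_kern_mul hm hc hq hg _)
      (integrable_kern_mul hm hc hq hg _)]
    congr 1; ext z
    rw [sub_add_eq_add_sub]; ring
  rw [e, nq_eq (by linarith), nq_eq (by linarith), one_div, ENNReal.rpow_inv_le_iff (by linarith),
    ENNReal.mul_rpow_of_nonneg _ _ (by linarith), ENNReal.rpow_inv_rpow (by linarith)]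
  exact lintegral_cv_rpow_le (by fun_prop) hg.1 hq

theorem schrodinger_comm {m : Rd d → ℂ} (hm : TemperateSymbol m) (t : ℝ) (T : 𝓢'(Rd d, ℂ)) :
    multiplierOp m (schrodinger t T) = schrodinger t (multiplierOp m T) := by
  rw [schrodinger, multiplierOp_multiplierOp (temperateSymbol_exp t) hm,
    multiplierOp_multiplierOp hm (temperateSymbol_exp t)]
  exact congrArg (fun m => multiplierOp m T) (funext fun ξ => mul_comm _ _)

/-! ### Frequency localized pieces and the square sum estimate at fixed time -/

/-- A smooth cutoff, equal to `1` for `|ξ| ≤ 2` and to `0` for `|ξ| ≥ 4`. -/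
noncomputable def lowCut (ξ : Rd d) : ℂ :=
  (((⟨2, 4, by norm_num, by norm_num⟩ : ContDiffBump (0 : Rd d)) ξ : ℝ) : ℂ)

theorem contDiff_lowCut : ContDiff ℝ ∞ (lowCut : Rd d → ℂ) :=
  Complex.ofRealCLM.contDiff.comp (ContDiffBump.contDiff _)

theorem hasCompactSupport_lowCut : HasCompactSupport (lowCut : Rd d → ℂ) :=
  (ContDiffBump.hasCompactSupport _).comp_left Complex.ofReal_zero

theorem lowCut_eq_one {ξ : Rd d} (h : ‖ξ‖ ≤ 2) : lowCut ξ = 1 := by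
  rw [lowCut, ContDiffBump.one_of_mem_closedBall _ (by simpa using h), Complex.ofReal_one]

theorem lowCut_eq_zero {ξ : Rd d} (h : 4 ≤ ‖ξ‖) : lowCut ξ = 0 := by
  rw [lowCut, ContDiffBump.zero_of_le_dist _ (by simpa using h), Complex.ofReal_zero]

/-- A smooth cutoff, equal to `1` for `1 / 2 ≤ |ξ| ≤ 2` and vanishing at the origin. -/
noncomputable def annCut (ξ : Rd d) : ℂ := lowCut ξ - lowCut ((8 : ℝ) • ξ)

theorem contDiff_annCut : ContDiff ℝ ∞ (annCut : Rd d → ℂ) :=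
  contDiff_lowCut.sub (contDiff_lowCut.comp (contDiff_const_smul _))

theorem hasCompactSupport_annCut : HasCompactSupport (annCut : Rd d → ℂ) :=
  hasCompactSupport_lowCut.sub (hasCompactSupport_lowCut.comp_smul (by norm_num))

theorem annCut_zero : annCut (0 : Rd d) = 0 := by simp [annCut]

theorem annCut_eq_one {ξ : Rd d} (h1 : 1 / 2 ≤ ‖ξ‖) (h2 : ‖ξ‖ ≤ 2) : annCut ξ = 1 := by
  rw [annCut, lowCut_eq_one h2, lowCut_eq_zero, sub_zero]
  rw [norm_smul, Real.norm_of_nonneg (by norm_num)]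
  linarith

/-- The symbol `m`, dilated to frequency `2 ^ k`. -/
noncomputable def dilated (m : Rd d → ℂ) (k : ℕ) (ξ : Rd d) : ℂ := m (((2 : ℝ) ^ k)⁻¹ • ξ)

theorem contDiff_dilated {m : Rd d → ℂ} (hm : ContDiff ℝ ∞ m) (k : ℕ) :
    ContDiff ℝ ∞ (dilated m k) := hm.comp (contDiff_const_smul _)

theorem hasCompactSupport_dilated {m : Rd d → ℂ} (hc : HasCompactSupport m) (k : ℕ) :
    HasCompactSupport (dilated m k) := hc.comp_smul (by positivity)

/-- The distribution `T` has frequencies of size about `2 ^ k`. -/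
structure FreqLocalized (k : ℕ) (T : 𝓢'(Rd d, ℂ)) : Prop where
  low : multiplierOp (dilated lowCut k) T = T
  ann : 1 ≤ k → multiplierOp (dilated annCut k) T = T

theorem freqLocalized_zero (k : ℕ) : FreqLocalized k (0 : 𝓢'(Rd d, ℂ)) :=
  ⟨map_zero _, fun _ => map_zero _⟩

/-- Each cutoff equals `1` wherever the dyadic symbol is nonzero, so multiplying by it changes
nothing. The annular one is excluded at `k = 0`, whose symbol is `1` at the origin. -/
theorem IsDyadicCutoff.freqLocalized {ψ : Rd d → ℝ} (hψ : IsDyadicCutoff ψ) (k : ℕ)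
    (T : 𝓢'(Rd d, ℂ)) : FreqLocalized k (multiplierOp (dyadicSymbol ψ k) T) := by
  have h1 : TemperateSymbol (dyadicSymbol ψ k) :=
    (hψ.hasCompactSupport_dyadicSymbol k).hasTemperateGrowth (hψ.contDiff_dyadicSymbol k)
  refine ⟨?_, fun hk => ?_⟩
  · rw [multiplierOp_multiplierOp h1 ((hasCompactSupport_dilated hasCompactSupport_lowCut
      k).hasTemperateGrowth (contDiff_dilated contDiff_lowCut k))]
    refine congrArg (fun m => multiplierOp m T) (funext fun ξ => ?_)
    rcases le_or_gt ‖ξ‖ (2 ^ (k + 1)) with h | h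
    · rw [dilated, lowCut_eq_one, mul_one]
      rw [norm_smul, Real.norm_of_nonneg (by positivity), ← div_eq_inv_mul,
        div_le_iff₀ (by positivity), ← pow_succ']
      exact h
    · rw [hψ.dyadicSymbol_eq_zero_of_norm_gt h, zero_mul]
  · rw [multiplierOp_multiplierOp h1 ((hasCompactSupport_dilated hasCompactSupport_annCut
      k).hasTemperateGrowth (contDiff_dilated contDiff_annCut k))]
    refine congrArg (fun m => multiplierOp m T) (funext fun ξ => ?_)
    obtain ⟨k, rfl⟩ : ∃ n, k = n + 1 := ⟨k - 1, by omega⟩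
    rcases lt_or_ge ‖ξ‖ (2 ^ k) with h0 | h0
    · rw [hψ.dyadicSymbol_eq_zero_of_norm_lt h0, zero_mul]
    rcases le_or_gt ‖ξ‖ (2 ^ (k + 1 + 1)) with h | h
    · rw [dilated, annCut_eq_one, mul_one]
      · rw [norm_smul, Real.norm_of_nonneg (by positivity), ← div_eq_inv_mul,
          le_div_iff₀ (by positivity), pow_succ]
        linarith
      · rw [norm_smul, Real.norm_of_nonneg (by positivity), ← div_eq_inv_mul,
          div_le_iff₀ (by positivity), ← pow_succ']
        exact h
    · rw [hψ.dyadicSymbol_eq_zero_of_norm_gt h, zero_mul]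

/-- The Schrödinger evolution of a function of frequency about `2 ^ k`. -/
noncomputable def pieceEvo (k : ℕ) (t : ℝ) (g : Rd d → ℂ) : Rd d → ℂ := cv (kern (evo (dilated lowCut k) t)) g

theorem memLp_pieceEvo {p q : ℝ} (hp : 1 ≤ p) (hpq : p ≤ q) {g : Rd d → ℂ}
    (hg : MemLp g (ENNReal.ofReal p) volume) (k : ℕ) (t : ℝ) :
    MemLp (pieceEvo k t g) (ENNReal.ofReal q) volume :=
  memLp_cv_kern (contDiff_evo (contDiff_dilated contDiff_lowCut k) t)
    (hasCompactSupport_evo (hasCompactSupport_dilated hasCompactSupport_lowCut k) t) hp hpq hg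

theorem FreqLocalized.isRepresentedBy_pieceEvo {p : ℝ} (hp : 1 ≤ p) {g : Rd d → ℂ}
    (hg : MemLp g (ENNReal.ofReal p) volume) {k : ℕ} {T : 𝓢'(Rd d, ℂ)} (hT : FreqLocalized k T)
    (hTg : IsRepresentedBy T g) (t : ℝ) : IsRepresentedBy (schrodinger t T) (pieceEvo k t g) := by
  have hm := contDiff_dilated (d := d) contDiff_lowCut k
  have hc := hasCompactSupport_dilated (d := d) hasCompactSupport_lowCut k
  rw [← hT.low, schrodinger_multiplierOp (hc.hasTemperateGrowth hm)]
  exact hTg.multiplierOp (contDiff_evo hm t) (hasCompactSupport_evo hc t) hp hg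

/-- A function that represents a distribution reproduced by a multiplier is reproduced by the
corresponding convolution. -/
theorem IsRepresentedBy.ae_eq_cv {q : ℝ} (hq : 1 ≤ q) {W : Rd d → ℂ}
    (hW : MemLp W (ENNReal.ofReal q) volume) {T : 𝓢'(Rd d, ℂ)} (hTW : IsRepresentedBy T W)
    {m : Rd d → ℂ} (hm : ContDiff ℝ ∞ m) (hc : HasCompactSupport m)
    (hT : _root_.multiplierOp m T = T) : W =ᵐ[volume] cv (kern m) W := by
  have h1 : (1 : ℝ≥0∞) ≤ ENNReal.ofReal q := by rwa [ENNReal.one_le_ofReal]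
  have h2 := hTW.multiplierOp hm hc hq hW
  rw [hT] at h2
  exact hTW.ae_eq h2 (hW.locallyIntegrable h1)
    ((memLp_cv_kern hm hc hq le_rfl hW).locallyIntegrable h1)

/-- The square function estimate for a sum of evolutions, at a fixed time. -/
theorem exists_nq_sum_pieceEvo_sq_le {p q : ℝ} (hp : 1 ≤ p) (hpq : p ≤ q) (hq : 2 ≤ q) :
    ∃ C : ℝ≥0, ∀ (g : ℕ → Rd d → ℂ) (T : ℕ → 𝓢'(Rd d, ℂ)) (t : ℝ),
      (∀ k, MemLp (g k) (ENNReal.ofReal p) volume) → (∀ k, IsRepresentedBy (T k) (g k)) →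
      (∀ k, FreqLocalized k (T k)) → ∀ N,
      nq q (∑ k ∈ Finset.range N, pieceEvo k t (g k)) ^ 2
        ≤ C * ∑ k ∈ Finset.range N, nq q (pieceEvo k t (g k)) ^ 2 := by
  have hq1 : 1 ≤ q := by linarith
  obtain ⟨L, hL⟩ := exists_lintegral_kern_translate_le (d := d) contDiff_lowCut
    hasCompactSupport_lowCut
  obtain ⟨B, hB⟩ := exists_lintegral_kern_mul_norm_le (d := d) contDiff_annCut
    hasCompactSupport_annCut
  obtain ⟨C, hC⟩ := nq_sum_sq_le (d := d) hq L B
  refine ⟨C, fun g T t hg hTg hT N => ?_⟩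
  have hW : ∀ k, MemLp (pieceEvo k t (g k)) (ENNReal.ofReal q) volume := fun k =>
    memLp_pieceEvo hp hpq (hg k) k t
  have hrep : ∀ k, IsRepresentedBy (schrodinger t (T k)) (pieceEvo k t (g k)) := fun k =>
    (hT k).isRepresentedBy_pieceEvo hp (hg k) (hTg k) t
  -- Two reproducing kernels are in play. The annular one has mean zero, because `annCut` vanishes
  -- at the origin, and provides cancellation for `k ≥ 1`; the low-pass one provides the modulus of
  -- continuity for every `k`.
  refine hC (fun k => pieceEvo k t (g k)) (fun k => kern (dilated annCut k)) hW ?_ ?_ N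
  · intro k hk
    have hm := contDiff_dilated (d := d) contDiff_annCut k
    have hc := hasCompactSupport_dilated (d := d) hasCompactSupport_annCut k
    refine ⟨integrable_kern hm hc, ?_, ?_, ?_⟩
    · rw [integral_kern hm hc, dilated, smul_zero, annCut_zero]
    · refine (hrep k).ae_eq_cv hq1 (hW k) hm hc ?_
      rw [schrodinger_comm (hc.hasTemperateGrowth hm), (hT k).ann hk]
    · refine (hB (2 ^ k) (by positivity)).trans_eq ?_
      rw [ENNReal.ofReal_inv_of_pos (by positivity), ENNReal.ofReal_pow (by norm_num),
        ENNReal.inv_pow]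
      simp
  · intro k y
    have hm := contDiff_dilated (d := d) contDiff_lowCut k
    have hc := hasCompactSupport_dilated (d := d) hasCompactSupport_lowCut k
    have hae : pieceEvo k t (g k) =ᵐ[volume] cv (kern (dilated lowCut k)) (pieceEvo k t (g k)) := by
      refine (hrep k).ae_eq_cv hq1 (hW k) hm hc ?_
      rw [schrodinger_comm (hc.hasTemperateGrowth hm), (hT k).low]
    have hae' : (fun x => pieceEvo k t (g k) (x + y) - pieceEvo k t (g k) x) =ᵐ[volume]
        fun x => cv (kern (dilated lowCut k)) (pieceEvo k t (g k)) (x + y)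
          - cv (kern (dilated lowCut k)) (pieceEvo k t (g k)) x := by
      have h1 := (measurePreserving_add_right volume y).quasiMeasurePreserving.ae_eq_comp hae
      filter_upwards [hae, h1] with x hx hx1
      rw [← hx]
      exact congrArg (· - _) hx1
    rw [nq, eLpNorm_congr_ae hae']
    refine (nq_cv_sub_le hm hc hq1 (hW k) y).trans ?_
    gcongr
    refine (hL (2 ^ k) (by positivity) y).trans_eq ?_
    rw [ENNReal.ofReal_pow (by norm_num)]
    simp

/-! ### Summation over frequencies in space-time -/

/-- Minkowski's inequality for finite sums. -/
theorem lintegral_Lp_sum_le {α : Type*} [MeasurableSpace α] {μ : Measure α} {r : ℝ} (hr : 1 ≤ r)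
    {A : ℕ → α → ℝ≥0∞} (hA : ∀ k, AEMeasurable (A k) μ) (N : ℕ) :
    (∫⁻ t, (∑ k ∈ Finset.range N, A k t) ^ r ∂μ) ^ (1 / r)
      ≤ ∑ k ∈ Finset.range N, (∫⁻ t, A k t ^ r ∂μ) ^ (1 / r) := by
  have hr0 : 0 < r := by linarith
  induction N with
  | zero => simp [hr0]
  | succ N ih =>
    simp only [Finset.sum_range_succ]
    refine le_trans ?_ (add_le_add_left ih _)
    exact ENNReal.lintegral_Lp_add_le (f := fun t => ∑ k ∈ Finset.range N, A k t) (g := A N)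
      (Finset.aemeasurable_fun_sum _ fun k _ => hA k) (hA N) hr

theorem aestronglyMeasurable_pieceEvo {g : Rd d → ℂ} (hg : AEStronglyMeasurable g volume) (k : ℕ)
    (μ : Measure (Rd d × ℝ)) [SFinite μ] :
    AEStronglyMeasurable (fun v : Rd d × ℝ => pieceEvo k v.2 g v.1) μ :=
  aestronglyMeasurable_cv_kern_evo (contDiff_dilated contDiff_lowCut k)
    (hasCompactSupport_dilated hasCompactSupport_lowCut k) hg μ

/-- The space-time estimate for a single frequency. -/
theorem AdjointRestriction.exists_lintegral_pieceEvo_le {p q : ℝ} (hd : 1 ≤ d) (hp : 2 ≤ p)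
    (hpq : p ≤ q) (h : AdjointRestriction d p q) (a b : ℝ) :
    ∃ C : ℝ≥0∞, C ≠ ⊤ ∧ ∀ (k : ℕ) (g : Rd d → ℂ), MemLp g (ENNReal.ofReal p) volume →
      ∫⁻ t in Icc a b, ∫⁻ x, ‖pieceEvo k t g x‖ₑ ^ q
        ≤ C * ((2 : ℝ≥0∞) ^ ((k : ℝ) * (d * (1 - 1 / p - 1 / q) - 2 / q)) * nq p g) ^ q := by
  have hp0 : 0 < p := by linarith
  have hq0 : 0 < q := by linarith
  obtain ⟨C, hCt, hC⟩ := h.lintegral_cv_comp_smul_le hd hp hpq contDiff_lowCut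
    hasCompactSupport_lowCut (T := max 1 (max |a| |b|)) (le_max_left _ _)
  refine ⟨C, hCt, fun k g hg => ?_⟩
  refine (lintegral_mono_set (Icc_subset_Icc ?_ ?_)).trans
    ((hC (2 ^ k) (one_le_pow₀ (by norm_num)) g hg).trans_eq ?_)
  · exact neg_le.1 ((neg_le_abs a).trans ((le_max_left _ _).trans (le_max_right _ _)))
  · exact (le_abs_self b).trans ((le_max_right _ _).trans (le_max_right _ _))
  · rw [ENNReal.mul_rpow_of_nonneg _ _ hq0.le, nq, eLpNorm_ofReal_eq hp0, ← ENNReal.rpow_mul,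
      ← ENNReal.rpow_mul, one_div_mul_eq_div, mul_assoc]
    congr 2
    rw [← Real.rpow_natCast, ← Real.rpow_mul (by norm_num), ← ENNReal.ofReal_rpow_of_pos (by norm_num),
      ENNReal.ofReal_ofNat]
    congr 1; ring

/-- The space-time estimate for sums of frequency localized evolutions. -/
theorem AdjointRestriction.exists_eLpNorm_sum_pieceEvo_le {p q : ℝ} (hd : 1 ≤ d) (hp : 2 ≤ p)
    (hpq : p ≤ q) (h : AdjointRestriction d p q) (a b : ℝ) :
    ∃ C : ℝ≥0∞, C ≠ ⊤ ∧ ∀ (g : ℕ → Rd d → ℂ) (T : ℕ → 𝓢'(Rd d, ℂ)),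
      (∀ k, MemLp (g k) (ENNReal.ofReal p) volume) → (∀ k, IsRepresentedBy (T k) (g k)) →
      (∀ k, FreqLocalized k (T k)) → ∀ N,
      eLpNorm (fun v : Rd d × ℝ => ∑ k ∈ Finset.range N, pieceEvo k v.2 (g k) v.1)
        (ENNReal.ofReal q) (volume.prod (volume.restrict (Icc a b))) ^ 2
      ≤ C * ∑ k ∈ Finset.range N,
        ((2 : ℝ≥0∞) ^ ((k : ℝ) * (d * (1 - 1 / p - 1 / q) - 2 / q)) * nq p (g k)) ^ 2 := by
  have hq0 : 0 < q := by linarith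
  have hq2 : 1 ≤ q / 2 := by linarith
  obtain ⟨C₁, hC₁⟩ := exists_nq_sum_pieceEvo_sq_le (d := d) (by linarith : 1 ≤ p) hpq (by linarith)
  obtain ⟨C₂, hC₂t, hC₂⟩ := h.exists_lintegral_pieceEvo_le hd hp hpq a b
  set α : ℝ := d * (1 - 1 / p - 1 / q) - 2 / q with hα
  refine ⟨C₁ * C₂ ^ (2 / q), ENNReal.mul_ne_top ENNReal.coe_ne_top
    (ENNReal.rpow_ne_top_of_nonneg (by positivity) hC₂t), fun g T hg hTg hT N => ?_⟩
  set μ : Measure ℝ := volume.restrict (Icc a b) with hμ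
  -- The square sum estimate holds at each `t`; Minkowski in `L^(q/2)` of time, which needs `q ≥ 2`,
  -- transfers it to the space-time norms of the pieces.
  set A : ℕ → ℝ → ℝ≥0∞ := fun k t => nq q (pieceEvo k t (g k)) ^ 2 with hA
  have hm : ∀ k, AEStronglyMeasurable (fun v : Rd d × ℝ => pieceEvo k v.2 (g k) v.1)
      (volume.prod μ) := fun k => aestronglyMeasurable_pieceEvo (hg k).1 k _
  have hAq : ∀ k t, A k t ^ (q / 2) = ∫⁻ x, ‖pieceEvo k t (g k) x‖ₑ ^ q := by
    intro k t
    simp only [hA]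
    rw [← ENNReal.rpow_ofNat, ← ENNReal.rpow_mul, nq_eq hq0, ← ENNReal.rpow_mul]
    have : 1 / q * ((OfNat.ofNat 2 : ℝ) * (q / 2)) = 1 := by
      field_simp
    rw [this, ENNReal.rpow_one]
  have hAm : ∀ k, AEMeasurable (A k) μ := by
    intro k
    have h1 : AEMeasurable (fun t => ∫⁻ x, ‖pieceEvo k t (g k) x‖ₑ ^ q) μ :=
      ((hm k).enorm.pow_const q).prod_swap.lintegral_prod_right'
    have h2 : A k = fun t => (∫⁻ x, ‖pieceEvo k t (g k) x‖ₑ ^ q) ^ (2 / q) := by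
      ext t
      rw [← hAq, ← ENNReal.rpow_mul]
      have : q / 2 * (2 / q) = 1 := by field_simp
      rw [this, ENNReal.rpow_one]
    rw [h2]
    exact h1.pow_const _
  have hsum : AEStronglyMeasurable
      (fun v : Rd d × ℝ => ∑ k ∈ Finset.range N, pieceEvo k v.2 (g k) v.1) (volume.prod μ) :=
    Finset.aestronglyMeasurable_fun_sum _ fun k _ => hm k
  have hL : ∫⁻ v : Rd d × ℝ, ‖∑ k ∈ Finset.range N, pieceEvo k v.2 (g k) v.1‖ₑ ^ q ∂(volume.prod μ)
      ≤ (C₁ : ℝ≥0∞) ^ (q / 2) * ∫⁻ t, (∑ k ∈ Finset.range N, A k t) ^ (q / 2) ∂μ := by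
    rw [lintegral_prod_symm _ (hsum.enorm.pow_const q), ← lintegral_const_mul' _ _
      (ENNReal.rpow_ne_top_of_nonneg (by positivity) ENNReal.coe_ne_top)]
    refine lintegral_mono fun t => ?_
    rw [← ENNReal.mul_rpow_of_nonneg _ _ (by positivity)]
    have h1 := ENNReal.rpow_le_rpow (hC₁ g T t hg hTg hT N) (by positivity : 0 ≤ q / 2)
    refine le_of_eq_of_le ?_ h1
    rw [← ENNReal.rpow_ofNat, ← ENNReal.rpow_mul, nq_eq hq0, ← ENNReal.rpow_mul]
    have : 1 / q * ((OfNat.ofNat 2 : ℝ) * (q / 2)) = 1 := by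
      field_simp
    rw [this, ENNReal.rpow_one]
    refine lintegral_congr fun x => ?_
    rw [Finset.sum_apply]
  rw [eLpNorm_ofReal_eq hq0, ← ENNReal.rpow_ofNat, ← ENNReal.rpow_mul]
  have e1 : 1 / q * (OfNat.ofNat 2 : ℝ) = 2 / q := by
    rw [one_div_mul_eq_div]
  rw [e1]
  calc _ ≤ ((C₁ : ℝ≥0∞) ^ (q / 2) * ∫⁻ t, (∑ k ∈ Finset.range N, A k t) ^ (q / 2) ∂μ) ^ (2 / q) :=
        ENNReal.rpow_le_rpow hL (by positivity)
    _ = C₁ * (∫⁻ t, (∑ k ∈ Finset.range N, A k t) ^ (q / 2) ∂μ) ^ (1 / (q / 2)) := by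
        rw [ENNReal.mul_rpow_of_nonneg _ _ (by positivity), ← ENNReal.rpow_mul]
        have : q / 2 * (2 / q) = 1 := by field_simp
        rw [this, ENNReal.rpow_one, one_div_div]
    _ ≤ C₁ * ∑ k ∈ Finset.range N, (∫⁻ t, A k t ^ (q / 2) ∂μ) ^ (1 / (q / 2)) := by
        gcongr
        exact lintegral_Lp_sum_le hq2 hAm N
    _ ≤ C₁ * ∑ k ∈ Finset.range N, (C₂ * ((2 : ℝ≥0∞) ^ ((k : ℝ) * α) * nq p (g k)) ^ q) ^ (2 / q) := by
        gcongr with k hk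
        rw [one_div_div]
        refine ENNReal.rpow_le_rpow ?_ (by positivity)
        simp only [hAq]
        exact hC₂ k (g k) (hg k)
    _ = _ := by
        rw [mul_assoc, Finset.mul_sum (s := Finset.range N) (a := C₂ ^ (2 / q))]
        congr 1
        refine Finset.sum_congr rfl fun k _ => ?_
        rw [ENNReal.mul_rpow_of_nonneg _ _ (by positivity), ← ENNReal.rpow_mul]
        have : q * (2 / q) = 2 := by field_simp
        rw [this, ENNReal.rpow_ofNat]

/-! ### Passage to the limit and the smoothing estimate -/

theorem integrable_schwartz_mul {q : ℝ} (hq : 1 < q) (φ : 𝓢(Rd d, ℂ)) {G : Rd d → ℂ}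
    (hG : MemLp G (ENNReal.ofReal q) volume) : Integrable fun x => φ x * G x := by
  have : ENNReal.HolderConjugate (ENNReal.ofReal q.conjExponent) (ENNReal.ofReal q) :=
    (Real.HolderConjugate.conjExponent hq).symm.ennrealOfReal
  exact MemLp.integrable_mul (φ.memLp (ENNReal.ofReal q.conjExponent) volume) hG

/-- Limits of distributions that are represented by an `L^q` convergent sequence. -/
theorem isRepresentedBy_of_tendsto {q : ℝ} (hq : 1 < q) {T : ℕ → 𝓢'(Rd d, ℂ)} {S : 𝓢'(Rd d, ℂ)}
    (hTS : ∀ φ, Filter.Tendsto (fun j => T j φ) Filter.atTop (nhds (S φ))) {F : ℕ → Rd d → ℂ}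
    (hF : ∀ j, MemLp (F j) (ENNReal.ofReal q) volume) (hTF : ∀ j, IsRepresentedBy (T j) (F j))
    {u : Rd d → ℂ} (hu : MemLp u (ENNReal.ofReal q) volume)
    (hlim : Filter.Tendsto (fun j => ∫⁻ x, ‖F j x - u x‖ₑ ^ q) Filter.atTop (nhds 0)) :
    IsRepresentedBy S u := by
  intro φ
  have hq0 : 0 < q := by linarith
  have hconj : (q.conjExponent).HolderConjugate q := (Real.HolderConjugate.conjExponent hq).symm
  have hint := fun G hG => integrable_schwartz_mul hq φ (G := G) hG
  refine ⟨hint u hu, ?_⟩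
  refine tendsto_nhds_unique (hTS φ) ?_
  simp only [fun j => (hTF j φ).2]
  rw [tendsto_iff_enorm_sub_tendsto_zero]
  set A : ℝ≥0∞ := (∫⁻ x, ‖φ x‖ₑ ^ q.conjExponent) ^ (1 / q.conjExponent) with hA
  have hAt : A ≠ ⊤ := by
    have h1 := (φ.memLp (ENNReal.ofReal q.conjExponent) volume).2
    rw [eLpNorm_ofReal_eq hconj.pos] at h1
    exact h1.ne
  have hle : ∀ j, ‖(∫ x, φ x * F j x) - ∫ x, φ x * u x‖ₑ
      ≤ A * (∫⁻ x, ‖F j x - u x‖ₑ ^ q) ^ (1 / q) := by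
    intro j
    rw [← integral_sub (hint _ (hF j)) (hint u hu)]
    refine (enorm_integral_le_lintegral_enorm _).trans ?_
    refine le_trans (le_of_eq (lintegral_congr fun x => ?_)) (ENNReal.lintegral_mul_le_Lp_mul_Lq _ hconj
      (f := fun x => ‖φ x‖ₑ) (g := fun x => ‖F j x - u x‖ₑ)
      φ.continuous.aestronglyMeasurable.enorm ((hF j).1.sub hu.1).enorm)
    rw [← mul_sub, enorm_mul]
    rfl
  refine tendsto_of_tendsto_of_tendsto_of_le_of_le tendsto_const_nhds ?_ (fun j => zero_le) hle
  have h2 := ((ENNReal.continuous_rpow_const (y := 1 / q)).tendsto 0).comp hlim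
  rw [ENNReal.zero_rpow_of_pos (by positivity)] at h2
  simpa using ENNReal.Tendsto.const_mul h2 (Or.inr hAt)

/-- The embedding `ℓ^ν ⊂ ℓ²` with norm `1`; this is where `ν ≤ 2` enters. -/
theorem tsum_sq_le_tsum_rpow {ν : ℝ} (hν : 0 < ν) (hν2 : ν ≤ 2) (b : ℕ → ℝ≥0∞) :
    ∑' k, b k ^ 2 ≤ ((∑' k, b k ^ ν) ^ (1 / ν)) ^ 2 := by
  set S := ∑' k, b k ^ ν with hS
  have h2ν : 0 ≤ 2 / ν - 1 := by rw [sub_nonneg, le_div_iff₀ hν]; linarith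
  have hpt : ∀ k, b k ^ 2 ≤ S ^ (2 / ν - 1) * b k ^ ν := by
    intro k
    have h1 : b k ^ ν ≤ S := ENNReal.le_tsum k
    calc b k ^ 2 = (b k ^ ν) ^ (2 / ν - 1) * b k ^ ν := by
          nth_rewrite 2 [← ENNReal.rpow_one (b k ^ ν)]
          rw [← ENNReal.rpow_add_of_nonneg _ _ h2ν zero_le_one, ← ENNReal.rpow_mul]
          have : ν * (2 / ν - 1 + 1) = 2 := by field_simp; ring
          rw [this, ENNReal.rpow_ofNat]
      _ ≤ _ := by gcongr
  calc ∑' k, b k ^ 2 ≤ ∑' k, S ^ (2 / ν - 1) * b k ^ ν := ENNReal.tsum_le_tsum hpt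
    _ = S ^ (2 / ν - 1) * S := by rw [ENNReal.tsum_mul_left]
    _ = _ := by
      nth_rewrite 2 [← ENNReal.rpow_one S]
      rw [← ENNReal.rpow_add_of_nonneg _ _ h2ν zero_le_one, ← ENNReal.rpow_ofNat, ← ENNReal.rpow_mul]
      congr 1; simp; ring

theorem pieceEvo_zero (k : ℕ) (t : ℝ) : pieceEvo k t (0 : Rd d → ℂ) = 0 := by
  ext x
  simp [pieceEvo, cv]

/-- The estimate for a tail of the dyadic decomposition. -/
theorem AdjointRestriction.exists_eLpNorm_sub_le {p q : ℝ} (hd : 1 ≤ d) (hp : 2 ≤ p)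
    (hpq : p ≤ q) (h : AdjointRestriction d p q) (a b : ℝ) :
    ∃ C : ℝ≥0∞, C ≠ ⊤ ∧ ∀ (g : ℕ → Rd d → ℂ) (T : ℕ → 𝓢'(Rd d, ℂ)),
      (∀ k, MemLp (g k) (ENNReal.ofReal p) volume) → (∀ k, IsRepresentedBy (T k) (g k)) →
      (∀ k, FreqLocalized k (T k)) → ∀ M N, M ≤ N →
      eLpNorm ((fun v : Rd d × ℝ => ∑ k ∈ Finset.range N, pieceEvo k v.2 (g k) v.1)
          - fun v : Rd d × ℝ => ∑ k ∈ Finset.range M, pieceEvo k v.2 (g k) v.1)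
        (ENNReal.ofReal q) (volume.prod (volume.restrict (Icc a b)))
      ≤ C * (∑' k : ℕ,
        ((2 : ℝ≥0∞) ^ (((k + M : ℕ) : ℝ) * (d * (1 - 1 / p - 1 / q) - 2 / q))
          * nq p (g (k + M))) ^ 2) ^ (1 / 2 : ℝ) := by
  obtain ⟨C, hCt, hC⟩ := h.exists_eLpNorm_sum_pieceEvo_le hd hp hpq a b
  set α : ℝ := d * (1 - 1 / p - 1 / q) - 2 / q with hα
  refine ⟨C ^ (1 / 2 : ℝ), ENNReal.rpow_ne_top_of_nonneg (by norm_num) hCt,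
    fun g T hg hTg hT M N hMN => ?_⟩
  rw [← ENNReal.mul_rpow_of_nonneg _ _ (by norm_num), one_div, ENNReal.le_rpow_inv_iff (by norm_num),
    ENNReal.rpow_ofNat]
  have h0 : IsRepresentedBy (0 : 𝓢'(Rd d, ℂ)) (0 : Rd d → ℂ) := fun φ => by
    simp only [Pi.zero_apply, mul_zero, integral_zero]
    exact ⟨integrable_zero _ _ _, rfl⟩
  -- The tail is treated as a full sum whose first `M` data are zero; zero satisfies every
  -- localization condition.
  have h1 := hC (fun k => if M ≤ k then g k else 0) (fun k => if M ≤ k then T k else 0)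
    (fun k => by split_ifs; exacts [hg k, MemLp.zero])
    (fun k => by split_ifs; exacts [hTg k, h0])
    (fun k => by split_ifs; exacts [hT k, freqLocalized_zero k]) N
  have e1 : ((fun v : Rd d × ℝ => ∑ k ∈ Finset.range N, pieceEvo k v.2 (g k) v.1)
          - fun v : Rd d × ℝ => ∑ k ∈ Finset.range M, pieceEvo k v.2 (g k) v.1)
      = fun v : Rd d × ℝ => ∑ k ∈ Finset.range N, pieceEvo k v.2 (if M ≤ k then g k else 0) v.1 := by
    ext v
    have hz : ∑ k ∈ Finset.range M, pieceEvo k v.2 (if M ≤ k then g k else 0) v.1 = 0 := by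
      refine Finset.sum_eq_zero fun k hk => ?_
      rw [if_neg (by simpa using hk), pieceEvo_zero]
      rfl
    rw [Pi.sub_apply, ← Finset.sum_range_add_sum_Ico _ hMN, add_sub_cancel_left,
      ← Finset.sum_range_add_sum_Ico _ hMN, hz, zero_add]
    refine Finset.sum_congr rfl fun k hk => ?_
    rw [if_pos (Finset.mem_Ico.1 hk).1]
  rw [e1]
  refine h1.trans ?_
  gcongr
  rw [← Finset.sum_range_add_sum_Ico _ hMN, Finset.sum_eq_zero, zero_add, Finset.sum_Ico_eq_sum_range]
  · refine le_trans (Finset.sum_le_sum fun k _ => ?_) (ENNReal.sum_le_tsum (Finset.range (N - M)))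
    rw [if_pos (by omega), add_comm M k]
  · intro k hk
    rw [if_neg (by simpa using hk), nq, eLpNorm_zero, mul_zero, zero_pow two_ne_zero]

/-- The adjoint restriction estimate implies the smoothing estimate for the Schrödinger
propagator. -/
theorem AdjointRestriction.schrodingerBounded {p q : ℝ} (hd : 1 ≤ d) (hp : 2 ≤ p)
    (hpq : p ≤ q) (h : AdjointRestriction d p q) {ν : ℝ} (hν : 0 < ν) (hν2 : ν ≤ 2) (a b : ℝ)
    {ψ : Rd d → ℝ} (hψ : IsDyadicCutoff ψ) :
    SchrodingerBounded d ψ p q (d * (1 - 1 / p - 1 / q) - 2 / q) ν a b := by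
  have hp0 : 0 < p := by linarith
  have hp1 : 1 ≤ p := by linarith
  have hq0 : 0 < q := by linarith
  have hq1 : (1 : ℝ≥0∞) ≤ ENNReal.ofReal q := one_le_ofReal_of_two_le (by linarith)
  obtain ⟨C, hCt, hC⟩ := h.exists_eLpNorm_sub_le hd hp hpq a b
  set α : ℝ := d * (1 - 1 / p - 1 / q) - 2 / q with hα
  refine ⟨C.toNNReal, fun f hf => ?_⟩
  rw [ENNReal.coe_toNNReal hCt]
  set μ : Measure (Rd d × ℝ) := volume.prod (volume.restrict (Icc a b)) with hμ
  set P : ℕ → 𝓢'(Rd d, ℂ) := fun k => multiplierOp (dyadicSymbol ψ k) f with hP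
  set β : ℕ → ℝ≥0∞ := fun k => (2 : ℝ≥0∞) ^ ((k : ℝ) * α) * distLpNorm p (P k) with hβ
  have hbes : besovNorm ψ p α ν f = (∑' k, β k ^ ν) ^ (1 / ν) := by
    rw [besovNorm]
    congr 1
    refine tsum_congr fun k => ?_
    simp only [hβ]
    rw [ENNReal.mul_rpow_of_nonneg _ _ hν.le, ← ENNReal.rpow_mul]
  have hβν : ∑' k, β k ^ ν ≠ ⊤ := by
    intro hcon
    rw [hbes, hcon, ENNReal.top_rpow_of_pos (by positivity)] at hf
    exact lt_irrefl _ hf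
  have hβt : ∀ k, β k ≠ ⊤ := by
    intro k hcon
    refine hβν (top_le_iff.1 (le_trans ?_ (ENNReal.le_tsum k)))
    rw [hcon, ENNReal.top_rpow_of_pos hν]
  have hDt : ∀ k, distLpNorm p (P k) ≠ ⊤ := by
    intro k hcon
    apply hβt k
    simp only [hβ]
    rw [hcon, ENNReal.mul_top]
    exact (ENNReal.rpow_pos (by norm_num) (by norm_num)).ne'
  choose g hg hPg using fun k => exists_of_distLpNorm_ne_top (hDt k)
  have hloc : ∀ k, FreqLocalized k (P k) := fun k => hψ.freqLocalized k f
  have hnq : ∀ k : ℕ, (2 : ℝ≥0∞) ^ ((k : ℝ) * α) * nq p (g k) = β k := fun k => by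
    simp only [hβ]
    rw [distLpNorm_eq hp1 (hg k) (hPg k), nq]
  set Q : ℝ≥0∞ := ∑' k, β k ^ 2 with hQ
  have hQle : Q ≤ besovNorm ψ p α ν f ^ 2 := by
    rw [hbes]; exact tsum_sq_le_tsum_rpow hν hν2 β
  have hQt : Q ≠ ⊤ := ne_top_of_le_ne_top (ENNReal.pow_ne_top hf.ne) hQle
  set F : ℕ → Rd d × ℝ → ℂ := fun n v => ∑ k ∈ Finset.range n, pieceEvo k v.2 (g k) v.1 with hF
  set R : ℕ → ℝ≥0∞ := fun M => C * (∑' k, β (k + M) ^ 2) ^ (1 / 2 : ℝ) with hR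
  have hdiff : ∀ M N, M ≤ N → eLpNorm (F N - F M) (ENNReal.ofReal q) μ ≤ R M := by
    intro M N hMN
    have h1 := hC g P hg hPg hloc M N hMN
    simp only [hnq] at h1
    exact h1
  have hR0 : Filter.Tendsto R Filter.atTop (nhds 0) := by
    have h1 := ((ENNReal.continuous_rpow_const (y := (1 / 2 : ℝ))).tendsto 0).comp
      (ENNReal.tendsto_sum_nat_add (fun k => β k ^ 2) hQt)
    rw [ENNReal.zero_rpow_of_pos (by norm_num)] at h1
    simpa [hR] using ENNReal.Tendsto.const_mul h1 (Or.inr hCt)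
  have hFm : ∀ n, AEStronglyMeasurable (F n) μ := fun n =>
    Finset.aestronglyMeasurable_fun_sum _ fun k _ => aestronglyMeasurable_pieceEvo (hg k).1 k _
  have hF0 : F 0 = 0 := by ext v; simp [hF]
  have hFle : ∀ n, eLpNorm (F n) (ENNReal.ofReal q) μ ≤ C * Q ^ (1 / 2 : ℝ) := by
    intro n
    have h1 := hdiff 0 n (Nat.zero_le n)
    rw [hF0, sub_zero] at h1
    exact h1
  have hFL : ∀ n, MemLp (F n) (ENNReal.ofReal q) μ := fun n => ⟨hFm n, (hFle n).trans_lt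
    (ENNReal.mul_ne_top hCt (ENNReal.rpow_ne_top_of_nonneg (by norm_num) hQt)).lt_top⟩
  -- A subsequence along which the tails decay geometrically, so that the errors are summable in
  -- `j`.
  obtain ⟨n, hn, hnR⟩ := Filter.extraction_forall_of_eventually (P := fun j k =>
    R k < (2⁻¹ : ℝ≥0∞) ^ j) fun j => hR0.eventually_lt_const
      (pos_iff_ne_zero.2 (pow_ne_zero _ (by norm_num)))
  have hcau1 : ∀ i j, i ≤ j → eLpNorm (F (n j) - F (n i)) (ENNReal.ofReal q) μ < (2⁻¹ : ℝ≥0∞) ^ i :=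
    fun i j hij => (hdiff _ _ (hn.monotone hij)).trans_lt (hnR i)
  have hpow : ∀ i j, i ≤ j → (2⁻¹ : ℝ≥0∞) ^ j ≤ (2⁻¹ : ℝ≥0∞) ^ i := fun i j hij =>
    pow_le_pow_right_of_le_one' (by norm_num) hij
  have hgeo : ∑' j : ℕ, (2⁻¹ : ℝ≥0∞) ^ j ≠ ⊤ := by
    rw [ENNReal.tsum_geometric]
    norm_num
  obtain ⟨u', hu', hlim'⟩ := Lp.cauchy_complete_eLpNorm hq1 (fun j => hFL (n j)) hgeo (by
    intro N i j hi hj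
    rcases le_total i j with hij | hij
    · rw [eLpNorm_sub_comm]
      exact (hcau1 i j hij).trans_le (hpow _ _ hi)
    · exact (hcau1 j i hij).trans_le (hpow _ _ hj))
  -- A strongly measurable representative is chosen so that every time slice of `u` is measurable.
  obtain ⟨u, hum, hu, hlim⟩ : ∃ u, StronglyMeasurable u ∧ MemLp u (ENNReal.ofReal q) μ ∧
      Filter.Tendsto (fun j => eLpNorm (F (n j) - u) (ENNReal.ofReal q) μ) Filter.atTop (nhds 0) := by
    refine ⟨hu'.1.mk u', hu'.1.stronglyMeasurable_mk, hu'.ae_eq hu'.1.ae_eq_mk, ?_⟩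
    refine hlim'.congr fun j => eLpNorm_congr_ae ?_
    filter_upwards [hu'.1.ae_eq_mk] with v hv
    simp [hv]
  have hrate : ∀ j, eLpNorm (F (n j) - u) (ENNReal.ofReal q) μ ≤ (2⁻¹ : ℝ≥0∞) ^ j := by
    intro j
    have h1 : Filter.Tendsto (fun i => (2⁻¹ : ℝ≥0∞) ^ j + eLpNorm (F (n i) - u) (ENNReal.ofReal q) μ)
        Filter.atTop (nhds ((2⁻¹ : ℝ≥0∞) ^ j + 0)) := hlim.const_add _
    rw [add_zero] at h1
    refine ge_of_tendsto h1 ?_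
    filter_upwards [Filter.eventually_ge_atTop j] with i hi
    calc _ = eLpNorm ((F (n j) - F (n i)) + (F (n i) - u)) (ENNReal.ofReal q) μ := by
          rw [sub_add_sub_cancel]
      _ ≤ _ := eLpNorm_add_le ((hFm _).sub (hFm _)) ((hFm _).sub hu.1) hq1
      _ ≤ _ := by
          gcongr
          rw [eLpNorm_sub_comm]
          exact (hcau1 j i hi).le
  refine ⟨u, hu, ?_, ?_⟩
  · have hHm : ∀ j, AEMeasurable (fun t => ∫⁻ x, ‖F (n j) (x, t) - u (x, t)‖ₑ ^ q)
        (volume.restrict (Icc a b)) := fun j =>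
      (((hFm (n j)).sub hu.1).enorm.pow_const q).prod_swap.lintegral_prod_right'
    have hHint : ∀ j, ∫⁻ t in Icc a b, ∫⁻ x, ‖F (n j) (x, t) - u (x, t)‖ₑ ^ q ≤ (2⁻¹ : ℝ≥0∞) ^ j := by
      intro j
      have h1 := lintegral_prod_symm _ (((hFm (n j)).sub hu.1).enorm.pow_const q)
      refine h1.symm.le.trans ?_
      have h2 := ENNReal.rpow_le_rpow (hrate j) hq0.le
      rw [eLpNorm_ofReal_rpow hq0] at h2
      refine h2.trans ?_
      calc _ ≤ ((2⁻¹ : ℝ≥0∞) ^ j) ^ (1 : ℝ) :=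
            ENNReal.rpow_le_rpow_of_exponent_ge (pow_le_one' (by norm_num) _) (by linarith)
        _ = _ := ENNReal.rpow_one _
    -- By Tonelli the slice errors are summable for almost every `t`. At such times the partial sums
    -- converge in `L^q(ℝ^d)` as well as in the sense of distributions, which identifies the slice
    -- of `u`.
    have hsum : ∀ᵐ t ∂(volume.restrict (Icc a b)),
        ∑' j, ∫⁻ x, ‖F (n j) (x, t) - u (x, t)‖ₑ ^ q < ⊤ := by
      refine ae_lt_top' (AEMeasurable.tsum hHm) ?_
      rw [lintegral_tsum hHm]
      exact ne_top_of_le_ne_top hgeo (ENNReal.tsum_le_tsum hHint)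
    filter_upwards [hsum] with t ht
    have hFt : ∀ m, MemLp (fun x => F m (x, t)) (ENNReal.ofReal q) volume := fun m =>
      memLp_finsetSum _ fun k _ => memLp_pieceEvo hp1 hpq (hg k) k t
    have hut : MemLp (fun x => u (x, t)) (ENNReal.ofReal q) volume := by
      have hmeas : AEStronglyMeasurable (fun x => u (x, t)) volume :=
        (hum.comp_measurable (by fun_prop : Measurable fun x : Rd d => (x, t))).aestronglyMeasurable
      have h1 : MemLp (fun x => F (n 0) (x, t) - u (x, t)) (ENNReal.ofReal q) volume := by
        rw [memLp_ofReal_iff hq0]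
        exact ⟨(hFt _).1.sub hmeas, ne_top_of_le_ne_top ht.ne (ENNReal.le_tsum 0)⟩
      have h2 := (hFt (n 0)).sub h1
      refine h2.congr_norm hmeas (Filter.Eventually.of_forall fun x => ?_)
      simp
    have hsymT : ∀ k, TemperateSymbol (dyadicSymbol ψ k) := fun k =>
      (hψ.hasCompactSupport_dyadicSymbol k).hasTemperateGrowth (hψ.contDiff_dyadicSymbol k)
    refine isRepresentedBy_of_tendsto (q := q) (by linarith)
      (T := fun j => ∑ k ∈ Finset.range (n j), schrodinger t (P k))
      (F := fun j x => F (n j) (x, t)) (fun φ => ?_) (fun j => hFt (n j)) (fun j => ?_) hut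
      (ENNReal.tendsto_atTop_zero_of_tsum_ne_top ht.ne)
    · refine ((hψ.tendsto_sum_apply (schrodinger t f) φ).comp hn.tendsto_atTop).congr fun j => ?_
      have e : ∑ k ∈ Finset.range (n j), schrodinger t (P k)
          = multiplierOp (fun ξ => ∑ k ∈ Finset.range (n j), dyadicSymbol ψ k ξ)
            (schrodinger t f) := by
        rw [← multiplierOp_sum hsymT]
        refine Finset.sum_congr rfl fun k _ => ?_
        rw [schrodinger_comm (hsymT k)]
      rw [e]; rfl
    · exact IsRepresentedBy.sum _ fun k _ => (hloc k).isRepresentedBy_pieceEvo hp1 (hg k) (hPg k) t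
  · have h1 : eLpNorm u (ENNReal.ofReal q) μ ≤ C * Q ^ (1 / 2 : ℝ) := by
      have h2 : Filter.Tendsto (fun j => C * Q ^ (1 / 2 : ℝ) + eLpNorm (F (n j) - u) (ENNReal.ofReal q) μ)
          Filter.atTop (nhds (C * Q ^ (1 / 2 : ℝ) + 0)) := hlim.const_add _
      rw [add_zero] at h2
      refine ge_of_tendsto h2 (Filter.Eventually.of_forall fun j => ?_)
      calc eLpNorm u (ENNReal.ofReal q) μ
          = eLpNorm (F (n j) - (F (n j) - u)) (ENNReal.ofReal q) μ := by rw [sub_sub_cancel]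
        _ ≤ _ := eLpNorm_sub_le (hFm _) ((hFm _).sub hu.1) hq1
        _ ≤ _ := by gcongr; exact hFle (n j)
    refine h1.trans ?_
    gcongr
    rw [one_div, ENNReal.rpow_inv_le_iff (by norm_num), ENNReal.rpow_ofNat]
    exact hQle

/-! ### Besov norms of data at a single frequency -/

theorem exists_isRepresentedBy {p : ℝ} (hp : 1 < p) {g : Rd d → ℂ}
    (hg : MemLp g (ENNReal.ofReal p) volume) : ∃ T : 𝓢'(Rd d, ℂ), IsRepresentedBy T g := by
  have : Fact (1 ≤ ENNReal.ofReal p) := ⟨by rw [ENNReal.one_le_ofReal]; exact hp.le⟩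
  refine ⟨Lp.toTemperedDistribution (hg.toLp g), fun φ => ⟨integrable_schwartz_mul hp φ hg, ?_⟩⟩
  rw [Lp.toTemperedDistribution_apply]
  refine integral_congr_ae ?_
  filter_upwards [hg.coeFn_toLp] with x hx
  rw [hx, smul_eq_mul]

theorem lintegral_kern_dilated (m : Rd d → ℂ) (k : ℕ) :
    ∫⁻ x, ‖kern (dilated m k) x‖ₑ = ∫⁻ x, ‖kern m x‖ₑ := by
  have hr : (0 : ℝ) < 2 ^ k := by positivity
  rw [lintegral_smul_comp hr.ne' (fun x => ‖kern m x‖ₑ),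
    ← lintegral_const_mul' _ _ ENNReal.ofReal_ne_top]
  refine lintegral_congr fun x => ?_
  have h := kern_comp_smul hr m x
  unfold dilated
  rw [h, enorm_mul, ← ofReal_norm, Complex.norm_real, Real.norm_of_nonneg (by positivity),
    abs_of_pos hr]

/-- The symbols with `k ≥ 1` are dilates of one another and their kernels share one `L¹` norm, so
only two constants occur. -/
theorem IsDyadicCutoff.exists_lintegral_kern_le {ψ : Rd d → ℝ} (hψ : IsDyadicCutoff ψ) :
    ∃ A : ℝ≥0∞, A ≠ ⊤ ∧ ∀ k, ∫⁻ x, ‖kern (dyadicSymbol ψ k) x‖ₑ ≤ A := by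
  have h0 := (integrable_kern (hψ.contDiff_dyadicSymbol 0) (hψ.hasCompactSupport_dyadicSymbol 0)).2.ne
  have h1 := (integrable_kern (hψ.contDiff_dyadicSymbol 1) (hψ.hasCompactSupport_dyadicSymbol 1)).2.ne
  refine ⟨(∫⁻ x, ‖kern (dyadicSymbol ψ 0) x‖ₑ) + ∫⁻ x, ‖kern (dyadicSymbol ψ 1) x‖ₑ,
    ENNReal.add_ne_top.2 ⟨h0, h1⟩, fun k => ?_⟩
  cases k with
  | zero => exact le_self_add
  | succ k =>
    have e : dyadicSymbol ψ (k + 1) = dilated (dyadicSymbol ψ 1) k := by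
      ext ξ
      rw [dilated, dyadicSymbol, dyadicSymbol, smul_smul, ← mul_inv, ← pow_add]
      congr 4
      ring
    rw [e, lintegral_kern_dilated]
    exact le_add_self

theorem multiplierOp_zero (T : 𝓢'(Rd d, ℂ)) : multiplierOp (fun _ => 0) T = 0 := by
  unfold multiplierOp
  rw [TemperedDistribution.fourierMultiplierCLM_const]
  simp

theorem isRepresentedBy_zero : IsRepresentedBy (0 : 𝓢'(Rd d, ℂ)) (0 : Rd d → ℂ) := fun φ => by
  simp only [Pi.zero_apply, mul_zero, integral_zero]
  exact ⟨integrable_zero _ _ _, rfl⟩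

theorem nq_cv_kern_le {m : Rd d → ℂ} (hm : ContDiff ℝ ∞ m) (hc : HasCompactSupport m) {p : ℝ}
    (hp : 1 ≤ p) {g : Rd d → ℂ} (hg : AEStronglyMeasurable g volume) :
    nq p (cv (kern m) g) ≤ (∫⁻ x, ‖kern m x‖ₑ) * nq p g := by
  rw [nq_eq (by linarith), nq_eq (by linarith), one_div, ENNReal.rpow_inv_le_iff (by linarith),
    ENNReal.mul_rpow_of_nonneg _ _ (by linarith), ENNReal.rpow_inv_rpow (by linarith)]
  exact lintegral_cv_rpow_le (continuous_kern hm hc).measurable hg hp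

/-- The Besov norm of a function whose frequencies are about `2 ^ n`. -/
theorem IsDyadicCutoff.exists_besovNorm_le {ψ : Rd d → ℝ} (hψ : IsDyadicCutoff ψ) {p : ℝ}
    (hp : 1 ≤ p) (α : ℝ) {ν : ℝ} (hν : 0 < ν) {χ : Rd d → ℂ} (hχ : ContDiff ℝ ∞ χ)
    (hc : HasCompactSupport χ) {c₁ c₂ : ℝ} (hc₁ : 0 < c₁)
    (hs : ∀ ξ, χ ξ ≠ 0 → c₁ ≤ ‖ξ‖ ∧ ‖ξ‖ ≤ c₂) :
    ∃ C : ℝ≥0∞, C ≠ ⊤ ∧ ∀ (n : ℕ) (g : Rd d → ℂ) (T : 𝓢'(Rd d, ℂ)),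
      MemLp g (ENNReal.ofReal p) volume → IsRepresentedBy T g →
      besovNorm ψ p α ν (multiplierOp (dilated χ n) T) ≤ C * (2 : ℝ≥0∞) ^ ((n : ℝ) * α) * nq p g := by
  obtain ⟨A, hAt, hA⟩ := hψ.exists_lintegral_kern_le
  set B := ∫⁻ x, ‖kern χ x‖ₑ with hB
  have hBt : B ≠ ⊤ := (integrable_kern hχ hc).2.ne
  -- `2^K` dominates both ratios, so the support of `χ` dilated by `2^n` can meet the `k`-th annulus
  -- only if `|k - n| ≤ K`.
  obtain ⟨K, hK⟩ : ∃ K : ℕ, max (2 / c₁) (2 * c₂) < (2 : ℝ) ^ K :=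
    pow_unbounded_of_one_lt _ (by norm_num)
  have hK₁ : 2 / c₁ < 2 ^ K := (le_max_left _ _).trans_lt hK
  have hK₂ : 2 * c₂ < 2 ^ K := (le_max_right _ _).trans_lt hK
  -- `2^(K|α|)` is the price of replacing `2^(kα)` by `2^(nα)` when `|k - n| ≤ K`; `A` and `B` bound
  -- the `L¹` norms of the two kernels.
  set D : ℝ≥0∞ := (2 : ℝ≥0∞) ^ ((K : ℝ) * |α|) * (A * B) with hD
  have hDt : D ≠ ⊤ := ENNReal.mul_ne_top (ENNReal.rpow_ne_top_of_nonneg (by positivity) (by norm_num))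
    (ENNReal.mul_ne_top hAt hBt)
  refine ⟨((2 * K + 1 : ℕ) : ℝ≥0∞) ^ (1 / ν) * D, ENNReal.mul_ne_top
    (ENNReal.rpow_ne_top_of_nonneg (by positivity) (ENNReal.natCast_ne_top _)) hDt,
    fun n g T hg hT => ?_⟩
  have hm := contDiff_dilated hχ n
  have hmc := hasCompactSupport_dilated hc n
  set G := cv (kern (dilated χ n)) g with hG
  have hGm : MemLp G (ENNReal.ofReal p) volume := memLp_cv_kern hm hmc hp le_rfl hg
  have hGT : IsRepresentedBy (multiplierOp (dilated χ n) T) G := hT.multiplierOp hm hmc hp hg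
  have hGn : nq p G ≤ B * nq p g := by
    rw [hB, ← lintegral_kern_dilated χ n]
    exact nq_cv_kern_le hm hmc hp hg.1
  have hle : ∀ k, distLpNorm p (multiplierOp (dyadicSymbol ψ k) (multiplierOp (dilated χ n) T))
      ≤ A * B * nq p g := by
    intro k
    have h1 := hψ.contDiff_dyadicSymbol k
    have h2 := hψ.hasCompactSupport_dyadicSymbol k
    rw [distLpNorm_eq hp (memLp_cv_kern h1 h2 hp le_rfl hGm) (hGT.multiplierOp h1 h2 hp hGm),
      mul_assoc]
    refine (nq_cv_kern_le h1 h2 hp hGm.1).trans ?_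
    gcongr
    exact hA k
  -- The subtraction `n - K` is truncated at `0`, which loses nothing because `k ≥ 0`.
  have hzero : ∀ k, k ∉ Finset.Icc (n - K) (n + K) →
      distLpNorm p (multiplierOp (dyadicSymbol ψ k) (multiplierOp (dilated χ n) T)) = 0 := by
    intro k hk
    have e : multiplierOp (dyadicSymbol ψ k) (multiplierOp (dilated χ n) T) = 0 := by
      rw [multiplierOp_multiplierOp (hmc.hasTemperateGrowth hm)
        ((hψ.hasCompactSupport_dyadicSymbol k).hasTemperateGrowth (hψ.contDiff_dyadicSymbol k)),
        ← multiplierOp_zero T]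
      refine congrArg (fun m => multiplierOp m T) (funext fun ξ => ?_)
      by_contra hne
      obtain ⟨h1, h2⟩ := hs _ (left_ne_zero_of_mul hne)
      rw [norm_smul, Real.norm_of_nonneg (by positivity), ← div_eq_inv_mul] at h1 h2
      rw [le_div_iff₀ (by positivity)] at h1
      rw [div_le_iff₀ (by positivity)] at h2
      have h3 : ‖ξ‖ ≤ 2 ^ (k + 1) := by
        by_contra hcon
        exact right_ne_zero_of_mul hne (hψ.dyadicSymbol_eq_zero_of_norm_gt (not_le.1 hcon))
      apply hk
      rw [Finset.mem_Icc]
      constructor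
      · have h4 : (2 : ℝ) ^ n ≤ 2 ^ (k + K) := by
          have h5 : (2 : ℝ) ^ n ≤ 2 / c₁ * 2 ^ k := by
            rw [div_mul_eq_mul_div, le_div_iff₀ hc₁, ← pow_succ']
            linarith
          calc (2 : ℝ) ^ n ≤ 2 / c₁ * 2 ^ k := h5
            _ ≤ 2 ^ K * 2 ^ k := by gcongr
            _ = _ := by ring
        have := (pow_le_pow_iff_right₀ (by norm_num : (1 : ℝ) < 2)).1 h4
        omega
      · cases k with
        | zero => omega
        | succ k =>
          have h6 : (2 : ℝ) ^ k ≤ ‖ξ‖ := by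
            by_contra hcon
            exact right_ne_zero_of_mul hne (hψ.dyadicSymbol_eq_zero_of_norm_lt (not_le.1 hcon))
          have h4 : (2 : ℝ) ^ (k + 1) ≤ 2 ^ (n + K) := by
            calc (2 : ℝ) ^ (k + 1) = 2 * 2 ^ k := by ring
              _ ≤ 2 * (c₂ * 2 ^ n) := by linarith
              _ = 2 * c₂ * 2 ^ n := by ring
              _ ≤ 2 ^ K * 2 ^ n := by gcongr
              _ = _ := by ring
          exact (pow_le_pow_iff_right₀ (by norm_num : (1 : ℝ) < 2)).1 h4
    rw [e, distLpNorm_eq hp MemLp.zero isRepresentedBy_zero, eLpNorm_zero]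
  have hterm : ∀ k ∈ Finset.Icc (n - K) (n + K), (2 : ℝ≥0∞) ^ ((k : ℝ) * α * ν) *
      distLpNorm p (multiplierOp (dyadicSymbol ψ k) (multiplierOp (dilated χ n) T)) ^ ν
      ≤ (D * (2 : ℝ≥0∞) ^ ((n : ℝ) * α) * nq p g) ^ ν := by
    intro k hk
    rw [ENNReal.rpow_mul, ← ENNReal.mul_rpow_of_nonneg _ _ hν.le]
    refine ENNReal.rpow_le_rpow ?_ hν.le
    have h1 : (k : ℝ) * α ≤ (K : ℝ) * |α| + n * α := by
      rw [Finset.mem_Icc] at hk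
      have h2 : |(k : ℝ) - n| ≤ K := by
        rw [abs_le]
        have ha : (n : ℝ) ≤ k + K := by exact_mod_cast (by omega : n ≤ k + K)
        have hb : (k : ℝ) ≤ n + K := by exact_mod_cast hk.2
        constructor <;> linarith
      have h3 : ((k : ℝ) - n) * α ≤ K * |α| := by
        refine (le_abs_self _).trans ?_
        rw [abs_mul]
        gcongr
      linarith
    calc _ ≤ (2 : ℝ≥0∞) ^ ((K : ℝ) * |α| + n * α) * (A * B * nq p g) := by
          refine mul_le_mul' (ENNReal.rpow_le_rpow_of_exponent_le (by norm_num) h1) (hle k)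
      _ = _ := by
          rw [ENNReal.rpow_add _ _ (by norm_num) (by norm_num), hD]; ring
  rw [besovNorm, _root_.tsum_eq_sum (s := Finset.Icc (n - K) (n + K)) fun k hk => by
    rw [hzero k hk, ENNReal.zero_rpow_of_pos hν, mul_zero]]
  calc _ ≤ (((2 * K + 1 : ℕ) : ℝ≥0∞) * (D * (2 : ℝ≥0∞) ^ ((n : ℝ) * α) * nq p g) ^ ν) ^ (1 / ν) := by
        refine ENNReal.rpow_le_rpow ((Finset.sum_le_sum hterm).trans ?_) (by positivity)
        rw [Finset.sum_const, nsmul_eq_mul]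
        gcongr
        rw [Nat.card_Icc]
        omega
    _ = _ := by
        rw [ENNReal.mul_rpow_of_nonneg _ _ (by positivity), ← ENNReal.rpow_mul,
          mul_one_div_cancel hν.ne', ENNReal.rpow_one]
        ring

/-! ### Evolutions of chirped data in pseudoconformal coordinates -/

theorem continuous_fullExt {h : Rd d → ℂ} (hh : Integrable h) : Continuous (fullExt h) := by
  unfold fullExt
  refine continuous_of_dominated (bound := fun y => ‖h y‖) ?_ ?_ hh.norm ?_
  · intro z
    exact hh.1.mul (Continuous.aestronglyMeasurable (by fun_prop))
  · intro z
    refine Filter.Eventually.of_forall fun y => ?_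
    rw [norm_mul, norm_exp_I_mul_ofReal, mul_one]
  · exact Filter.Eventually.of_forall fun y => by fun_prop

theorem norm_fullExt_le (h : Rd d → ℂ) (z : Rd d × ℝ) : ‖fullExt h z‖ ≤ ∫ y, ‖h y‖ := by
  refine (norm_integral_le_integral_norm _).trans_eq ?_
  congr 1; ext y
  rw [norm_mul, norm_exp_I_mul_ofReal, mul_one]

/-- The average of the extension of `h` against the kernel of `χ` that appears when the frequency
localized Schrödinger evolution is written in pseudoconformal coordinates. -/
noncomputable def averagedExt (χ h : Rd d → ℂ) (v : ℝ × ℝ × Rd d × ℝ) : ℂ :=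
  ∫ z, kern χ z * (Complex.exp (Complex.I *
    ((v.1 * (v.2.1 * ‖z‖ ^ 2 - ⟪v.2.2.1, z⟫) : ℝ) : ℂ)) *
      fullExt h (v.2.2.1 - (2 * v.2.1) • z, v.2.2.2))

theorem continuous_averagedExt {χ : Rd d → ℂ} (hχ : ContDiff ℝ ∞ χ) (hc : HasCompactSupport χ)
    {h : Rd d → ℂ} (hh : Integrable h) : Continuous (averagedExt χ h) := by
  have hk := continuous_kern hχ hc
  have hE := continuous_fullExt hh
  unfold averagedExt
  refine continuous_of_dominated (bound := fun z => ‖kern χ z‖ * ∫ y, ‖h y‖) ?_ ?_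
    ((integrable_kern hχ hc).norm.mul_const _) ?_
  · intro v
    exact Continuous.aestronglyMeasurable (by fun_prop)
  · intro v
    refine Filter.Eventually.of_forall fun z => ?_
    rw [norm_mul, norm_mul, norm_exp_I_mul_ofReal, one_mul]
    gcongr
    exact norm_fullExt_le _ _
  · exact Filter.Eventually.of_forall fun z => by fun_prop

/-- When the first parameter is `0` the quadratic phase disappears, and by Fubini the average
multiplies `h(y)` by the Fourier transform of `kern χ` at `-2τ y`, that is by `χ (-2τ y)`. -/
theorem averagedExt_zero {χ : Rd d → ℂ} (hχ : ContDiff ℝ ∞ χ) (hc : HasCompactSupport χ)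
    {h : Rd d → ℂ} (hh : Integrable h) {τ : ℝ} (h1 : ∀ y, h y ≠ 0 → χ (-(2 * τ) • y) = 1)
    (ξ : Rd d) (s : ℝ) : averagedExt χ h (0, τ, ξ, s) = fullExt h (ξ, s) := by
  have hki := integrable_kern hχ hc
  have hint : Integrable (fun w : Rd d × Rd d => kern χ w.1 * (h w.2 *
      Complex.exp (Complex.I * ((s * ‖w.2‖ ^ 2 - ⟪ξ - (2 * τ) • w.1, w.2⟫ : ℝ) : ℂ))))
      (volume.prod volume) := by
    refine (hki.mul_prod hh).norm.mono' ?_ (Filter.Eventually.of_forall fun w => ?_)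
    · exact hki.1.comp_fst.mul (hh.1.comp_snd.mul (Continuous.aestronglyMeasurable (by fun_prop)))
    · rw [norm_mul, norm_mul, norm_mul, norm_exp_I_mul_ofReal, mul_one]
  calc averagedExt χ h (0, τ, ξ, s)
      = ∫ z, ∫ y, kern χ z * (h y *
          Complex.exp (Complex.I * ((s * ‖y‖ ^ 2 - ⟪ξ - (2 * τ) • z, y⟫ : ℝ) : ℂ))) := by
        simp only [averagedExt, fullExt, zero_mul, Complex.ofReal_zero, mul_zero, Complex.exp_zero,
          one_mul, integral_const_mul]
    _ = ∫ y, ∫ z, kern χ z * (h y *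
          Complex.exp (Complex.I * ((s * ‖y‖ ^ 2 - ⟪ξ - (2 * τ) • z, y⟫ : ℝ) : ℂ))) :=
        integral_integral_swap hint
    _ = ∫ y, h y * Complex.exp (Complex.I * ((s * ‖y‖ ^ 2 - ⟪ξ, y⟫ : ℝ) : ℂ)) := by
        congr 1; ext y
        by_cases hy : h y = 0
        · simp [hy]
        have h2 := integral_kern_mul_exp hχ hc (-(2 * τ) • y)
        rw [h1 y hy] at h2
        rw [← mul_one (h y * _), ← h2, ← integral_const_mul]
        congr 1; ext z
        rw [show ∀ a b c e : ℂ, a * b * (c * e) = c * (a * (b * e)) by intros; ring,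
          ← Complex.exp_add]
        congr 3
        rw [inner_smul_right, inner_sub_left, real_inner_smul_left]
        push_cast
        ring_nf

/-- The rescaling of `h` by `ρ`, modulated by the quadratic phase `-c|x|²`. -/
noncomputable def modulatedDilate (ρ c : ℝ) (h : Rd d → ℂ) (x : Rd d) : ℂ :=
  h (ρ⁻¹ • x) * Complex.exp (Complex.I * ((-(c * ‖x‖ ^ 2) : ℝ) : ℂ))

/-- The modulation only shifts the time variable of the extension, recentring it at `t = 1 / (4c)`.
-/
theorem chirp_modulatedDilate {ρ t : ℝ} (hρ : 0 < ρ) (ht : t ≠ 0) (c : ℝ) (h : Rd d → ℂ)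
    (w : Rd d) : chirp t (modulatedDilate ρ c h) w
      = ((ρ ^ d : ℝ) : ℂ) * (Complex.exp (Complex.I * ((‖w‖ ^ 2 / (4 * t) : ℝ) : ℂ)) *
        fullExt h ((ρ / (2 * t)) • w, ρ ^ 2 / (4 * t) - ρ ^ 2 * c)) := by
  have h1 := Measure.integral_comp_smul (volume : Measure (Rd d)) (fun y =>
    modulatedDilate ρ c h y * Complex.exp (Complex.I * ((‖w - y‖ ^ 2 / (4 * t) : ℝ) : ℂ))) ρ
  rw [finrank_euclideanSpace_fin, abs_of_nonneg (by positivity), Complex.real_smul] at h1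
  have h2 : chirp t (modulatedDilate ρ c h) w = ((ρ ^ d : ℝ) : ℂ) *
      ∫ y, modulatedDilate ρ c h (ρ • y) *
        Complex.exp (Complex.I * ((‖w - ρ • y‖ ^ 2 / (4 * t) : ℝ) : ℂ)) := by
    rw [h1, ← mul_assoc, ← Complex.ofReal_mul, mul_inv_cancel₀ (by positivity), chirp]
    simp
  rw [h2, fullExt, ← integral_const_mul (Complex.exp _)]
  congr 2; ext y
  rw [modulatedDilate, inv_smul_smul₀ hρ.ne', mul_assoc,
    mul_left_comm (Complex.exp _) (h y), ← Complex.exp_add,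
    ← Complex.exp_add, ← mul_add, ← mul_add, ← Complex.ofReal_add, ← Complex.ofReal_add]
  congr 4
  rw [norm_sub_sq_real, inner_smul_right, norm_smul, real_inner_smul_left,
    Real.norm_of_nonneg hρ.le]
  field_simp
  ring

/-- Displacing `x` by `z / ρ` changes the phase `‖x‖² / (4t)` by `ρ⁻²` times an expression in the
pseudoconformal variables. Hence `ρ⁻²` enters `averagedExt` as a separate parameter, which will tend
to `0`. -/
theorem norm_cv_kern_chirp_modulatedDilate {ρ t : ℝ} (hρ : 0 < ρ) (ht : t ≠ 0) (c : ℝ)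
    (χ h : Rd d → ℂ) (x : Rd d) :
    ‖cv (kern (fun ξ => χ (ρ⁻¹ • ξ))) (chirp t (modulatedDilate ρ c h)) x‖
      = ρ ^ d * ‖averagedExt χ h ((ρ ^ 2)⁻¹, 1 / (4 * t), (ρ / (2 * t)) • x,
        ρ ^ 2 / (4 * t) - ρ ^ 2 * c)‖ := by
  have h1 := Measure.integral_comp_smul (volume : Measure (Rd d)) (fun z =>
    kern χ z * chirp t (modulatedDilate ρ c h) (x - ρ⁻¹ • z)) ρ
  rw [finrank_euclideanSpace_fin, abs_of_nonneg (by positivity), Complex.real_smul] at h1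
  have h2 : cv (kern (fun ξ => χ (ρ⁻¹ • ξ))) (chirp t (modulatedDilate ρ c h)) x
      = ∫ z, kern χ z * chirp t (modulatedDilate ρ c h) (x - ρ⁻¹ • z) := by
    rw [cv_eq_integral_mul_sub]
    simp only [kern_comp_smul hρ, mul_assoc]
    rw [integral_const_mul]
    simp only [inv_smul_smul₀ hρ.ne'] at h1
    rw [h1, ← mul_assoc, Complex.ofReal_inv, mul_inv_cancel₀, one_mul]
    exact_mod_cast (by positivity : ρ ^ d ≠ 0)
  have h3 : (∫ z, kern χ z * chirp t (modulatedDilate ρ c h) (x - ρ⁻¹ • z))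
      = ((ρ ^ d : ℝ) : ℂ) * (Complex.exp (Complex.I * ((‖x‖ ^ 2 / (4 * t) : ℝ) : ℂ)) *
        averagedExt χ h ((ρ ^ 2)⁻¹, 1 / (4 * t), (ρ / (2 * t)) • x,
          ρ ^ 2 / (4 * t) - ρ ^ 2 * c)) := by
    rw [averagedExt, ← integral_const_mul, ← integral_const_mul]
    congr 1; ext z
    have e1 : (ρ / (2 * t)) • (x - ρ⁻¹ • z) = (ρ / (2 * t)) • x - (2 * (1 / (4 * t))) • z := by
      rw [smul_sub, smul_smul]
      congr 2
      field_simp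
      norm_num
    have e2 : Complex.exp (Complex.I * ((‖x - ρ⁻¹ • z‖ ^ 2 / (4 * t) : ℝ) : ℂ))
        = Complex.exp (Complex.I * ((‖x‖ ^ 2 / (4 * t) : ℝ) : ℂ)) *
          Complex.exp (Complex.I * (((ρ ^ 2)⁻¹ * (1 / (4 * t) * ‖z‖ ^ 2 -
            ⟪(ρ / (2 * t)) • x, z⟫) : ℝ) : ℂ)) := by
      rw [← Complex.exp_add, ← mul_add, ← Complex.ofReal_add]
      congr 3
      rw [norm_sub_sq_real, inner_smul_right, norm_smul, real_inner_smul_left,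
        Real.norm_of_nonneg (by positivity)]
      field_simp
      ring
    rw [chirp_modulatedDilate hρ ht, e1, e2]
    ring
  rw [h2, h3, norm_mul, norm_mul, norm_exp_I_mul_ofReal, one_mul, Complex.norm_real,
    Real.norm_of_nonneg (by positivity)]

theorem lintegral_enorm_modulatedDilate_rpow {ρ : ℝ} (hρ : 0 < ρ) (c p : ℝ) (h : Rd d → ℂ) :
    ∫⁻ x, ‖modulatedDilate ρ c h x‖ₑ ^ p = ENNReal.ofReal (ρ ^ d) * ∫⁻ x, ‖h x‖ₑ ^ p := by
  have h1 : ∀ x, ‖modulatedDilate ρ c h x‖ₑ = ‖h (ρ⁻¹ • x)‖ₑ := by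
    intro x
    rw [modulatedDilate, enorm_mul, ← ofReal_norm (Complex.exp _), norm_exp_I_mul_ofReal]
    simp
  rw [lintegral_smul_comp hρ.ne', abs_of_pos hρ]
  simp only [h1, inv_smul_smul₀ hρ.ne']

theorem aestronglyMeasurable_modulatedDilate {ρ : ℝ} (hρ : 0 < ρ) (c : ℝ) {h : Rd d → ℂ}
    (hh : AEStronglyMeasurable h volume) :
    AEStronglyMeasurable (modulatedDilate ρ c h) volume := by
  refine AEStronglyMeasurable.mul ?_ (Continuous.aestronglyMeasurable (by fun_prop))
  exact hh.comp_quasiMeasurePreserving (quasiMeasurePreserving_const_smul (inv_pos.2 hρ).ne')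

theorem MemLp.modulatedDilate {p ρ : ℝ} (hp : 0 < p) (hρ : 0 < ρ) (c : ℝ) {h : Rd d → ℂ}
    (hh : MemLp h (ENNReal.ofReal p) volume) :
    MemLp (modulatedDilate ρ c h) (ENNReal.ofReal p) volume := by
  rw [memLp_ofReal_iff hp] at hh ⊢
  refine ⟨aestronglyMeasurable_modulatedDilate hρ c hh.1, ?_⟩
  rw [lintegral_enorm_modulatedDilate_rpow hρ]
  exact ENNReal.mul_ne_top ENNReal.ofReal_ne_top hh.2

theorem nq_modulatedDilate {p ρ : ℝ} (hp : 0 < p) (hρ : 0 < ρ) (c : ℝ) (h : Rd d → ℂ) :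
    nq p (modulatedDilate ρ c h) = ENNReal.ofReal (ρ ^ (d / p)) * nq p h := by
  rw [nq, nq, eLpNorm_ofReal_eq hp, eLpNorm_ofReal_eq hp, lintegral_enorm_modulatedDilate_rpow hρ,
    ENNReal.mul_rpow_of_nonneg _ _ (by positivity),
    ENNReal.ofReal_rpow_of_nonneg (by positivity) (by positivity), ← Real.rpow_natCast,
    ← Real.rpow_mul hρ.le, mul_one_div]

/-- Allows the function supplied by the Schrödinger estimate to be identified at a given time
without first knowing that this slice lies in some `L^q`. -/
theorem IsRepresentedBy.locallyIntegrable {T : 𝓢'(Rd d, ℂ)} {g : Rd d → ℂ}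
    (h : IsRepresentedBy T g) : LocallyIntegrable g := by
  intro x
  let φ : ContDiffBump x := ⟨1, 2, by norm_num, by norm_num⟩
  have hφ : ContDiff ℝ ∞ (fun y => (φ y : ℂ)) := Complex.ofRealCLM.contDiff.comp φ.contDiff
  have hc : HasCompactSupport (fun y => (φ y : ℂ)) :=
    φ.hasCompactSupport.comp_left Complex.ofReal_zero
  refine ⟨Metric.closedBall x 1, Metric.closedBall_mem_nhds x one_pos, ?_⟩
  refine (h (hc.toSchwartzMap hφ)).1.integrableOn.congr_fun (fun y hy => ?_)
    Metric.isClosed_closedBall.measurableSet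
  have : φ y = 1 := φ.one_of_mem_closedBall hy
  simp [this]

theorem lintegral_cv_kern_evo_eq {m : Rd d → ℂ} (hm : ContDiff ℝ ∞ m) (hc : HasCompactSupport m)
    {p : ℝ} (hp : 1 ≤ p) (q : ℝ) {g : Rd d → ℂ} (hg : MemLp g (ENNReal.ofReal p) volume)
    {T : 𝓢'(Rd d, ℂ)} (hT : IsRepresentedBy T g) {t : ℝ} {w : Rd d → ℂ}
    (hw : IsRepresentedBy (schrodinger t (multiplierOp m T)) w) :
    ∫⁻ x, ‖cv (kern (evo m t)) g x‖ₑ ^ q = ∫⁻ x, ‖w x‖ₑ ^ q := by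
  rw [schrodinger_multiplierOp (hc.hasTemperateGrowth hm)] at hw
  have h1 := hT.multiplierOp (contDiff_evo hm t) (hasCompactSupport_evo hc t) hp hg
  refine lintegral_congr_ae ?_
  filter_upwards [h1.ae_eq hw h1.locallyIntegrable hw.locallyIntegrable] with x hx
  rw [hx]

theorem enorm_averagedExt_eq {χ : Rd d → ℂ} (hχ : ContDiff ℝ ∞ χ) (hc : HasCompactSupport χ)
    {h : Rd d → ℂ} {n : ℕ} {c t : ℝ} (hh : Integrable (modulatedDilate (2 ^ n) c h)) (ht : t ≠ 0)
    (x : Rd d) :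
    ‖averagedExt χ h (((2 ^ n) ^ 2)⁻¹, 1 / (4 * t), ((2 ^ n : ℝ) / (2 * t)) • x,
        (2 ^ n) ^ 2 / (4 * t) - (2 ^ n) ^ 2 * c)‖ₑ
      = ENNReal.ofReal ((2 ^ n : ℝ) ^ (-(d : ℝ)) * (4 * Real.pi * |t|) ^ ((d : ℝ) / 2)) *
        ‖cv (kern (evo (dilated χ n) t)) (modulatedDilate (2 ^ n) c h) x‖ₑ := by
  have h0 : (0 : ℝ) < 4 * Real.pi * |t| := by have := abs_pos.2 ht; positivity
  rw [← ofReal_norm, ← ofReal_norm, ← ENNReal.ofReal_mul (by positivity),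
    cv_kern_evo_eq (contDiff_dilated hχ n) (hasCompactSupport_dilated hc n) ht hh x]
  have h1 := norm_cv_kern_chirp_modulatedDilate (ρ := 2 ^ n) (by positivity) ht c χ h x
  change ‖cv (kern (dilated χ n)) _ x‖ = _ at h1
  rw [h1, ← mul_assoc, ← mul_assoc, mul_assoc (_ ^ (-(d : ℝ))), ← Real.rpow_add h0,
    mul_assoc (_ ^ (-(d : ℝ))), mul_comm (_ ^ (_ : ℝ)) ((2 ^ n : ℝ) ^ d), ← mul_assoc,
    Real.rpow_neg (by positivity), Real.rpow_natCast, inv_mul_cancel₀ (by positivity),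
    show (d : ℝ) / 2 + -(d : ℝ) / 2 = 0 by ring, Real.rpow_zero, one_mul, one_mul]

/-- In pseudoconformal coordinates, a Schrödinger estimate bounds averages of the extension
operator, uniformly in the frequency. -/
theorem SchrodingerBounded.lintegral_averagedExt_le {ψ : Rd d → ℝ} (hψ : IsDyadicCutoff ψ)
    {p q α ν a b : ℝ} (hp : 1 < p) (hq : 0 < q) (hν : 0 < ν)
    (hα : α = d * (1 - 1 / p - 1 / q) - 2 / q) (hS : SchrodingerBounded d ψ p q α ν a b)
    {χ : Rd d → ℂ} (hχ : ContDiff ℝ ∞ χ) (hc : HasCompactSupport χ) {c₁ c₂ : ℝ} (hc₁ : 0 < c₁)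
    (hs : ∀ ξ, χ ξ ≠ 0 → c₁ ≤ ‖ξ‖ ∧ ‖ξ‖ ≤ c₂) (c : ℝ) {m M : ℝ} (hm : 0 < m) {J : Set ℝ}
    (hJ : MeasurableSet J) (hJs : J ⊆ Icc a b) (hJm : ∀ t ∈ J, m ≤ |t| ∧ |t| ≤ M) :
    ∃ C : ℝ≥0∞, C ≠ ⊤ ∧ ∀ (n : ℕ) (h : Rd d → ℂ), MemLp h (ENNReal.ofReal p) volume →
      Integrable h →
      ∫⁻ s in (fun t : ℝ => (2 ^ n) ^ 2 / (4 * t) - (2 ^ n) ^ 2 * c) '' J,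
          ∫⁻ ξ, ‖averagedExt χ h (((2 ^ n) ^ 2)⁻¹, c + s * ((2 ^ n) ^ 2)⁻¹, ξ, s)‖ₑ ^ q
        ≤ C * nq p h ^ q := by
  obtain ⟨C, hC⟩ := hS
  obtain ⟨B, hBt, hB⟩ := hψ.exists_besovNorm_le hp.le α hν hχ hc hc₁ hs
  have hp0 : 0 < p := by linarith
  -- `A` bounds the factors depending on `t`, namely the Jacobian and the dispersive decay, using `m
  -- ≤ |t| ≤ M`.
  set A : ℝ≥0∞ := ENNReal.ofReal (1 / (4 * m ^ 2) * (1 / (2 * m)) ^ d *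
    ((4 * Real.pi * M) ^ ((d : ℝ) / 2)) ^ q) with hA
  refine ⟨A * (C * B) ^ q, ENNReal.mul_ne_top ENNReal.ofReal_ne_top
    (ENNReal.rpow_ne_top_of_nonneg hq.le (ENNReal.mul_ne_top ENNReal.coe_ne_top hBt)), ?_⟩
  intro n h hh hhi
  set ρ : ℝ := 2 ^ n with hρd
  have hρ : 0 < ρ := by positivity
  set g := modulatedDilate ρ c h with hg
  have hgp : MemLp g (ENNReal.ofReal p) volume := MemLp.modulatedDilate hp0 hρ c hh
  have hgi : Integrable g := by
    have h1 : MemLp h (ENNReal.ofReal 1) volume := by simpa using memLp_one_iff_integrable.2 hhi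
    have h2 := MemLp.modulatedDilate one_pos hρ c h1
    rw [ENNReal.ofReal_one] at h2
    exact memLp_one_iff_integrable.1 h2
  obtain ⟨T, hT⟩ := exists_isRepresentedBy hp hgp
  have hbes := hB n g T hgp hT
  have hρe : (2 : ℝ≥0∞) ^ ((n : ℝ) * α) = ENNReal.ofReal (ρ ^ α) := by
    rw [hρd, ← Real.rpow_natCast, ← Real.rpow_mul (by norm_num),
      ← ENNReal.ofReal_rpow_of_pos (by norm_num)]
    norm_num
  rw [hg, nq_modulatedDilate hp0 hρ, hρe] at hbes
  have hfin : besovNorm ψ p α ν (multiplierOp (dilated χ n) T) < ⊤ :=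
    hbes.trans_lt (ENNReal.mul_lt_top (ENNReal.mul_lt_top hBt.lt_top ENNReal.ofReal_lt_top)
      (ENNReal.mul_lt_top ENNReal.ofReal_lt_top hh.2))
  obtain ⟨u, hu, hur, hub⟩ := hC _ hfin
  have hV : ∫⁻ t in J, ∫⁻ x, ‖cv (kern (evo (dilated χ n) t)) g x‖ₑ ^ q
      ≤ (C * B * ENNReal.ofReal (ρ ^ α) * ENNReal.ofReal (ρ ^ (d / p)) * nq p h) ^ q := by
    calc _ ≤ ∫⁻ t in Icc a b, ∫⁻ x, ‖cv (kern (evo (dilated χ n) t)) g x‖ₑ ^ q :=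
          lintegral_mono_set hJs
      _ = ∫⁻ t in Icc a b, ∫⁻ x, ‖u (x, t)‖ₑ ^ q := by
          refine lintegral_congr_ae ?_
          filter_upwards [hur] with t ht
          exact lintegral_cv_kern_evo_eq (contDiff_dilated hχ n) (hasCompactSupport_dilated hc n)
            hp.le q hgp hT ht
      _ = eLpNorm u (ENNReal.ofReal q) (volume.prod (volume.restrict (Icc a b))) ^ q := by
          rw [eLpNorm_ofReal_rpow hq, lintegral_prod_symm _ (hu.1.enorm.pow_const q)]
      _ ≤ _ := by
          refine ENNReal.rpow_le_rpow (hub.trans ?_) hq.le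
          refine (mul_le_mul_right hbes _).trans_eq ?_
          ring
  have h0 : ∀ t ∈ J, t ≠ 0 := fun t ht => abs_pos.1 (hm.trans_le (hJm t ht).1)
  have hpt : ∀ t ∈ J, ENNReal.ofReal (ρ ^ 2 / (4 * t ^ 2) * (ρ / (2 * |t|)) ^ d) *
      ∫⁻ x, ‖averagedExt χ h ((ρ ^ 2)⁻¹, c + (ρ ^ 2 / (4 * t) - ρ ^ 2 * c) * (ρ ^ 2)⁻¹,
        (ρ / (2 * t)) • x, ρ ^ 2 / (4 * t) - ρ ^ 2 * c)‖ₑ ^ q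
      ≤ A * ENNReal.ofReal (ρ ^ (2 + d - d * q)) *
        ∫⁻ x, ‖cv (kern (evo (dilated χ n) t)) g x‖ₑ ^ q := by
    intro t ht
    have ht0 := abs_pos.2 (h0 t ht)
    have htt := h0 t ht
    have hM : 0 ≤ M := ht0.le.trans (hJm t ht).2
    -- With `s = ρ² / (4t) - ρ² c`, the parameter `1 / (4t)` is `c + s ρ⁻²`, which tends to `c` as
    -- `n → ∞` with `s` fixed.
    have e1 : c + (ρ ^ 2 / (4 * t) - ρ ^ 2 * c) * (ρ ^ 2)⁻¹ = 1 / (4 * t) := by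
      field_simp
      ring
    have e2 : ∀ x, ‖averagedExt χ h ((ρ ^ 2)⁻¹, 1 / (4 * t), (ρ / (2 * t)) • x,
        ρ ^ 2 / (4 * t) - ρ ^ 2 * c)‖ₑ ^ q
        = ENNReal.ofReal ((ρ ^ (-(d : ℝ)) * (4 * Real.pi * |t|) ^ ((d : ℝ) / 2)) ^ q) *
          ‖cv (kern (evo (dilated χ n) t)) g x‖ₑ ^ q := by
      intro x
      rw [enorm_averagedExt_eq hχ hc hgi htt, ENNReal.mul_rpow_of_nonneg _ _ hq.le,
        ENNReal.ofReal_rpow_of_nonneg (by positivity) hq.le]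
    simp only [e1, e2]
    rw [lintegral_const_mul' _ _ ENNReal.ofReal_ne_top, ← mul_assoc, hA,
      ← ENNReal.ofReal_mul (by positivity),
      ← ENNReal.ofReal_mul (by positivity)]
    refine mul_le_mul_left (ENNReal.ofReal_le_ofReal ?_) _
    have h3 : ρ ^ (2 + d - d * q : ℝ) = ρ ^ 2 * ρ ^ d * (ρ ^ (-(d : ℝ))) ^ q := by
      rw [← Real.rpow_natCast ρ d, ← Real.rpow_natCast ρ 2, ← Real.rpow_mul hρ.le,
        ← Real.rpow_add hρ, ← Real.rpow_add hρ]
      congr 1; push_cast; ring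
    rw [Real.mul_rpow (by positivity) (by positivity), h3, ← sq_abs t]
    have h4 : ρ ^ 2 / (4 * |t| ^ 2) * (ρ / (2 * |t|)) ^ d
        = ρ ^ 2 * ρ ^ d * (1 / (4 * |t| ^ 2) * (1 / (2 * |t|)) ^ d) := by
      rw [div_pow, div_pow]; ring
    rw [h4]
    have h5 : 1 / (4 * |t| ^ 2) * (1 / (2 * |t|)) ^ d ≤ 1 / (4 * m ^ 2) * (1 / (2 * m)) ^ d := by
      have := (hJm t ht).1
      gcongr
    have h6 : ((4 * Real.pi * |t|) ^ ((d : ℝ) / 2)) ^ q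
        ≤ ((4 * Real.pi * M) ^ ((d : ℝ) / 2)) ^ q := by
      have := (hJm t ht).2
      gcongr
    calc _ = (ρ ^ 2 * ρ ^ d * (ρ ^ (-(d : ℝ))) ^ q) * ((1 / (4 * |t| ^ 2) * (1 / (2 * |t|)) ^ d) *
          ((4 * Real.pi * |t|) ^ ((d : ℝ) / 2)) ^ q) := by ring
      _ ≤ (ρ ^ 2 * ρ ^ d * (ρ ^ (-(d : ℝ))) ^ q) * ((1 / (4 * m ^ 2) * (1 / (2 * m)) ^ d) *
          ((4 * Real.pi * M) ^ ((d : ℝ) / 2)) ^ q) := by gcongr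
      _ = _ := by ring
  rw [lintegral_pseudoconformal hρ (ρ ^ 2 * c) hJ h0
    (fun z => ‖averagedExt χ h ((ρ ^ 2)⁻¹, c + z.2 * (ρ ^ 2)⁻¹, z.1, z.2)‖ₑ ^ q)]
  calc _ ≤ ∫⁻ t in J, A * ENNReal.ofReal (ρ ^ (2 + d - d * q)) *
        ∫⁻ x, ‖cv (kern (evo (dilated χ n) t)) g x‖ₑ ^ q := setLIntegral_mono' hJ hpt
    _ = A * ENNReal.ofReal (ρ ^ (2 + d - d * q)) *
        ∫⁻ t in J, ∫⁻ x, ‖cv (kern (evo (dilated χ n) t)) g x‖ₑ ^ q :=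
        lintegral_const_mul' _ _ (ENNReal.mul_ne_top ENNReal.ofReal_ne_top ENNReal.ofReal_ne_top)
    _ ≤ A * ENNReal.ofReal (ρ ^ (2 + d - d * q)) *
        (C * B * ENNReal.ofReal (ρ ^ α) * ENNReal.ofReal (ρ ^ (d / p)) * nq p h) ^ q := by gcongr
    _ = A * (C * B) ^ q * nq p h ^ q * (ENNReal.ofReal (ρ ^ (2 + d - d * q)) *
        (ENNReal.ofReal (ρ ^ α) * ENNReal.ofReal (ρ ^ (d / p))) ^ q) := by
        rw [mul_assoc ((C : ℝ≥0∞) * B), ENNReal.mul_rpow_of_nonneg _ _ hq.le,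
          ENNReal.mul_rpow_of_nonneg _ _ hq.le]
        ring
    _ = A * (C * B) ^ q * nq p h ^ q := by
        rw [← ENNReal.ofReal_mul (by positivity), ← Real.rpow_add hρ,
          ENNReal.ofReal_rpow_of_nonneg (by positivity) hq.le, ← Real.rpow_mul hρ.le,
          ← ENNReal.ofReal_mul (by positivity), ← Real.rpow_add hρ]
        -- The value of `α` makes all powers of `ρ` cancel, so the bound is uniform in `n`.
        have : 2 + d - d * q + (α + d / p) * q = 0 := by
          rw [hα]
          field_simp
          ring
        rw [this, Real.rpow_zero, ENNReal.ofReal_one, mul_one]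

/-! ### The limit of infinite frequency -/

open Filter Topology


theorem tendsto_sq_two_pow_inv : Tendsto (fun n : ℕ => (((2 : ℝ) ^ n) ^ 2)⁻¹) atTop (𝓝 0) := by
  have h := tendsto_pow_atTop_nhds_zero_of_lt_one (r := (1 / 4 : ℝ)) (by norm_num) (by norm_num)
  refine h.congr fun n => ?_
  rw [← pow_mul, mul_comm, pow_mul, ← inv_pow]
  norm_num

/-- The preimage of `s` is `(1/t₀ + 4 s 4^{-n})⁻¹`, which tends to `t₀`: the time windows exhaust
the line. -/
theorem eventually_mem_pseudoconformal_image {t₀ : ℝ} (ht : t₀ ≠ 0) {J : Set ℝ} (hJ : J ∈ 𝓝 t₀)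
    (s : ℝ) : ∀ᶠ n : ℕ in atTop,
      s ∈ (fun t : ℝ => (2 ^ n) ^ 2 / (4 * t) - (2 ^ n) ^ 2 * (1 / (4 * t₀))) '' J := by
  have h1 : Tendsto (fun n : ℕ => 1 / t₀ + 4 * s * (((2 : ℝ) ^ n) ^ 2)⁻¹) atTop (𝓝 (1 / t₀)) := by
    simpa using (tendsto_sq_two_pow_inv.const_mul (4 * s)).const_add (1 / t₀)
  have h0 : 1 / t₀ ≠ 0 := one_div_ne_zero ht
  have h2 : Tendsto (fun n : ℕ => (1 / t₀ + 4 * s * (((2 : ℝ) ^ n) ^ 2)⁻¹)⁻¹) atTop (𝓝 t₀) := by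
    simpa using h1.inv₀ h0
  filter_upwards [h2.eventually hJ] with n hn
  refine ⟨_, hn, ?_⟩
  have h3 : ((2 : ℝ) ^ n) ^ 2 ≠ 0 := by positivity
  simp only []
  rw [div_mul_eq_div_div, div_inv_eq_mul]
  field_simp
  ring

/-- A Schrödinger estimate bounds the extension of functions supported in an annulus. -/
theorem SchrodingerBounded.lintegral_fullExt_le {ψ : Rd d → ℝ} (hψ : IsDyadicCutoff ψ)
    {p q α ν a b : ℝ} (hp : 1 < p) (hq : 0 < q) (hν : 0 < ν) (hab : a < b)
    (hα : α = d * (1 - 1 / p - 1 / q) - 2 / q) (hS : SchrodingerBounded d ψ p q α ν a b) :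
    ∃ C : ℝ≥0∞, C ≠ ⊤ ∧ ∀ h : Rd d → ℂ, MemLp h (ENNReal.ofReal p) volume →
      Integrable h → (∀ y, h y ≠ 0 → 2 ≤ ‖y‖ ∧ ‖y‖ ≤ 4) →
      ∫⁻ z, ‖fullExt h z‖ₑ ^ q ≤ C * nq p h ^ q := by
  -- The time `0` must be avoided, since the pseudoconformal map is singular there; another interior
  -- point is used when the midpoint vanishes.
  obtain ⟨t₀, ht₀, htab⟩ : ∃ t₀ : ℝ, t₀ ≠ 0 ∧ t₀ ∈ Ioo a b := by
    by_cases h : (a + b) / 2 = 0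
    · exact ⟨(a + 3 * b) / 4, by intro h'; linarith, by constructor <;> linarith⟩
    · exact ⟨(a + b) / 2, h, by constructor <;> linarith⟩
  have hta := abs_pos.2 ht₀
  obtain ⟨δ, hδ, hδa, hδb, hδt⟩ : ∃ δ : ℝ, 0 < δ ∧ a ≤ t₀ - δ ∧ t₀ + δ ≤ b ∧ δ ≤ |t₀| / 2 := by
    refine ⟨min (min (t₀ - a) (b - t₀)) (|t₀| / 2), ?_, ?_, ?_, min_le_right _ _⟩
    · exact lt_min (lt_min (by linarith [htab.1]) (by linarith [htab.2])) (by linarith)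
    · linarith [min_le_left (min (t₀ - a) (b - t₀)) (|t₀| / 2), min_le_left (t₀ - a) (b - t₀)]
    · linarith [min_le_left (min (t₀ - a) (b - t₀)) (|t₀| / 2), min_le_right (t₀ - a) (b - t₀)]
  set J := Icc (t₀ - δ) (t₀ + δ) with hJ
  have hJm : ∀ t ∈ J, |t₀| / 2 ≤ |t| ∧ |t| ≤ 2 * |t₀| := by
    intro t ht
    have h1 : |t - t₀| ≤ δ := abs_le.2 ⟨by linarith [ht.1], by linarith [ht.2]⟩
    have h2 := abs_sub_abs_le_abs_sub t t₀
    have h3 := abs_sub_abs_le_abs_sub t₀ t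
    rw [abs_sub_comm] at h3
    constructor <;> linarith
  -- At `x = ρ y` the datum has local frequency `-ρ y / (2 t₀)`. Multiplied by `|t₀| / ρ` it has
  -- size `‖y‖ / 2 ∈ [1, 2]` for `2 ≤ ‖y‖ ≤ 4`, where `annCut` equals `1`.
  set χ : Rd d → ℂ := fun ξ => annCut (|t₀| • ξ) with hχd
  have hχ : ContDiff ℝ ∞ χ := contDiff_annCut.comp (contDiff_const_smul _)
  have hc : HasCompactSupport χ := hasCompactSupport_annCut.comp_smul hta.ne'
  have hs : ∀ ξ, χ ξ ≠ 0 → 1 / (4 * |t₀|) ≤ ‖ξ‖ ∧ ‖ξ‖ ≤ 4 / |t₀| := by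
    intro ξ hξ
    have h0 : ‖|t₀| • ξ‖ = ‖ξ‖ * |t₀| := by rw [norm_smul, Real.norm_eq_abs, abs_abs, mul_comm]
    rw [div_le_iff₀ (by positivity), le_div_iff₀ hta]
    constructor
    · by_contra! hcon
      apply hξ
      simp only [hχd, annCut]
      rw [lowCut_eq_one, lowCut_eq_one, sub_self]
      · rw [norm_smul, h0, Real.norm_of_nonneg (by norm_num)]; linarith
      · rw [h0]; linarith
    · by_contra! hcon
      apply hξ
      simp only [hχd, annCut]
      rw [lowCut_eq_zero, lowCut_eq_zero, sub_self]
      · rw [norm_smul, h0, Real.norm_of_nonneg (by norm_num)]; linarith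
      · rw [h0]; linarith
  obtain ⟨C, hCt, hC⟩ := hS.lintegral_averagedExt_le hψ hp hq hν hα hχ hc
    (by positivity : 0 < 1 / (4 * |t₀|)) hs (1 / (4 * t₀)) (half_pos hta) measurableSet_Icc
    (Icc_subset_Icc hδa hδb) hJm
  refine ⟨C, hCt, fun h hh hhi hsupp => ?_⟩
  set S : ℕ → Set ℝ := fun n =>
    (fun t : ℝ => (2 ^ n) ^ 2 / (4 * t) - (2 ^ n) ^ 2 * (1 / (4 * t₀))) '' J with hSd
  have hSm : ∀ n, MeasurableSet (S n) := by
    intro n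
    refine (isCompact_Icc.image_of_continuousOn ?_).measurableSet
    refine ContinuousOn.sub (continuousOn_const.div (by fun_prop) fun t ht => ?_) continuousOn_const
    have : 0 < |t| := (half_pos hta).trans_le (hJm t ht).1
    simpa using abs_pos.1 this
  have hcont := continuous_averagedExt hχ hc hhi
  set F : ℕ → Rd d × ℝ → ℝ≥0∞ := fun n z =>
    ‖averagedExt χ h (((2 ^ n) ^ 2)⁻¹, 1 / (4 * t₀) + z.2 * ((2 ^ n) ^ 2)⁻¹, z.1, z.2)‖ₑ ^ q with hF
  have hFm : ∀ n, Measurable (F n) := by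
    intro n
    refine (Continuous.measurable ?_).enorm.pow_const q
    fun_prop
  have hGm : ∀ n, Measurable ((Prod.snd ⁻¹' S n).indicator (F n)) := fun n =>
    (hFm n).indicator (measurable_snd (hSm n))
  have hone : ∀ y, h y ≠ 0 → χ (-(2 * (1 / (4 * t₀))) • y) = 1 := by
    intro y hy
    have h1 := hsupp y hy
    have h2 : ‖|t₀| • -(2 * (1 / (4 * t₀))) • y‖ = ‖y‖ / 2 := by
      rw [norm_smul, norm_smul, norm_neg, Real.norm_eq_abs, abs_abs, norm_mul, norm_div,
        norm_mul, Real.norm_eq_abs t₀]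
      norm_num
      field_simp
      norm_num
    exact annCut_eq_one (by rw [h2]; linarith) (by rw [h2]; linarith)
  have hlim : ∀ z, Tendsto (fun n => (Prod.snd ⁻¹' S n).indicator (F n) z) atTop
      (𝓝 (‖fullExt h z‖ₑ ^ q)) := by
    rintro ⟨ξ, s⟩
    have h1 : Tendsto (fun n : ℕ => averagedExt χ h ((((2 : ℝ) ^ n) ^ 2)⁻¹,
        1 / (4 * t₀) + s * (((2 : ℝ) ^ n) ^ 2)⁻¹, ξ, s)) atTop (𝓝 (fullExt h (ξ, s))) := by
      rw [← averagedExt_zero hχ hc hhi hone ξ s]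
      have h2 : Continuous fun r : ℝ => averagedExt χ h (r, 1 / (4 * t₀) + s * r, ξ, s) := by
        fun_prop
      have h3 := (h2.tendsto 0).comp tendsto_sq_two_pow_inv
      simpa [Function.comp_def] using h3
    refine ((ENNReal.continuous_rpow_const.tendsto _).comp
      ((continuous_enorm.tendsto _).comp h1)).congr' ?_
    filter_upwards [eventually_mem_pseudoconformal_image ht₀
      (Icc_mem_nhds (by linarith) (by linarith) : J ∈ 𝓝 t₀) s] with n hn
    rw [indicator_of_mem (by exact hn)]
    rfl
  have hint : ∀ n, ∫⁻ z, (Prod.snd ⁻¹' S n).indicator (F n) z ≤ C * nq p h ^ q := by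
    intro n
    rw [Measure.volume_eq_prod, lintegral_prod_symm _ (hGm n).aemeasurable]
    refine le_trans (le_of_eq ?_) (hC n h hh hhi)
    rw [← lintegral_indicator (hSm n)]
    refine lintegral_congr fun s => ?_
    by_cases hs' : s ∈ S n
    · rw [indicator_of_mem (by exact hs')]
      exact lintegral_congr fun ξ => indicator_of_mem (by exact hs') _
    · rw [indicator_of_notMem (by exact hs')]
      exact (lintegral_congr fun ξ => indicator_of_notMem (by exact hs') _).trans lintegral_zero
  calc ∫⁻ z, ‖fullExt h z‖ₑ ^ q
      = ∫⁻ z, liminf (fun n => (Prod.snd ⁻¹' S n).indicator (F n) z) atTop :=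
        lintegral_congr fun z => (hlim z).liminf_eq.symm
    _ ≤ liminf (fun n => ∫⁻ z, (Prod.snd ⁻¹' S n).indicator (F n) z) atTop :=
        lintegral_liminf_le hGm
    _ ≤ liminf (fun _ : ℕ => C * nq p h ^ q) atTop :=
        liminf_le_liminf (Eventually.of_forall hint)
    _ = _ := liminf_const _

/-! ### Galilean invariance and the adjoint restriction estimate -/

/-- Galilean invariance: completing the square in `‖y + v‖²` shears `ξ` by `2 s v`, a measure
preserving map at each `s`, and leaves a unimodular factor. -/
theorem norm_fullExt_comp_sub (h : Rd d → ℂ) (v ξ : Rd d) (s : ℝ) :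
    ‖fullExt (fun y => h (y - v)) (ξ, s)‖ = ‖fullExt h (ξ - (2 * s) • v, s)‖ := by
  have h1 : fullExt (fun y => h (y - v)) (ξ, s)
      = Complex.exp (Complex.I * ((s * ‖v‖ ^ 2 - ⟪ξ, v⟫ : ℝ) : ℂ)) *
        fullExt h (ξ - (2 * s) • v, s) := by
    rw [fullExt, ← integral_add_right_eq_self _ v, fullExt, ← integral_const_mul]
    congr 1; ext y
    rw [add_sub_cancel_right, mul_left_comm, ← Complex.exp_add, ← mul_add, ← Complex.ofReal_add]
    congr 4
    rw [norm_add_sq_real, inner_add_right, inner_sub_left, real_inner_smul_left,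
      real_inner_comm v y]
    ring
  rw [h1, norm_mul, norm_exp_I_mul_ofReal, one_mul]

theorem lintegral_fullExt_comp_sub {h : Rd d → ℂ} (hh : Integrable h) (v : Rd d) (q : ℝ) :
    ∫⁻ z, ‖fullExt (fun y => h (y - v)) z‖ₑ ^ q = ∫⁻ z, ‖fullExt h z‖ₑ ^ q := by
  have hm : ∀ {g : Rd d → ℂ}, Integrable g → AEMeasurable (fun z => ‖fullExt g z‖ₑ ^ q)
      ((volume : Measure (Rd d)).prod (volume : Measure ℝ)) := fun hg =>
    ((continuous_fullExt hg).measurable.enorm.pow_const q).aemeasurable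
  rw [Measure.volume_eq_prod, lintegral_prod_symm _ (hm (hh.comp_sub_right v)),
    lintegral_prod_symm _ (hm hh)]
  refine lintegral_congr fun s => ?_
  rw [← lintegral_sub_right_eq_self (fun ξ => ‖fullExt h (ξ, s)‖ₑ ^ q) ((2 * s) • v)]
  refine lintegral_congr fun ξ => ?_
  rw [← ofReal_norm, norm_fullExt_comp_sub, ofReal_norm]

theorem extensionOp_eq_fullExt_indicator (f : Rd d → ℂ) :
    extensionOp f = fullExt ((Metric.closedBall (0 : Rd d) 1).indicator f) := by
  ext z
  rw [extensionOp, fullExt, ← integral_indicator Metric.isClosed_closedBall.measurableSet]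
  congr 1; ext y
  by_cases hy : y ∈ Metric.closedBall (0 : Rd d) 1
  · rw [indicator_of_mem hy, indicator_of_mem hy]
  · rw [indicator_of_notMem hy, indicator_of_notMem hy, zero_mul]

theorem SchrodingerBounded.adjointRestriction (hd : 1 ≤ d) {ψ : Rd d → ℝ} (hψ : IsDyadicCutoff ψ)
    {p q ν a b : ℝ} (hp : 1 < p) (hq : 0 < q) (hν : 0 < ν) (hab : a < b)
    (hS : SchrodingerBounded d ψ p q (d * (1 - 1 / p - 1 / q) - 2 / q) ν a b) :
    AdjointRestriction d p q := by
  obtain ⟨C, hCt, hC⟩ := hS.lintegral_fullExt_le hψ hp hq hν hab rfl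
  have hK : C ^ (1 / q) ≠ ⊤ := ENNReal.rpow_ne_top_of_nonneg (by positivity) hCt
  refine ⟨(C ^ (1 / q)).toNNReal, fun f hf => ?_⟩
  set g := (Metric.closedBall (0 : Rd d) 1).indicator f with hg
  have hgs : ∀ y, g y ≠ 0 → ‖y‖ ≤ 1 := fun y hy => by
    simpa using mem_of_indicator_ne_zero hy
  have hgp : MemLp g (ENNReal.ofReal p) volume :=
    hf.indicator Metric.isClosed_closedBall.measurableSet
  have hgi : Integrable g := integrable_of_memLp_of_bounded_support (z := 0) (R := 1) hp.le hgp
    (by simpa using hgs)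
  -- Translation by a vector of length `3` carries the unit ball into the annulus `2 ≤ ‖y‖ ≤ 4`;
  -- such a coordinate vector exists because `1 ≤ d`.
  set v : Rd d := EuclideanSpace.single ⟨0, hd⟩ 3 with hv
  have hvn : ‖v‖ = 3 := by simp [hv]
  clear_value v g
  have hmp := measurePreserving_sub_right (volume : Measure (Rd d)) v
  have hsupp : ∀ y, g (y - v) ≠ 0 → 2 ≤ ‖y‖ ∧ ‖y‖ ≤ 4 := by
    intro y hy
    have h1 := hgs _ hy
    have h2 := norm_sub_norm_le v y
    have h3 := norm_sub_norm_le y v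
    rw [norm_sub_rev] at h2
    constructor <;> linarith
  have hle := hC (fun y => g (y - v)) (hgp.comp_measurePreserving hmp) (hgi.comp_sub_right v) hsupp
  have hnq : nq p (fun y => g (y - v)) = nq p g :=
    eLpNorm_comp_measurePreserving hgp.1 hmp
  rw [lintegral_fullExt_comp_sub hgi, hnq] at hle
  have hmain : eLpNorm (extensionOp f) (ENNReal.ofReal q) volume
      ≤ C ^ (1 / q) * eLpNorm f (ENNReal.ofReal p) volume := by
    rw [extensionOp_eq_fullExt_indicator, ← hg, eLpNorm_ofReal_eq hq]
    refine (ENNReal.rpow_le_rpow hle (one_div_nonneg.2 hq.le)).trans ?_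
    rw [ENNReal.mul_rpow_of_nonneg _ _ (by positivity), ← ENNReal.rpow_mul,
      mul_one_div_cancel hq.ne', ENNReal.rpow_one]
    gcongr
    rw [hg]
    exact eLpNorm_indicator_le f
  rw [ENNReal.coe_toNNReal hK]
  refine ⟨⟨?_, hmain.trans_lt (ENNReal.mul_lt_top hK.lt_top hf.2)⟩, hmain⟩
  rw [extensionOp_eq_fullExt_indicator, ← hg]
  exact (continuous_fullExt hgi).aestronglyMeasurable

end

theorem theorem1p1 (d : ℕ) (hd : 1 ≤ d) (p q : ℝ) (hp : 2 ≤ p) (hpq : p ≤ q)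
    (ν : ℝ) (hν : 0 < ν) (hν2 : ν ≤ 2) (a b : ℝ) (hab : a < b)
    (ψ : Rd d → ℝ) (hψ : IsDyadicCutoff ψ) :
    AdjointRestriction d p q ↔
      SchrodingerBounded d ψ p q (d * (1 - 1 / p - 1 / q) - 2 / q) ν a b :=
  ⟨fun h => h.schrodingerBounded hd hp hpq hν hν2 a b hψ,
    fun h => h.adjointRestriction hd hψ (by linarith) (by linarith) hν hab⟩
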